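/- A Boolean relation of arity $r\ge 0$ is a set $R\subseteq\{0,1\}^r$; it is non-zero-valid if $(0,\dots,0)\notin R$. The relation $R$ is mergeable if for all $\alpha,\beta,\gamma,\delta\in R$ with $\alpha\wedge\delta\le\beta\le\alpha$ and $\beta\wedge\gamma\le\delta\le\gamma$ (all operations and comparisons coordinatewise) we have $\alpha\wedge(\beta\vee\gamma)\in R$. It is zero-closed on position $i$ if replacing the $i$-th entry of any tuple of $R$ by $0$ gives a tuple of $R$. A constraint language is a finite set of Boolean relations; it is mergeable if all its relations are. A formula over $\Gamma$ is a finite conjunction of constraints $R(x_1,\dots,x_r)$ with $R\in\Gamma$ and variables $x_1,\dots,x_r$, not necessarily distinct; the weight of an assignment is the number of variables it sets to $1$. For a formula $\mathcal F$ and a relation $R$, let $\mathfrak F(\mathcal F,R)$ be the set of tuples of variables obtained from the $R$-constraints $R(x_1,\dots,x_r)$ of $\mathcal F$ by deleting from $(x_1,\dots,x_r)$ the entries in all positions on which $R$ is zero-closed. **Theorem.** Let $\Gamma$ be a mergeable constraint language with maximum arity $d$. There are a mergeable constraint language $\Gamma'\supseteq\Gamma$, also with maximum arity $d$, a constant $C$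 (both depending only on $\Gamma$), and a polynomial-time algorithm that, given a formula $\mathcal F$ over $\Gamma$ and an integer $k\ge 0$ (numbers and variable names written in binary), computes a formula $\mathcal F'$ over $\Gamma'$ all of whose variables occur in $\mathcal F$, such that 1. every assignment of weight at most $k$ to the variables of $\mathcal F$ satisfies $\mathcal F$ if and only if it satisfies $\mathcal F'$; 2. $|\mathfrak F(\mathcal F',R)|\le C\cdot\max(k,1)^d$ for every non-zero-valid relation $R$ that occurs in $\mathcal F'$; that is, $|\mathfrak F(\mathcal F',R)|\in O(k^d)$. -/

import Mathlib

namespace MinOnes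

/-- A relation over the Boolean domain: an arity together with a set of tuples. -/
@[ext]
structure BoolRel where
  arity : ℕ
  tuples : Set (Fin arity → Bool)

namespace BoolRel

/-- The merge operation applies to `α, β, γ, δ` if `α ∧ δ ≤ β ≤ α` and `β ∧ γ ≤ δ ≤ γ`
(pointwise); it then produces `α ∧ (β ∨ γ)`. A relation is mergeable if it contains the
produced tuple for any four of its tuples to which the operation applies. -/
def Mergeable (R : BoolRel) : Prop :=
  ∀ α ∈ R.tuples, ∀ β ∈ R.tuples, ∀ γ ∈ R.tuples, ∀ δ ∈ R.tuples,
    α ⊓ δ ≤ β → β ≤ α → β ⊓ γ ≤ δ → δ ≤ γ → α ⊓ (β ⊔ γ) ∈ R.tuples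

/-- A relation is zero-valid if it contains the all-zero tuple. -/
def ZeroValid (R : BoolRel) : Prop :=
  (fun _ => false) ∈ R.tuples

/-- A relation is zero-closed on position `i` if setting the `i`-th entry of any of its
tuples to zero gives a tuple of the relation again. -/
def ZeroClosedAt (R : BoolRel) (i : Fin R.arity) : Prop :=
  ∀ t ∈ R.tuples, Function.update t i false ∈ R.tuples

/-- The positions on which `R` is not zero-closed, i.e. the positions of its
non-zero-closed core. -/
def CorePos (R : BoolRel) : Type :=
  {i : Fin R.arity // ¬ R.ZeroClosedAt i}

end BoolRel

/-- A (finite) Boolean constraint language is mergeable if all of its relations are. -/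
def MergeableLanguage (Γ : Finset BoolRel) : Prop :=
  ∀ R ∈ Γ, R.Mergeable

/-- The maximum arity of the relations of a constraint language (`0` for the empty one). -/
def maxArity (Γ : Finset BoolRel) : ℕ :=
  Γ.sup BoolRel.arity

/-- A constraint over `Γ`: a relation of `Γ` applied to a tuple of variables, repetitions
allowed. Variables are natural numbers. -/
structure Constraint (Γ : Finset BoolRel) where
  rel : Γ
  args : Fin rel.1.arity → ℕ

/-- A formula over `Γ`: a finite conjunction of constraints over `Γ`. -/
abbrev Formula (Γ : Finset BoolRel) : Type :=
  List (Constraint Γ)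

variable {Γ : Finset BoolRel}

/-- A constraint holds under `φ` if the tuple of the values of its variables is in its
relation. -/
def Constraint.Holds (φ : ℕ → Bool) (c : Constraint Γ) : Prop :=
  (fun i => φ (c.args i)) ∈ c.rel.1.tuples

namespace Formula

/-- The set of variables that occur in a formula. -/
def vars (F : Formula Γ) : Finset ℕ :=
  (F.flatMap fun c => List.ofFn c.args).toFinset

/-- `φ` satisfies `F` if every constraint of `F` holds under `φ`. -/
def Satisfies (φ : ℕ → Bool) (F : Formula Γ) : Prop :=
  ∀ c ∈ F, c.Holds φ

/-- The weight of `φ` as an assignment to the variables of `F`: the number of variables of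
`F` that `φ` sets to true. -/
def weight (φ : ℕ → Bool) (F : Formula Γ) : ℕ :=
  (F.vars.filter fun x => φ x = true).card

/-- The set of all tuples of variables to which the non-zero-closed core of `R` is applied in
the `R`-constraints of `F`: each `R`-constraint contributes the tuple of its variables in the
positions on which `R` is not zero-closed. -/
def cores (F : Formula Γ) (R : Γ) : Set (R.1.CorePos → ℕ) :=
  {t | ∃ args : Fin R.1.arity → ℕ, (⟨R, args⟩ : Constraint Γ) ∈ F ∧ t = fun i => args i.1}

theorem cores_finite (F : Formula Γ) (R : Γ) : (F.cores R).Finite := by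
  have h : {c : Constraint Γ | c ∈ F}.Finite := List.finite_toSet F
  have hinj : Function.Injective (fun a : Fin R.1.arity → ℕ => (⟨R, a⟩ : Constraint Γ)) := by
    intro a b hab
    simpa using hab
  refine ((h.preimage hinj.injOn).image
    (fun (a : Fin R.1.arity → ℕ) (i : R.1.CorePos) => a i.1)).subset ?_
  rintro t ⟨a, ha, rfl⟩
  exact ⟨a, ha, rfl⟩

end Formula

/-- The alphabet in which formulas over `Γ` are written: one symbol for each relation of `Γ`,
the two bits, and a delimiter. -/
inductive Symb (Γ : Finset BoolRel) : Type
  | rel (R : Γ)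
  | bit (b : Bool)
  | comma

/-- A natural number in binary, followed by the delimiter. -/
def encodeNumber (Γ : Finset BoolRel) (n : ℕ) : List (Symb Γ) :=
  (Computability.encodeNat n).map Symb.bit ++ [Symb.comma]

/-- A constraint is written as the symbol of its relation followed by its variables. -/
def encodeConstraint (c : Constraint Γ) : List (Symb Γ) :=
  Symb.rel c.rel :: (List.ofFn c.args).flatMap (encodeNumber Γ)

/-- A formula is written as the sequence of its constraints. -/
def encodeFormula (F : Formula Γ) : List (Symb Γ) :=
  F.flatMap encodeConstraint

/-- An instance `(F, k)` is written as `k` in binary, followed by `F`. -/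
def encodeInstance (p : Formula Γ × ℕ) : List (Symb Γ) :=
  encodeNumber Γ p.2 ++ encodeFormula p.1

/-- `f` is computed by a (multi-stack) Turing machine whose number of steps is bounded by a
polynomial in the length of the encoded input. -/
def PolyTimeComputable {α β A B : Type} (ea : α → List A) (eb : β → List B) (f : α → β) : Prop :=
  Nonempty (Turing.TM2ComputableInPolyTime ea eb f)

end MinOnes

/-! Fix a relation `R` that is not zero-valid and a proper subset `S` of its core. Suppose more than
`k` of the `R`-constraints agree with a constraint `c` on the positions `S`, while their variable
sets on the remaining core positions ("petals") are pairwise disjoint. An assignment of weight at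
most `k` misses the petals of one of them completely. If it satisfies the formula, zeroing that
constraint's non-core positions shows that the tuple of `c`, with everything outside `S` set to
zero, still lies in `R` (`stable_of_heavy`). For such assignments `c` can therefore be strengthened
from `R` to `R.stable S`.

Mergeability makes this strengthening useful. The relation `R.stable S` is the intersection of
`R.down S` and `R.side S` (`Mergeable.mem_down_and_mem_side_iff`), and both of these are mergeable
of the same arity (`Mergeable.down`, `Mergeable.side`). The core of `R.down S` is contained in `S`,
hence smaller than that of `R`, and `R.side S` is zero-valid. The language of all mergeable
relations of arity at most `d` is finite and closed under both operations, so it serves as the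
target language.

One pass treats one pair `(R, S)`. A constraint of `R` survives only if the greedy search for it
found at most `k` disjoint petals. By maximality of the greedy family, the at most `d * k` variables
of these petals meet the petals of every `R`-constraint in the same class (`isHit_pass`). Passes run
through the pairs by decreasing core size. Later passes create only zero-valid relations and
relations with strictly smaller core, so no hitting property is destroyed (`isHit_foldl_corePass`).
In the end all pairs are hit at once, and branching over a core position and an element of the
hitting set, at most `d * (d * k)` choices on each of at most `d` levels, bounds the number of core
tuples (`card_coreTuples_le`).

The number of passes depends only on `d` and each pass at most doubles the formula, so the algorithm
is polynomial. This is certified by a small structured language on stacks, compiled step for step to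
`Turing.TM2` (`Prog.Exec.code_reaches`), in which every subroutine has an explicit cost bound. -/

namespace MinOnes

/-! ### Structured stack programs and their compilation to Turing machines -/

/-- Structured programs over stacks indexed by `K` with alphabet `A` and a finite memory `σ`. -/
inductive Prog (K A σ : Type) : Type
  | push (k : K) (f : σ → A)
  | pop (k : K) (f : σ → Option A → σ)
  | peek (k : K) (f : σ → Option A → σ)
  | load (f : σ → σ)
  | seq (p q : Prog K A σ)
  | ite (b : σ → Bool) (p q : Prog K A σ)
  | loop (b : σ → Bool) (p : Prog K A σ)

namespace Prog

variable {K A σ : Type} [DecidableEq K]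

/-- `Exec p s n t`: the program `p` leads from the state `s` to the state `t` in `n` steps. -/
inductive Exec : Prog K A σ → σ × (K → List A) → ℕ → σ × (K → List A) → Prop
  | push (k f v S) : Exec (push k f) (v, S) 1 (v, Function.update S k (f v :: S k))
  | pop (k f v S) :
      Exec (pop k f) (v, S) 1 (f v (S k).head?, Function.update S k (S k).tail)
  | peek (k f v S) : Exec (peek k f) (v, S) 1 (f v (S k).head?, S)
  | load (f v S) : Exec (load f) (v, S) 1 (f v, S)
  | seq {p q s t u m n} : Exec p s m t → Exec q t n u → Exec (seq p q) s (m + n) u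
  | ite_true {b p q s n t} : b s.1 = true → Exec p s n t → Exec (ite b p q) s (1 + n) t
  | ite_false {b p q s n t} : b s.1 = false → Exec q s n t → Exec (ite b p q) s (1 + n) t
  | loop_false {b p s} : b s.1 = false → Exec (loop b p) s 1 s
  | loop_true {b p s m t n u} : b s.1 = true → Exec p s m t → Exec (loop b p) t n u →
      Exec (loop b p) s (1 + m + n) u

/-- The program `p` leads from `s` to `t` in at most `n` steps. -/
def Runs (p : Prog K A σ) (s : σ × (K → List A)) (n : ℕ) (t : σ × (K → List A)) : Prop :=
  ∃ m ≤ n, Exec p s m t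

/-- The control points of a program. -/
def Label : Prog K A σ → Type
  | push _ _ | pop _ _ | peek _ _ | load _ => Unit
  | seq p q => p.Label ⊕ q.Label
  | ite _ p q => Option (p.Label ⊕ q.Label)
  | loop _ p => Option p.Label

instance Label.fintype : (p : Prog K A σ) → Fintype p.Label
  | push _ _ | pop _ _ | peek _ _ | load _ => inferInstanceAs (Fintype Unit)
  | seq p q =>
    letI := Label.fintype p
    letI := Label.fintype q
    inferInstanceAs (Fintype (p.Label ⊕ q.Label))
  | ite _ p q =>
    letI := Label.fintype p
    letI := Label.fintype q
    inferInstanceAs (Fintype (Option (p.Label ⊕ q.Label)))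
  | loop _ p =>
    letI := Label.fintype p
    inferInstanceAs (Fintype (Option p.Label))

/-- The control point at which a program starts. -/
def entry : (p : Prog K A σ) → p.Label
  | push _ _ | pop _ _ | peek _ _ | load _ => ()
  | seq p _ => Sum.inl p.entry
  | ite _ _ _ | loop _ _ => none

/-- The alphabets of the stacks of the compiled machine: the input stack `none` has its own
alphabet. -/
abbrev Alph (A₀ A : Type) : Option K → Type
  | none => A₀
  | some _ => A

open Turing.TM2.Stmt in
/-- The compiled program. Control points are embedded into the labels `Λ` of the machine by
`emb`, and `out` is the label at which the execution continues. -/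
def code (A₀ : Type) {Λ : Type} : (p : Prog K A σ) → (p.Label → Λ) → Λ → p.Label →
    Turing.TM2.Stmt (Alph (K := K) A₀ A) Λ (σ × Option A)
  | push k f, _, out, _ => .push (some k) (fun v => f v.1) (goto fun _ => out)
  | pop k f, _, out, _ => .pop (some k) (fun v a => (f v.1 a, v.2)) (goto fun _ => out)
  | peek k f, _, out, _ => .peek (some k) (fun v a => (f v.1 a, v.2)) (goto fun _ => out)
  | load f, _, out, _ => .load (fun v => (f v.1, v.2)) (goto fun _ => out)
  | seq p q, emb, out, l =>
    match l with
    | Sum.inl l => code A₀ p (fun l => emb (Sum.inl l)) (emb (Sum.inr q.entry)) l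
    | Sum.inr l => code A₀ q (fun l => emb (Sum.inr l)) out l
  | ite b p q, emb, out, l =>
    match l with
    | none => branch (fun v => b v.1) (goto fun _ => emb (some (Sum.inl p.entry)))
        (goto fun _ => emb (some (Sum.inr q.entry)))
    | some (Sum.inl l) => code A₀ p (fun l => emb (some (Sum.inl l))) out l
    | some (Sum.inr l) => code A₀ q (fun l => emb (some (Sum.inr l))) out l
  | loop b p, emb, out, l =>
    match l with
    | none => branch (fun v => b v.1) (goto fun _ => emb (some p.entry)) (goto fun _ => out)
    | some l => code A₀ p (fun l => emb (some l)) (emb none) l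

/-- The contents of the stacks of the compiled machine, given those of the program. -/
def stackOf {A₀ : Type} (w : List A₀) (S : K → List A) : ∀ k : Option K, List (Alph A₀ A k)
  | none => w
  | some k => S k

theorem stackOf_update {A₀ : Type} (w : List A₀) (S : K → List A) (k : K) (x : List A) :
    Function.update (stackOf w S) (some k) x = stackOf w (Function.update S k x) := by
  funext j
  rcases j with _ | j
  · rw [Function.update_of_ne (by simp)]; rfl
  · by_cases h : j = k
    · subst h; simp [stackOf]
    · rw [Function.update_of_ne (by simpa using h)]
      simp [stackOf, Function.update_of_ne h]

theorem iterate_bind_add {α : Type} (f : α → Option α) {m n : ℕ} {a b : α} {c : Option α}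
    (h₁ : (flip bind f)^[m] (some a) = some b) (h₂ : (flip bind f)^[n] (some b) = c) :
    (flip bind f)^[m + n] (some a) = c := by
  rw [Nat.add_comm, Function.iterate_add_apply, h₁, h₂]

-- The costs in `Exec` are chosen so that every basic instruction and every test is exactly one
-- machine step; sequencing costs nothing because it is only a choice of exit label. The component
-- `x` of the memory is never touched by compiled code.
open Turing in
theorem Exec.code_reaches {A₀ Λ : Type} (M : Λ → TM2.Stmt (Alph (K := K) A₀ A) Λ (σ × Option A))
    (w : List A₀) (x : Option A) {p : Prog K A σ} {s t : σ × (K → List A)} {n : ℕ}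
    (h : Exec p s n t) (emb : p.Label → Λ) (out : Λ)
    (hM : ∀ l, M (emb l) = code A₀ p emb out l) :
    (flip bind (TM2.step M))^[n] (some ⟨some (emb p.entry), (s.1, x), stackOf w s.2⟩) =
      some ⟨some out, (t.1, x), stackOf w t.2⟩ := by
  induction h generalizing out with
  | push k f v S =>
    simp only [Function.iterate_one, flip, Option.bind_eq_bind, Option.bind_some, TM2.step, hM, code,
      TM2.stepAux, stackOf_update, stackOf]
  | pop k f v S =>
    simp only [Function.iterate_one, flip, Option.bind_eq_bind, Option.bind_some, TM2.step, hM, code,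
      TM2.stepAux, stackOf_update, stackOf]
  | peek k f v S =>
    simp only [Function.iterate_one, flip, Option.bind_eq_bind, Option.bind_some, TM2.step, hM, code,
      TM2.stepAux, stackOf]
  | load f v S =>
    simp only [Function.iterate_one, flip, Option.bind_eq_bind, Option.bind_some, TM2.step, hM, code,
      TM2.stepAux]
  | @seq p q s t u m n h₁ h₂ ih₁ ih₂ =>
    exact iterate_bind_add _ (ih₁ (fun l => emb (Sum.inl l)) _ fun l => hM (Sum.inl l))
      (ih₂ (fun l => emb (Sum.inr l)) out fun l => hM (Sum.inr l))
  | @ite_true b p q s n t hb h ih =>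
    refine iterate_bind_add _ ?_ (ih (fun l => emb (some (Sum.inl l))) out
      fun l => hM (some (Sum.inl l)))
    have h₀ := hM none
    simp only [code] at h₀
    simp [flip, entry, h₀, hb]
  | @ite_false b p q s n t hb h ih =>
    refine iterate_bind_add _ ?_ (ih (fun l => emb (some (Sum.inr l))) out
      fun l => hM (some (Sum.inr l)))
    have h₀ := hM none
    simp only [code] at h₀
    simp [flip, entry, h₀, hb]
  | @loop_false b p s hb =>
    have h₀ := hM none
    simp only [code] at h₀
    simp [flip, entry, h₀, hb]
  | @loop_true b p s m t n u hb h₁ h₂ ih₁ ih₂ =>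
    refine iterate_bind_add _ (iterate_bind_add _ ?_
      (ih₁ (fun l => emb (some l)) _ fun l => hM (some l))) (ih₂ emb out hM)
    have h₀ := hM none
    simp only [code] at h₀
    simp [flip, entry, h₀, hb]

open Turing.TM2.Stmt in
/-- The statements of the machine that moves its input to the stack `i` (which reverses it), runs
the program `p` and halts. -/
def machine {A₀ : Type} (p : Prog K A σ) (v₀ : σ) (ι : A₀ → A) (i : K) (a₀ : A) :
    p.Label ⊕ Bool → Turing.TM2.Stmt (Alph (K := K) A₀ A) (p.Label ⊕ Bool) (σ × Option A)
  | Sum.inl l => code A₀ p Sum.inl (Sum.inr true) l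
  | Sum.inr false => .pop none (fun v a => (v.1, Option.map ι a))
      (branch (fun v => v.2.isNone) (goto fun _ => Sum.inl p.entry)
        (.push (some i) (fun v => v.2.getD a₀) (goto fun _ => Sum.inr false)))
  | Sum.inr true => .load (fun _ => (v₀, none)) halt

/-- The bundled machine with the statements `Prog.machine` and the output stack `o`. -/
def toFinTM2 [Fintype K] [Fintype σ] [Fintype A] {A₀ : Type} [Fintype A₀] (p : Prog K A σ)
    (v₀ : σ) (ι : A₀ → A) (i o : K) (a₀ : A) : Turing.FinTM2 where
  K := Option K
  k₀ := none
  k₁ := some o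
  Γ := Alph A₀ A
  Λ := p.Label ⊕ Bool
  main := Sum.inr false
  σ := σ × Option A
  initialState := (v₀, none)
  Γk₀Fin := inferInstanceAs (Fintype A₀)
  m := machine p v₀ ι i a₀

/-- The stacks of which only `k` is not empty. -/
def only (k : K) (x : List A) : K → List A :=
  fun j => if j = k then x else []

-- One step per input symbol and one more to notice that the input stack is empty. Popping from one
-- stack and pushing to another reverses the word.
open Turing in
theorem machine_load {A₀ : Type} (p : Prog K A σ) (v₀ : σ) (ι : A₀ → A) (i : K) (a₀ : A) (w : List A₀) (x : List A)
    (y : Option A) :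
    (flip bind (TM2.step (p.machine v₀ ι i a₀)))^[w.length + 1]
        (some ⟨some (Sum.inr false), (v₀, y), stackOf w (only i x)⟩) =
      some ⟨some (Sum.inl p.entry), (v₀, none),
        stackOf [] (only i ((w.map ι).reverse ++ x))⟩ := by
  have hupd (u : List A₀) (S : K → List A) :
      Function.update (stackOf (A := A) u S) none u.tail = stackOf u.tail S := by
    funext j
    rcases j with _ | j
    · simp [stackOf]
    · rw [Function.update_of_ne (by simp)]; rfl
  induction w generalizing x y with
  | nil =>
    simp only [List.length_nil, Nat.zero_add, Function.iterate_one, flip, Option.bind_eq_bind,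
      Option.bind_some, TM2.step, machine, TM2.stepAux]
    rw [show (stackOf (A₀ := A₀) [] (only i x) none) = [] from rfl]
    have := hupd [] (only i x)
    simp only [List.tail_nil] at this
    simp [this]
  | cons a w ih =>
    rw [List.length_cons, Nat.add_right_comm, Nat.add_comm]
    refine iterate_bind_add _ (b := ⟨some (Sum.inr false), (v₀, some (ι a)),
      stackOf w (only i (ι a :: x))⟩) ?_ ?_
    · simp only [Function.iterate_one, flip, Option.bind_eq_bind,
        Option.bind_some, TM2.step, machine, TM2.stepAux]
      rw [show (stackOf (a :: w) (only i x) none) = a :: w from rfl]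
      have := hupd (a :: w) (only i x)
      simp only [List.tail_cons] at this
      simp only [List.tail_cons, List.head?_cons, Option.map_some, Option.isNone_some, cond_false,
        Option.getD_some, this]
      rw [stackOf_update]
      congr 3
      funext j
      by_cases h : j = i
      · subst h; simp [only, stackOf]
      · simp [only, h]
    · simpa using ih (ι a :: x) (some (ι a))

-- The bridge from cost bounds to the required notion of computability: the program sees its input
-- reversed on stack `i`, must leave its output as the only nonempty stack, and may end with
-- arbitrary memory.
open Turing in
theorem polyTimeComputable_of_runs [Fintype K] [Fintype σ] [Fintype A] {α β A₀ : Type}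
    [Fintype A₀] (p : Prog K A σ) (v₀ : σ) (ι : A₀ → A) (i o : K) (a₀ : A)
    (ea : α → List A₀) (eb : β → List A) (f : α → β) (T : Polynomial ℕ)
    (h : ∀ a, ∃ v, Runs p (v₀, only i ((ea a).map ι).reverse) (T.eval (ea a).length)
      (v, only o (eb (f a)))) :
    PolyTimeComputable ea eb f := by
  refine ⟨⟨⟨p.toFinTM2 v₀ ι i o a₀, Equiv.refl A₀, Equiv.refl A⟩,
    T + Polynomial.X + 2, fun a => ?_⟩⟩
  -- The step count has to be supplied as data, so the existential is rearranged to let `choose`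
  -- extract it.
  have h' : ∃ n ≤ T.eval (ea a).length, ∃ v, Exec p (v₀, only i ((ea a).map ι).reverse) n
      (v, only o (eb (f a))) := by
    obtain ⟨v, n, hn, hv⟩ := h a
    exact ⟨n, hn, v, hv⟩
  -- Besides the program itself, loading takes the input length plus one steps, and resetting the
  -- memory and halting takes one.
  have hle : (ea a).length + 1 + h'.choose + 1 ≤
      (T + Polynomial.X + 2).eval (ea a).length := by
    have := h'.choose_spec.1
    simp only [Polynomial.eval_add, Polynomial.eval_X, Polynomial.eval_ofNat]
    omega
  refine ⟨⟨(ea a).length + 1 + h'.choose + 1, ?_⟩, hle⟩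
  · obtain ⟨hn, v, hv⟩ := h'.choose_spec
    have h₁ := p.machine_load v₀ ι i a₀ (ea a) [] none
    rw [List.append_nil] at h₁
    have h₂ := hv.code_reaches (p.machine v₀ ι i a₀) [] none Sum.inl (Sum.inr true)
      (fun l => rfl)
    refine iterate_bind_add _ (iterate_bind_add _ (Eq.trans ?_ h₁) h₂) ?_
    · congr 2
      simp only [initList, toFinTM2]
      congr 1
      funext k
      rcases k with _ | k
      · simp [stackOf]; rfl
      · simp [stackOf, only]
    · change some (⟨none, (v₀, none), stackOf [] (only o (eb (f a)))⟩ :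
        TM2.Cfg (Alph A₀ A) (p.Label ⊕ Bool) (σ × Option A)) = some _
      simp only [toFinTM2, haltList]
      congr 2
      funext k
      rcases k with _ | k
      · simp [stackOf]
      · by_cases hk : k = o
        · subst hk; simp [stackOf, only]; rfl
        · simp [stackOf, only, hk]

end Prog

/-! ### Splitting a mergeable relation along a set of positions -/

namespace BoolRel

/-- The positions on which `R` is not zero-closed, as natural numbers. -/
noncomputable def core (R : BoolRel) : Finset ℕ := by
  classical exact {i ∈ Finset.range R.arity | ∃ h : i < R.arity, ¬ R.ZeroClosedAt ⟨i, h⟩}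

theorem mem_core {R : BoolRel} {i : ℕ} :
    i ∈ R.core ↔ ∃ h : i < R.arity, ¬ R.ZeroClosedAt ⟨i, h⟩ := by
  simp only [core, Finset.mem_filter, Finset.mem_range, and_iff_right_iff_imp]
  exact fun ⟨h, _⟩ => h

/-- The tuple `t` with the entries in positions outside of `S` replaced by zero. -/
def mask {n : ℕ} (S : Finset ℕ) (t : Fin n → Bool) : Fin n → Bool :=
  fun i => if i.1 ∈ S then t i else false

/-- Zero-closedness allows clearing one position outside the core at a time, so the positions below
`m` are cleared by induction on `m`. -/
theorem mask_core_mem {R : BoolRel} {t : Fin R.arity → Bool} (ht : t ∈ R.tuples) :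
    mask R.core t ∈ R.tuples := by
  suffices h : ∀ m ≤ R.arity, (fun i => if i.1 < m then mask R.core t i else t i) ∈ R.tuples by
    simpa using h R.arity le_rfl
  intro m
  induction m with
  | zero => simpa using ht
  | succ m ih =>
    intro hm
    have h := ih (by omega)
    by_cases hc : m ∈ R.core
    · convert h using 2 with i
      rcases lt_trichotomy i.1 m with hi | hi | hi
      · simp [hi, Nat.lt_succ_of_lt hi]
      · simp [hi, mask, hc]
      · rw [if_neg (by omega), if_neg (by omega)]
    · have hz : R.ZeroClosedAt ⟨m, hm⟩ := by
        by_contra hz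
        exact hc (mem_core.2 ⟨hm, hz⟩)
      convert hz _ h using 2 with i
      by_cases hi : i.1 = m
      · have : i = ⟨m, hm⟩ := Fin.ext hi
        subst this
        simp [mask, hc]
      · rw [Function.update_of_ne (by simpa [Fin.ext_iff] using hi)]
        rcases lt_or_gt_of_ne hi with hi | hi
        · simp [hi, Nat.lt_succ_of_lt hi]
        · rw [if_neg (by omega), if_neg (by omega)]

/-- The tuples of `R` that stay in `R` when their entries outside of `S` are set to zero. -/
def stable (R : BoolRel) (S : Finset ℕ) : Set (Fin R.arity → Bool) :=
  {t | t ∈ R.tuples ∧ mask S t ∈ R.tuples}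

/-- The relation that the tuples of `R.stable S` generate by setting entries outside of `S` to
zero. -/
def down (R : BoolRel) (S : Finset ℕ) : BoolRel :=
  ⟨R.arity, {t | ∃ u ∈ R.stable S, ∀ i, (i.1 ∈ S → t i = u i) ∧ t i ≤ u i}⟩

/-- The tuples whose part outside of `S` may be intersected with every tuple of `R.stable S`. -/
def side (R : BoolRel) (S : Finset ℕ) : BoolRel :=
  ⟨R.arity, {u | ∀ v ∈ R.stable S, (fun i => if i.1 ∈ S then v i else v i && u i) ∈ R.stable S}⟩

variable {R : BoolRel} {S : Finset ℕ}

theorem mask_mem_stable {t : Fin R.arity → Bool} (ht : t ∈ R.stable S) :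
    mask S t ∈ R.stable S := by
  refine ⟨ht.2, ?_⟩
  convert ht.2 using 1
  funext i
  by_cases hi : i.1 ∈ S <;> simp [mask, hi]

/-- A coordinatewise form of mergeability: its hypothesis is a statement about a few Booleans, which
`decide` can settle. -/
theorem Mergeable.mem (hR : R.Mergeable) {α β γ δ ρ : Fin R.arity → Bool}
    (hα : α ∈ R.tuples) (hβ : β ∈ R.tuples) (hγ : γ ∈ R.tuples) (hδ : δ ∈ R.tuples)
    (h : ∀ i, (α i && δ i) ≤ β i ∧ β i ≤ α i ∧ (β i && γ i) ≤ δ i ∧ δ i ≤ γ i ∧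
      ρ i = (α i && (β i || γ i))) : ρ ∈ R.tuples := by
  have : ρ = α ⊓ (β ⊔ γ) := funext fun i => (h i).2.2.2.2
  rw [this]
  exact hR α hα β hβ γ hγ δ hδ (fun i => (h i).1) (fun i => (h i).2.1) (fun i => (h i).2.2.1)
    (fun i => (h i).2.2.2.1)

/-- Masking commutes with the merge operation and preserves its side conditions, so the same merge
can be applied to the masked tuples. -/
theorem Mergeable.mem_stable (hR : R.Mergeable) {α β γ δ ρ : Fin R.arity → Bool}
    (hα : α ∈ R.stable S) (hβ : β ∈ R.stable S) (hγ : γ ∈ R.stable S) (hδ : δ ∈ R.stable S)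
    (h : ∀ i, (α i && δ i) ≤ β i ∧ β i ≤ α i ∧ (β i && γ i) ≤ δ i ∧ δ i ≤ γ i ∧
      ρ i = (α i && (β i || γ i))) : ρ ∈ R.stable S := by
  refine ⟨hR.mem hα.1 hβ.1 hγ.1 hδ.1 h, hR.mem hα.2 hβ.2 hγ.2 hδ.2 fun i => ?_⟩
  by_cases hi : i.1 ∈ S
  · simpa only [mask, hi, if_true] using h i
  · simp [mask, hi]

/-- Merge `α`, `mask S α`, `γ`, `mask S γ`. On `S` the result is `α ∧ (α ∨ γ) = α`; elsewhere the
masks vanish and `α ∧ γ` remains. -/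
theorem Mergeable.inf_mem_stable (hR : R.Mergeable) {α γ : Fin R.arity → Bool}
    (hα : α ∈ R.stable S) (hγ : γ ∈ R.stable S) :
    (fun i => if i.1 ∈ S then α i else α i && γ i) ∈ R.stable S := by
  refine hR.mem_stable hα (mask_mem_stable hα) hγ (mask_mem_stable hγ) fun i => ?_
  by_cases hi : i.1 ∈ S
  · simp only [mask, hi, if_true]
    generalize α i = a, γ i = c
    revert a c; decide
  · simp only [mask, hi, if_false]
    generalize α i = a, γ i = c
    revert a c; decide

/-- Outside `S` the merge conditions can be weakened to `β ≤ α`. A first merge with `β` and `δ`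
masked is correct on `S` but loses `β` elsewhere. A second merge, with the first result in place of
`γ`, restores it: its fourth tuple is `β` on `S` and `β ∧ γ` elsewhere. -/
theorem Mergeable.merge_mem_stable (hR : R.Mergeable) {α β γ δ : Fin R.arity → Bool}
    (hα : α ∈ R.stable S) (hβ : β ∈ R.stable S) (hγ : γ ∈ R.stable S) (hδ : δ ∈ R.stable S)
    (h : ∀ i : Fin R.arity, i.1 ∈ S →
      (α i && δ i) ≤ β i ∧ β i ≤ α i ∧ (β i && γ i) ≤ δ i ∧ δ i ≤ γ i)
    (hβα : ∀ i : Fin R.arity, i.1 ∉ S → β i ≤ α i) :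
    (fun i => α i && (β i || γ i)) ∈ R.stable S := by
  have h₁ : (fun i => if i.1 ∈ S then α i && (β i || γ i) else α i && γ i) ∈ R.stable S := by
    refine hR.mem_stable hα (mask_mem_stable hβ) hγ (mask_mem_stable hδ) fun i => ?_
    by_cases hi : i.1 ∈ S
    · obtain ⟨h1, h2, h3, h4⟩ := h i hi
      simp only [mask, hi, if_true]
      exact ⟨h1, h2, h3, h4, trivial⟩
    · simp [mask, hi]
  refine hR.mem_stable hα hβ h₁ (hR.inf_mem_stable hβ hγ) fun i => ?_
  by_cases hi : i.1 ∈ S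
  · have := h i hi
    simp only [hi, if_true]
    revert this
    generalize α i = a, β i = b, γ i = c, δ i = d
    revert a b c d; decide
  · have := hβα i hi
    simp only [hi, if_false]
    revert this
    generalize α i = a, β i = b, γ i = c
    revert a b c; decide

theorem Mergeable.down (hR : R.Mergeable) (S : Finset ℕ) : (R.down S).Mergeable := by
  rintro α ⟨a, ha, hα⟩ β ⟨b, hb, hβ⟩ γ ⟨c, hc, hγ⟩ δ ⟨d, hd, hδ⟩ h₁ h₂ h₃ h₄
  -- Outside `S` nothing relates the witnesses `a` and `b`. Cutting `b` down by `a` there yields the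
  -- inequality that `merge_mem_stable` needs, and `β` stays below the cut witness because `β ≤ α ≤
  -- a`.
  have hb' := hR.inf_mem_stable hb ha
  refine ⟨_, hR.merge_mem_stable ha hb' hc hd (fun i hi => ?_) (fun i hi => ?_), fun i => ?_⟩
  · simp only [hi, if_true, ← (hα i).1 hi, ← (hβ i).1 hi, ← (hγ i).1 hi, ← (hδ i).1 hi]
    exact ⟨h₁ i, h₂ i, h₃ i, h₄ i⟩
  · simp only [hi, if_false]
    generalize a i = a, b i = b
    revert a b; decide
  · by_cases hi : i.1 ∈ S
    · simp only [hi, if_true, ← (hα i).1 hi, ← (hβ i).1 hi, ← (hγ i).1 hi]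
      exact ⟨fun _ => rfl, le_rfl⟩
    · refine ⟨fun h => absurd h hi, ?_⟩
      have e₁ : α i ≤ a i := (hα i).2
      have e₂ : β i ≤ b i := (hβ i).2
      have e₃ : γ i ≤ c i := (hγ i).2
      have e₄ : β i ≤ α i := h₂ i
      simp only [hi, if_false]
      change (α i && (β i || γ i)) ≤ _
      revert e₁ e₂ e₃ e₄
      generalize a i = a', b i = b', c i = c', α i = x, β i = y, γ i = z
      revert a' b' c' x y z; decide

/-- For fixed `v`, the four tuples obtained from `v` coincide on `S` and are the meets of `v` with
`α`, `β`, `γ`, `δ` elsewhere; meeting with `v` preserves the merge conditions and commutes with the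
merge. -/
theorem Mergeable.side (hR : R.Mergeable) (S : Finset ℕ) : (R.side S).Mergeable := by
  intro α hα β hβ γ hγ δ hδ h₁ h₂ h₃ h₄ v hv
  refine hR.mem_stable (hα v hv) (hβ v hv) (hγ v hv) (hδ v hv) fun i => ?_
  by_cases hi : i.1 ∈ S
  · simp [hi]
  · have e₁ : (α i && δ i) ≤ β i := h₁ i
    have e₂ : β i ≤ α i := h₂ i
    have e₃ : (β i && γ i) ≤ δ i := h₃ i
    have e₄ : δ i ≤ γ i := h₄ i
    have e₅ : (α ⊓ (β ⊔ γ)) i = (α i && (β i || γ i)) := rfl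
    simp only [hi, if_false, e₅]
    revert e₁ e₂ e₃ e₄
    generalize α i = a, β i = b, γ i = c, δ i = d, v i = x
    revert a b c d x; decide

theorem zeroValid_side (R : BoolRel) (S : Finset ℕ) : (R.side S).ZeroValid := by
  intro v hv
  convert mask_mem_stable hv using 1
  funext i
  simp [mask]

theorem core_down_subset (R : BoolRel) (S : Finset ℕ) : (R.down S).core ⊆ S := by
  intro i hi
  obtain ⟨h, hz⟩ := mem_core.1 hi
  by_contra hS
  refine hz ?_
  rintro t ⟨u, hu, ht⟩
  refine ⟨u, hu, fun (j : Fin (R.down S).arity) => ?_⟩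
  by_cases hj : j = ⟨i, h⟩
  · subst hj
    rw [Function.update_self]
    exact ⟨fun h => absurd h hS, Bool.false_le _⟩
  · rw [Function.update_of_ne hj]
    exact ht j

/-- If `u` witnesses that `t` is in `R.down S`, then `t` agrees with `u` on `S` and equals `u ∧ t`
elsewhere, which is exactly what membership in `R.side S` produces from `u`. The converse is
`inf_mem_stable`. -/
theorem Mergeable.mem_down_and_mem_side_iff (hR : R.Mergeable) {t : Fin R.arity → Bool} :
    t ∈ (R.down S).tuples ∧ t ∈ (R.side S).tuples ↔ t ∈ R.stable S := by
  constructor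
  · rintro ⟨⟨u, hu, ht⟩, hs⟩
    convert hs u hu using 1
    funext i
    by_cases hi : i.1 ∈ S
    · simp [hi, (ht i).1 hi]
    · have := (ht i).2
      simp only [hi, if_false]
      revert this
      generalize u i = a, t i = b
      revert a b; decide
  · exact fun ht => ⟨⟨t, ht, fun i => ⟨fun _ => rfl, le_rfl⟩⟩, fun v hv => hR.inf_mem_stable hv ht⟩

end BoolRel

/-! ### One replacement pass: greedy search, correctness and counting -/

/-- The variable of a constraint in position `i`, and `0` if there is no such position. -/
def Constraint.arg {G : Finset BoolRel} (c : Constraint G) (i : ℕ) : ℕ :=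
  if h : i < c.rel.1.arity then c.args ⟨i, h⟩ else 0

/-- The relation `Q` applied to the variables of `c`. -/
def Constraint.withRel {G : Finset BoolRel} (c : Constraint G) (Q : G) : Constraint G :=
  ⟨Q, fun i => c.arg i⟩

theorem Constraint.arg_of_lt {G : Finset BoolRel} (c : Constraint G) {i : ℕ}
    (h : i < c.rel.1.arity) : c.arg i = c.args ⟨i, h⟩ :=
  dif_pos h

theorem Constraint.withRel_arg {G : Finset BoolRel} (c : Constraint G) {Q : G} {i : ℕ}
    (h : i < Q.1.arity) : (c.withRel Q).arg i = c.arg i := by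
  rw [Constraint.arg_of_lt _ h]; rfl

theorem Formula.mem_vars {G : Finset BoolRel} {F : Formula G} {x : ℕ} :
    x ∈ F.vars ↔ ∃ c ∈ F, ∃ i < c.rel.1.arity, x = c.arg i := by
  simp only [Formula.vars, List.mem_toFinset, List.mem_flatMap, List.mem_ofFn]
  constructor
  · rintro ⟨c, hc, i, rfl⟩
    exact ⟨c, hc, i, i.2, by rw [c.arg_of_lt i.2]⟩
  · rintro ⟨c, hc, i, hi, rfl⟩
    exact ⟨c, hc, ⟨i, hi⟩, by rw [c.arg_of_lt hi]⟩

section Pass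

open scoped Classical

variable {G : Finset BoolRel} {d : ℕ}

/-- The elements of `S` below `d`, as a list. -/
def positions (d : ℕ) (S : Finset ℕ) : List (Fin d) :=
  (List.finRange d).filter fun i => decide (i.1 ∈ S)

theorem mem_positions {S : Finset ℕ} {i : Fin d} : i ∈ positions d S ↔ i.1 ∈ S := by
  simp [positions]

theorem length_positions_le (d : ℕ) (S : Finset ℕ) : (positions d S).length ≤ d :=
  (List.length_filter_le _ _).trans (by simp)

/-- `c'` is an `R`-constraint that has the same variables as `c` in the positions `S`. -/
def Agrees (R : G) (S : List (Fin d)) (c c' : Constraint G) : Prop :=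
  c'.rel = R ∧ ∀ i ∈ S, c.arg i = c'.arg i

/-- One step of the greedy search for `R`-constraints that agree with `c` in the positions `S`
and have pairwise disjoint sets of variables in the positions `P`. The state consists of the
variables used so far, the number of constraints still allowed, and whether it was exceeded. -/
noncomputable def collect (R : G) (S P : List (Fin d)) (c : Constraint G)
    (s : List ℕ × ℕ × Bool) (c' : Constraint G) : List ℕ × ℕ × Bool :=
  if Agrees R S c c' ∧ ∀ i ∈ P, c'.arg i ∉ s.1 then
    ((P.map fun i : Fin d => c'.arg i).reverse ++ s.1, s.2.1 - 1, s.2.2 || decide (s.2.1 = 0))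
  else s

/-- The greedy search finds more than `k` constraints of `F`. -/
noncomputable def heavy (R : G) (S P : List (Fin d)) (k : ℕ) (F : Formula G)
    (c : Constraint G) : Bool :=
  (F.foldl (collect R S P c) ([], k, false)).2.2

/-- Replace each `R`-constraint for which the greedy search is successful by the applications of
`Q₁` and `Q₂` to the same variables. -/
noncomputable def pass (R Q₁ Q₂ : G) (S P : List (Fin d)) (k : ℕ) (F : Formula G) : Formula G :=
  F.foldl (fun O c => if c.rel = R ∧ heavy R S P k F c = true then
    c.withRel Q₂ :: c.withRel Q₁ :: O else c :: O) []

/-- The invariant of the greedy search, with `L` the constraints accepted so far. The last clause is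
maximality: any agreeing constraint, accepted or rejected, meets the recorded variables. It needs `P
≠ []`, as an accepted constraint without petals would leave no trace. -/
theorem foldl_collect (R : G) (S P : List (Fin d)) (c : Constraint G) (k : ℕ) (F : Formula G)
    (hP : P ≠ []) : ∃ L : List (Constraint G), (∀ c' ∈ L, c' ∈ F ∧ Agrees R S c c') ∧
      L.Pairwise (fun c₁ c₂ => ∀ i ∈ P, ∀ j ∈ P, c₁.arg i ≠ c₂.arg j) ∧
      (F.foldl (collect R S P c) ([], k, false)).1.length = P.length * L.length ∧
      (∀ c' ∈ L, ∀ i ∈ P, c'.arg i ∈ (F.foldl (collect R S P c) ([], k, false)).1) ∧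
      (F.foldl (collect R S P c) ([], k, false)).2 = (k - L.length, decide (k < L.length)) ∧
      ∀ c' ∈ F, Agrees R S c c' →
        ∃ i ∈ P, c'.arg i ∈ (F.foldl (collect R S P c) ([], k, false)).1 := by
  induction F using List.reverseRecOn with
  | nil => exact ⟨[], by simp⟩
  | append_singleton F x ih =>
    obtain ⟨L, h₁, h₂, h₃, h₄, h₅, h₆⟩ := ih
    simp only [List.foldl_append, List.foldl_cons, List.foldl_nil]
    generalize List.foldl (collect R S P c) ([], k, false) F = s at *
    obtain ⟨i₀, hi₀⟩ := List.exists_mem_of_ne_nil P hP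
    by_cases hx : Agrees R S c x ∧ ∀ i ∈ P, x.arg i ∉ s.1
    · rw [collect, if_pos hx]
      refine ⟨x :: L, ?_, ?_, ?_, ?_, ?_, ?_⟩
      · simp only [List.mem_cons, List.mem_append, List.not_mem_nil, or_false]
        rintro c' (rfl | hc')
        · exact ⟨Or.inr rfl, hx.1⟩
        · exact ⟨Or.inl (h₁ c' hc').1, (h₁ c' hc').2⟩
      · refine List.pairwise_cons.2 ⟨fun c' hc' i hi j hj h => ?_, h₂⟩
        exact hx.2 i hi (h ▸ h₄ c' hc' j hj)
      · simp [h₃, Nat.mul_add, Nat.add_comm]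
      · simp only [List.mem_cons, List.mem_append, List.mem_reverse, List.mem_map]
        rintro c' (rfl | hc') i hi
        · exact Or.inl ⟨i, hi, rfl⟩
        · exact Or.inr (h₄ c' hc' i hi)
      · rw [h₅]
        simp only [List.length_cons, Prod.mk.injEq]
        refine ⟨by omega, ?_⟩
        rw [← Bool.decide_or]
        exact decide_eq_decide.2 (by omega)
      · simp only [List.mem_append, List.mem_reverse, List.mem_map, List.mem_singleton]
        rintro c' (hc' | rfl) h
        · obtain ⟨i, hi, h⟩ := h₆ c' hc' h
          exact ⟨i, hi, Or.inr h⟩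
        · exact ⟨i₀, hi₀, Or.inl ⟨i₀, hi₀, rfl⟩⟩
    · rw [collect, if_neg hx]
      refine ⟨L, fun c' hc' => ⟨List.mem_append_left _ (h₁ c' hc').1, (h₁ c' hc').2⟩, h₂, h₃, h₄,
        h₅, fun c' hc' h => ?_⟩
      rcases List.mem_append.1 hc' with hc' | hc'
      · exact h₆ c' hc' h
      · rw [List.mem_singleton] at hc'
        subst hc'
        simp only [not_and, not_forall, not_not] at hx
        obtain ⟨i, hi, h⟩ := hx h
        exact ⟨i, hi, h⟩

theorem mem_pass {R Q₁ Q₂ : G} {S P : List (Fin d)} {k : ℕ} {F : Formula G} {x : Constraint G} :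
    x ∈ pass R Q₁ Q₂ S P k F ↔ ∃ c ∈ F, if c.rel = R ∧ heavy R S P k F c = true then
      x = c.withRel Q₁ ∨ x = c.withRel Q₂ else x = c := by
  -- The fold is generalized to `F'` and `O`, while heaviness continues to be measured in the fixed
  -- formula `F`.
  have h (F' O : Formula G) : x ∈ F'.foldl (fun O c =>
      if c.rel = R ∧ heavy R S P k F c = true then
        c.withRel Q₂ :: c.withRel Q₁ :: O else c :: O) O ↔ x ∈ O ∨
      ∃ c ∈ F', if c.rel = R ∧ heavy R S P k F c = true then
      x = c.withRel Q₁ ∨ x = c.withRel Q₂ else x = c := by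
    induction F' generalizing O with
    | nil => simp
    | cons c F' ih =>
      rw [List.foldl_cons, ih]
      by_cases hc : c.rel = R ∧ heavy R S P k F c = true
      · simp only [if_pos hc, List.mem_cons, exists_eq_or_imp]
        tauto
      · simp only [if_neg hc, List.mem_cons, exists_eq_or_imp]
        tauto
  rw [pass, h]
  simp

theorem vars_pass_subset {R Q₁ Q₂ : G} {S P : List (Fin d)} {k : ℕ} {F : Formula G}
    (h₁ : Q₁.1.arity = R.1.arity) (h₂ : Q₂.1.arity = R.1.arity) :
    (pass R Q₁ Q₂ S P k F).vars ⊆ F.vars := by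
  intro y hy
  obtain ⟨x, hx, i, hi, rfl⟩ := Formula.mem_vars.1 hy
  obtain ⟨c, hc, h⟩ := mem_pass.1 hx
  split_ifs at h with hR
  · rcases h with rfl | rfl
    · rw [c.withRel_arg (Q := Q₁) hi]
      exact Formula.mem_vars.2 ⟨c, hc, i, (hi.trans_eq h₁).trans_eq (by rw [hR.1]), rfl⟩
    · rw [c.withRel_arg (Q := Q₂) hi]
      exact Formula.mem_vars.2 ⟨c, hc, i, (hi.trans_eq h₂).trans_eq (by rw [hR.1]), rfl⟩
  · subst h
    exact Formula.mem_vars.2 ⟨x, hc, i, hi, rfl⟩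

/-- If the greedy search succeeds, then setting to zero the positions outside of `S` preserves
the tuple of each constraint in its scope. -/
theorem stable_of_heavy {R : G} {S : Finset ℕ} {k : ℕ} {F : Formula G}
    (hd : R.1.arity ≤ d) (hS : S ⊂ R.1.core) {c : Constraint G} (hc : c.rel = R)
    (hheavy : heavy R (positions d S) (positions d (R.1.core \ S)) k F c = true)
    {φ : ℕ → Bool} (hφ : F.Satisfies φ) {T : Finset ℕ} (hT : ∀ x ∈ F.vars, φ x = true → x ∈ T)
    (hTk : T.card ≤ k) :
    BoolRel.mask S (fun i : Fin R.1.arity => φ (c.arg i)) ∈ R.1.tuples := by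
  obtain ⟨p, hpc, hpS⟩ := Finset.exists_of_ssubset hS
  have hlt {i : ℕ} (hi : i ∈ R.1.core) : i < R.1.arity := (BoolRel.mem_core.1 hi).1
  have hP : positions d (R.1.core \ S) ≠ [] := by
    refine List.ne_nil_of_mem (a := ⟨p, (hlt hpc).trans_le hd⟩) ?_
    simp [mem_positions, hpc, hpS]
  obtain ⟨L, h₁, h₂, -, -, h₅, -⟩ :=
    foldl_collect R (positions d S) (positions d (R.1.core \ S)) c k F hP
  rw [heavy, h₅] at hheavy
  have hkL : k < L.length := of_decide_eq_true hheavy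
  -- Otherwise each of the more than `k` constraints in `L` has a true petal variable. These are
  -- distinct by disjointness and all lie in `T`, which has at most `k` elements.
  obtain ⟨c', hc'L, hc'⟩ : ∃ c' ∈ L, ∀ i ∈ R.1.core \ S, φ (c'.arg i) = false := by
    by_contra! hcon
    have hex (x : Constraint G) : ∃ v, x ∈ L → v ∈ T ∧ ∃ i ∈ positions d (R.1.core \ S),
        v = x.arg i := by
      by_cases hx : x ∈ L
      · obtain ⟨i, hi, hv⟩ := hcon x hx
        have hi' := hlt (Finset.mem_sdiff.1 hi).1
        refine ⟨x.arg i, fun _ => ⟨hT _ ?_ (by simpa using hv),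
          ⟨i, hi'.trans_le hd⟩, mem_positions.2 hi, rfl⟩⟩
        exact Formula.mem_vars.2 ⟨x, (h₁ x hx).1, i, by rw [(h₁ x hx).2.1]; exact hi', rfl⟩
      · exact ⟨0, fun h => absurd h hx⟩
    choose v hv using hex
    have hnd : (L.map v).Nodup := by
      refine List.pairwise_map.2 (h₂.imp_of_mem ?_)
      intro a b ha hb hab
      obtain ⟨-, i, hi, hi'⟩ := hv a ha
      obtain ⟨-, j, hj, hj'⟩ := hv b hb
      rw [hi', hj']
      exact hab i hi j hj
    have hle := Finset.card_le_card (s := (L.map v).toFinset) (t := T) (by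
      intro y hy
      simp only [List.mem_toFinset, List.mem_map] at hy
      obtain ⟨x, hx, rfl⟩ := hy
      exact (hv x hx).1)
    rw [List.toFinset_card_of_nodup hnd, List.length_map] at hle
    omega
  obtain ⟨hc'F, rfl, hag⟩ := h₁ c' hc'L
  -- The core-masked tuple of `c'` is the `S`-masked tuple of `c`: the two constraints agree on `S`,
  -- and the petals of `c'` are zero.
  have hmem := BoolRel.mask_core_mem (hφ c' hc'F)
  convert hmem using 1
  funext i
  simp only [BoolRel.mask]
  by_cases hi : i.1 ∈ S
  · rw [if_pos hi, if_pos (hS.1 hi), hag ⟨i, i.2.trans_le hd⟩ (mem_positions.2 hi),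
      c'.arg_of_lt i.2]
  · rw [if_neg hi]
    split_ifs with hi'
    · rw [← c'.arg_of_lt i.2, hc' i (by simp [hi, hi'])]
    · rfl

/-- Only the forward direction uses the weight bound. Conversely, the two replacing constraints
always imply the original one. The bound is phrased with a set `T` so that the same `T` serves for
all passes. -/
theorem satisfies_pass {R Q₁ Q₂ : G} {S : Finset ℕ} {k : ℕ} {F : Formula G}
    (hR : R.1.Mergeable) (hd : R.1.arity ≤ d) (hS : S ⊂ R.1.core)
    (h₁ : Q₁.1 = R.1.down S) (h₂ : Q₂.1 = R.1.side S)
    {φ : ℕ → Bool} {T : Finset ℕ} (hT : ∀ x ∈ F.vars, φ x = true → x ∈ T) (hTk : T.card ≤ k) :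
    F.Satisfies φ ↔
      (pass R Q₁ Q₂ (positions d S) (positions d (R.1.core \ S)) k F).Satisfies φ := by
  -- Since `Constraint.arg` takes natural numbers, the tuples seen by `Q₁`, `Q₂` and `R` agree
  -- definitionally after the substitution, without casts between arities.
  have key (c : Constraint G) (hc : c.rel = R) :
      (c.withRel Q₁).Holds φ ∧ (c.withRel Q₂).Holds φ ↔
        (fun i : Fin R.1.arity => φ (c.arg i)) ∈ R.1.stable S := by
    rw [← hR.mem_down_and_mem_side_iff]
    obtain ⟨Q₁, hQ₁⟩ := Q₁
    obtain ⟨Q₂, hQ₂⟩ := Q₂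
    simp only at h₁ h₂
    subst h₁ h₂
    exact Iff.rfl
  have holds_iff (c : Constraint G) (hc : c.rel = R) :
      c.Holds φ ↔ (fun i : Fin R.1.arity => φ (c.arg i)) ∈ R.1.tuples := by
    subst hc
    have : (fun i : Fin c.rel.1.arity => φ (c.arg i)) = fun i => φ (c.args i) := by
      funext i
      rw [c.arg_of_lt i.2]
    rw [this]
    exact Iff.rfl
  constructor
  · intro hφ x hx
    obtain ⟨c, hc, h⟩ := mem_pass.1 hx
    split_ifs at h with hcR
    · have := (key c hcR.1).2 ⟨(holds_iff c hcR.1).1 (hφ c hc),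
        stable_of_heavy hd hS hcR.1 hcR.2 hφ hT hTk⟩
      rcases h with rfl | rfl
      exacts [this.1, this.2]
    · exact h ▸ hφ c hc
  · intro hφ c hc
    by_cases hcR : c.rel = R ∧
        heavy R (positions d S) (positions d (R.1.core \ S)) k F c = true
    · have hQ₁ := hφ (c.withRel Q₁) (mem_pass.2 ⟨c, hc, by rw [if_pos hcR]; exact Or.inl rfl⟩)
      have hQ₂ := hφ (c.withRel Q₂) (mem_pass.2 ⟨c, hc, by rw [if_pos hcR]; exact Or.inr rfl⟩)
      exact (holds_iff c hcR.1).2 ((key c hcR.1).1 ⟨hQ₁, hQ₂⟩).1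
    · exact hφ c (mem_pass.2 ⟨c, hc, by rw [if_neg hcR]⟩)

/-- Each class of `R`-constraints of `F` that agree in the positions `S` is hit by at most `N`
variables in the other positions of the core of `R`. -/
def IsHit (N : ℕ) (R : G) (S : Finset ℕ) (F : Formula G) : Prop :=
  ∀ c ∈ F, c.rel = R → ∃ B : Finset ℕ, B.card ≤ N ∧ ∀ c' ∈ F, c'.rel = R →
    (∀ i ∈ S, c.arg i = c'.arg i) → ∃ i ∈ R.1.core \ S, c'.arg i ∈ B

/-- Deleting `R`-constraints cannot hurt, and constraints of other relations play no role; this is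
how the property survives later passes. -/
theorem IsHit.mono {N : ℕ} {R : G} {S : Finset ℕ} {F F' : Formula G} (h : IsHit N R S F)
    (hF : ∀ c ∈ F', c.rel = R → c ∈ F) : IsHit N R S F' := by
  intro c hc hcR
  obtain ⟨B, hB, h⟩ := h c (hF c hc hcR) hcR
  exact ⟨B, hB, fun c' hc' hc'R => h c' (hF c' hc' hc'R) hc'R⟩

theorem mem_of_mem_pass {R R' Q₁ Q₂ : G} {S P : List (Fin d)} {k : ℕ} {F : Formula G}
    (h₁ : Q₁ ≠ R') (h₂ : Q₂ ≠ R') {c : Constraint G} (hc : c ∈ pass R Q₁ Q₂ S P k F)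
    (hcR : c.rel = R') : c ∈ F := by
  obtain ⟨c', hc', h⟩ := mem_pass.1 hc
  split_ifs at h
  · rcases h with rfl | rfl
    exacts [absurd hcR h₁, absurd hcR h₂]
  · exact h ▸ hc'

/-- The recorded variables of the greedy search in the old formula form the hitting set. They number
at most `d` per accepted constraint, and a surviving constraint had at most `k` accepted. -/
theorem isHit_pass {R Q₁ Q₂ : G} {S : Finset ℕ} {k : ℕ} {F : Formula G}
    (hd : R.1.arity ≤ d) (hS : S ⊂ R.1.core) (h₁ : Q₁ ≠ R) (h₂ : Q₂ ≠ R) :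
    IsHit (d * k) R S
      (pass R Q₁ Q₂ (positions d S) (positions d (R.1.core \ S)) k F) := by
  obtain ⟨p, hpc, hpS⟩ := Finset.exists_of_ssubset hS
  have hlt {i : ℕ} (hi : i ∈ R.1.core) : i < R.1.arity := (BoolRel.mem_core.1 hi).1
  have hP : positions d (R.1.core \ S) ≠ [] := by
    refine List.ne_nil_of_mem (a := ⟨p, (hlt hpc).trans_le hd⟩) ?_
    simp [mem_positions, hpc, hpS]
  intro c hc hcR
  -- Neither `Q₁` nor `Q₂` is `R`, so an `R`-constraint of the new formula was kept, not created,
  -- and the search for it failed.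
  have hn : heavy R (positions d S) (positions d (R.1.core \ S)) k F c = false := by
    obtain ⟨c', hc', h⟩ := mem_pass.1 hc
    split_ifs at h with hh
    · rcases h with rfl | rfl
      exacts [absurd hcR h₁, absurd hcR h₂]
    · subst h
      simpa [hcR] using hh
  obtain ⟨L, -, -, h₃, -, h₅, h₆⟩ :=
    foldl_collect R (positions d S) (positions d (R.1.core \ S)) c k F hP
  rw [heavy, h₅] at hn
  have hL : L.length ≤ k := by simpa using hn
  refine ⟨(F.foldl (collect R (positions d S) (positions d (R.1.core \ S)) c)
    ([], k, false)).1.toFinset, ?_, fun c' hc' hc'R hag => ?_⟩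
  · refine (List.toFinset_card_le _).trans ?_
    rw [h₃]
    exact Nat.mul_le_mul (length_positions_le _ _) hL
  · obtain ⟨i, hi, h⟩ := h₆ c' (mem_of_mem_pass h₁ h₂ hc' hc'R)
      ⟨hc'R, fun i hi => hag i (mem_positions.1 hi)⟩
    exact ⟨i, mem_positions.1 hi, by simpa using h⟩

/-- The core tuples of the `R`-constraints of `F` that agree with `τ` in the positions `S`. -/
noncomputable def coreTuples (F : Formula G) (R : G) (S : Finset ℕ) (τ : ℕ → ℕ) :
    Finset (ℕ → ℕ) :=
  {c ∈ F.toFinset | c.rel = R ∧ ∀ i ∈ S, c.arg i = τ i}.image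
    fun c i => if i ∈ R.1.core then c.arg i else 0

theorem mem_coreTuples {F : Formula G} {R : G} {S : Finset ℕ} {τ t : ℕ → ℕ} :
    t ∈ coreTuples F R S τ ↔ ∃ c ∈ F, (c.rel = R ∧ ∀ i ∈ S, c.arg i = τ i) ∧
      (fun i => if i ∈ R.1.core then c.arg i else 0) = t := by
  simp [coreTuples, and_assoc]

/-- Induction on the number of core positions not yet fixed. Each tuple of a nonempty class takes a
value from the hitting set in some unfixed core position; fixing this position and value leaves at
most `d * N` subclasses. -/
theorem card_coreTuples_le {F : Formula G} {R : G} {N : ℕ} (hd : R.1.arity ≤ d)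
    (h : ∀ S, S ⊂ R.1.core → IsHit N R S F) (n : ℕ) (S : Finset ℕ) (hS : S ⊆ R.1.core)
    (hn : (R.1.core \ S).card = n) (τ : ℕ → ℕ) :
    (coreTuples F R S τ).card ≤ (d * N) ^ n := by
  induction n generalizing S τ with
  | zero =>
    have hSc : S = R.1.core :=
      hS.antisymm (Finset.sdiff_eq_empty_iff_subset.1 (Finset.card_eq_zero.1 hn))
    rw [pow_zero, Finset.card_le_one]
    have (t : ℕ → ℕ) (ht : t ∈ coreTuples F R S τ) :
        t = fun i => if i ∈ R.1.core then τ i else 0 := by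
      obtain ⟨c, -, ⟨-, hc⟩, rfl⟩ := mem_coreTuples.1 ht
      funext i
      split_ifs with hi
      · exact hc i (hSc ▸ hi)
      · rfl
    intro a ha b hb
    rw [this a ha, this b hb]
  | succ n ih =>
    rcases (coreTuples F R S τ).eq_empty_or_nonempty with he | ⟨t, ht⟩
    · simp [he]
    obtain ⟨c, hcF, ⟨hcR, hcτ⟩, -⟩ := mem_coreTuples.1 ht
    have hSs : S ⊂ R.1.core := by
      refine hS.ssubset_of_ne fun he => ?_
      simp [he] at hn
    obtain ⟨B, hB, hhit⟩ := h S hSs c hcF hcR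
    have hsub : coreTuples F R S τ ⊆ ((R.1.core \ S) ×ˢ B).biUnion fun p =>
        coreTuples F R (insert p.1 S) (Function.update τ p.1 p.2) := by
      intro u hu
      obtain ⟨c', hc'F, ⟨hc'R, hc'τ⟩, rfl⟩ := mem_coreTuples.1 hu
      obtain ⟨i, hi, hiB⟩ := hhit c' hc'F hc'R fun i hi => by rw [hcτ i hi, hc'τ i hi]
      refine Finset.mem_biUnion.2 ⟨(i, c'.arg i), Finset.mem_product.2 ⟨hi, hiB⟩,
        mem_coreTuples.2 ⟨c', hc'F, ⟨hc'R, fun j hj => ?_⟩, rfl⟩⟩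
      by_cases hji : j = i
      · subst hji; simp
      · rw [Function.update_of_ne hji]
        exact hc'τ j ((Finset.mem_insert.1 hj).resolve_left hji)
    refine (Finset.card_le_card hsub).trans ((Finset.card_biUnion_le_card_mul _ _ ((d * N) ^ n)
      ?_).trans ?_)
    · rintro ⟨i, v⟩ hp
      obtain ⟨hi, -⟩ := Finset.mem_product.1 hp
      refine ih _ (Finset.insert_subset (Finset.mem_sdiff.1 hi).1 hS) ?_ _
      rw [Finset.sdiff_insert, Finset.card_erase_of_mem hi, hn]
      rfl
    · rw [pow_succ, Nat.mul_comm, Finset.card_product]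
      refine Nat.mul_le_mul_left _ (Nat.mul_le_mul ?_ hB)
      refine (Finset.card_le_card (Finset.sdiff_subset.trans (Finset.filter_subset _ _))).trans ?_
      simpa using hd

theorem ncard_cores_le {F : Formula G} {R : G} {k : ℕ} (hd : R.1.arity ≤ d)
    (h : ∀ S, S ⊂ R.1.core → IsHit (d * k) R S F) :
    (F.cores R).ncard ≤ (d * d + 1) ^ d * (max k 1) ^ d := by
  have hsub : F.cores R ⊆ (fun (t : ℕ → ℕ) (i : R.1.CorePos) => t i.1.1) ''
      (coreTuples F R ∅ 0 : Set (ℕ → ℕ)) := by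
    rintro t ⟨a, ha, rfl⟩
    refine ⟨_, mem_coreTuples.2 ⟨_, ha, ⟨rfl, by simp⟩, rfl⟩, ?_⟩
    funext i
    have hi : i.1.1 ∈ R.1.core := BoolRel.mem_core.2 ⟨i.1.2, i.2⟩
    simp only [hi, if_true]
    exact Constraint.arg_of_lt _ i.1.2
  refine (Set.ncard_le_ncard hsub (Set.toFinite _)).trans ((Set.ncard_image_le
    (Set.toFinite _)).trans ?_)
  rw [Set.ncard_coe_finset]
  refine (card_coreTuples_le hd h _ ∅ (Finset.empty_subset _) rfl 0).trans ?_
  have hcard : (R.1.core \ ∅).card ≤ d := by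
    rw [Finset.sdiff_empty]
    exact (Finset.card_le_card (Finset.filter_subset _ _)).trans (by simpa using hd)
  rw [← Nat.mul_pow]
  -- The summand `1` and the maximum with `1` keep the base positive, so the exponent may be raised
  -- from the size of the core to `d`.
  have hle : d * (d * k) ≤ (d * d + 1) * max k 1 := by
    rw [← Nat.mul_assoc]
    exact Nat.mul_le_mul (Nat.le_succ _) (le_max_left _ _)
  refine (Nat.pow_le_pow_left hle _).trans (Nat.pow_le_pow_right ?_ hcard)
  exact Nat.mul_pos (Nat.succ_pos _) (by omega)

end Pass

/-! ### The schedule of passes and the kernel -/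

section Kernel

open scoped Classical

/-- All mergeable relations of arity at most `d`. -/
noncomputable def mergeableRels (d : ℕ) : Finset BoolRel :=
  Set.Finite.toFinset (s := {R : BoolRel | R.arity ≤ d ∧ R.Mergeable}) (by
    refine (Set.finite_range fun p : (Σ n : Fin (d + 1), Set (Fin n → Bool)) =>
      (⟨p.1, p.2⟩ : BoolRel)).subset ?_
    rintro R ⟨h, -⟩
    exact ⟨⟨⟨R.arity, Nat.lt_succ_of_le h⟩, R.tuples⟩, rfl⟩)

variable {d : ℕ}

theorem mem_mergeableRels {R : BoolRel} : R ∈ mergeableRels d ↔ R.arity ≤ d ∧ R.Mergeable := by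
  simp [mergeableRels]

/-- `BoolRel.down` on the mergeable relations of arity at most `d`. -/
noncomputable def downRel (R : mergeableRels d) (S : Finset ℕ) : mergeableRels d :=
  ⟨R.1.down S, mem_mergeableRels.2 ⟨(mem_mergeableRels.1 R.2).1,
    (mem_mergeableRels.1 R.2).2.down S⟩⟩

/-- `BoolRel.side` on the mergeable relations of arity at most `d`. -/
noncomputable def sideRel (R : mergeableRels d) (S : Finset ℕ) : mergeableRels d :=
  ⟨R.1.side S, mem_mergeableRels.2 ⟨(mem_mergeableRels.1 R.2).1,
    (mem_mergeableRels.1 R.2).2.side S⟩⟩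

/-- The pass that replaces the `R`-constraints for which many `R`-constraints agree in the
positions `S`, but are disjoint in the other positions of the core of `R`. -/
noncomputable def corePass (k : ℕ) (F : Formula (mergeableRels d))
    (p : mergeableRels d × Finset ℕ) : Formula (mergeableRels d) :=
  pass p.1 (downRel p.1 p.2) (sideRel p.1 p.2) (positions d p.2)
    (positions d (p.1.1.core \ p.2)) k F

/-- The relations and sets of positions for which passes are made, relations with larger core
first. -/
noncomputable def schedule (d : ℕ) : List (mergeableRels d × Finset ℕ) :=
  List.insertionSort (fun p q => q.1.1.core.card ≤ p.1.1.core.card)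
    {p ∈ (Finset.univ : Finset (mergeableRels d)) ×ˢ (Finset.range d).powerset |
      ¬ p.1.1.ZeroValid ∧ p.2 ⊂ p.1.1.core}.toList

theorem mem_schedule {p : mergeableRels d × Finset ℕ} :
    p ∈ schedule d ↔ ¬ p.1.1.ZeroValid ∧ p.2 ⊂ p.1.1.core := by
  simp only [schedule, List.mem_insertionSort, Finset.mem_toList, Finset.mem_filter,
    Finset.mem_product, Finset.mem_univ, true_and, Finset.mem_powerset, and_iff_right_iff_imp]
  rintro ⟨-, h⟩ i hi
  obtain ⟨hlt, -⟩ := BoolRel.mem_core.1 (h.1 hi)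
  exact Finset.mem_range.2 (hlt.trans_le (mem_mergeableRels.1 p.1.2).1)

theorem pairwise_schedule (d : ℕ) :
    (schedule d).Pairwise fun p q => q.1.1.core.card ≤ p.1.1.core.card := by
  have : Std.Total fun p q : mergeableRels d × Finset ℕ =>
    q.1.1.core.card ≤ p.1.1.core.card := ⟨fun p q => le_total _ _⟩
  have : IsTrans _ fun p q : mergeableRels d × Finset ℕ =>
    q.1.1.core.card ≤ p.1.1.core.card := ⟨fun p q r h₁ h₂ => h₂.trans h₁⟩
  exact List.pairwise_insertionSort _ _

/-- The result of all passes. -/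
noncomputable def kernel (k : ℕ) (F : Formula (mergeableRels d)) : Formula (mergeableRels d) :=
  (schedule d).foldl (corePass k) F

theorem vars_corePass_subset (k : ℕ) (F : Formula (mergeableRels d))
    (p : mergeableRels d × Finset ℕ) : (corePass k F p).vars ⊆ F.vars :=
  vars_pass_subset rfl rfl

theorem vars_foldl_corePass_subset (k : ℕ) (l : List (mergeableRels d × Finset ℕ))
    (F : Formula (mergeableRels d)) : (l.foldl (corePass k) F).vars ⊆ F.vars := by
  induction l generalizing F with
  | nil => exact subset_rfl
  | cons p l ih => exact (ih _).trans (vars_corePass_subset k F p)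

theorem satisfies_foldl_corePass {k : ℕ} {l : List (mergeableRels d × Finset ℕ)}
    (hl : ∀ p ∈ l, p ∈ schedule d) {F : Formula (mergeableRels d)} {φ : ℕ → Bool} {T : Finset ℕ}
    (hT : ∀ x ∈ F.vars, φ x = true → x ∈ T) (hTk : T.card ≤ k) :
    F.Satisfies φ ↔ (l.foldl (corePass k) F).Satisfies φ := by
  induction l generalizing F with
  | nil => exact Iff.rfl
  | cons p l ih =>
    have hR := mem_mergeableRels.1 p.1.2
    have hp := mem_schedule.1 (hl p List.mem_cons_self)
    rw [List.foldl_cons, ← ih (fun q hq => hl q (List.mem_cons_of_mem _ hq))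
      fun x hx => hT x (vars_corePass_subset k F p hx)]
    exact satisfies_pass hR.2 hR.1 hp.2 rfl rfl hT hTk

/-- The core of the new relation lies in `p.2`, a proper subset of the core of `p.1`, so it is too
small to be the core of `q.1`. -/
theorem downRel_ne {p q : mergeableRels d × Finset ℕ} (hp : p ∈ schedule d)
    (hpq : p.1.1.core.card ≤ q.1.1.core.card) : downRel p.1 p.2 ≠ q.1 := by
  intro h
  have h₁ := Finset.card_le_card (BoolRel.core_down_subset p.1.1 p.2)
  have h₂ := Finset.card_lt_card (mem_schedule.1 hp).2
  have h₃ : (downRel p.1 p.2).1.core.card = q.1.1.core.card := by rw [h]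
  change (p.1.1.down p.2).core.card = _ at h₃
  omega

theorem sideRel_ne {p : mergeableRels d × Finset ℕ} {R : mergeableRels d}
    (hR : ¬ R.1.ZeroValid) : sideRel p.1 p.2 ≠ R := by
  rintro rfl
  exact hR (BoolRel.zeroValid_side p.1.1 p.2)

/-- The disjunction `h` is the loop invariant: either the pass for `p` is still to come, or it has
been made and only relations with no larger core remain to be processed. -/
theorem isHit_foldl_corePass {k : ℕ} {l : List (mergeableRels d × Finset ℕ)}
    (hl : ∀ p ∈ l, p ∈ schedule d)
    (hs : l.Pairwise fun p q => q.1.1.core.card ≤ p.1.1.core.card)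
    {F : Formula (mergeableRels d)} {p : mergeableRels d × Finset ℕ} (hp : p ∈ schedule d)
    (h : p ∈ l ∨ (∀ q ∈ l, q.1.1.core.card ≤ p.1.1.core.card) ∧ IsHit (d * k) p.1 p.2 F) :
    IsHit (d * k) p.1 p.2 (l.foldl (corePass k) F) := by
  induction l generalizing F with
  | nil => simpa using h
  | cons q l ih =>
    rw [List.pairwise_cons] at hs
    refine ih (fun q hq => hl q (List.mem_cons_of_mem _ hq)) hs.2 ?_
    have hq := hl q List.mem_cons_self
    have hpz := (mem_schedule.1 hp).1
    rcases h with h | ⟨h₁, h₂⟩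
    · rcases List.mem_cons.1 h with rfl | h
      · exact Or.inr ⟨hs.1, isHit_pass (mem_mergeableRels.1 p.1.2).1 (mem_schedule.1 hp).2
          (downRel_ne hq le_rfl) (sideRel_ne hpz)⟩
      · exact Or.inl h
    · exact Or.inr ⟨fun r hr => h₁ r (List.mem_cons_of_mem _ hr), h₂.mono fun c hc hcR =>
        mem_of_mem_pass (downRel_ne hq (h₁ q List.mem_cons_self)) (sideRel_ne hpz) hc hcR⟩

theorem ncard_cores_kernel_le (k : ℕ) (F : Formula (mergeableRels d)) {R : mergeableRels d}
    (hR : ¬ R.1.ZeroValid) :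
    ((kernel k F).cores R).ncard ≤ (d * d + 1) ^ d * (max k 1) ^ d := by
  refine ncard_cores_le (mem_mergeableRels.1 R.2).1 fun S hS => ?_
  have hp : (R, S) ∈ schedule d := mem_schedule.2 ⟨hR, hS⟩
  exact isHit_foldl_corePass (fun _ h => h) (pairwise_schedule d) hp (Or.inl hp)

end Kernel

/-! ### Upper bounds on running times -/

namespace Prog

variable {K A σ : Type} [DecidableEq K] {p q : Prog K A σ} {s t u : σ × (K → List A)} {m n : ℕ}

theorem Runs.mono (h : Runs p s m t) (hmn : m ≤ n) : Runs p s n t := by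
  obtain ⟨l, hl, h⟩ := h
  exact ⟨l, hl.trans hmn, h⟩

theorem Runs.seq (h₁ : Runs p s m t) (h₂ : Runs q t n u) : Runs (seq p q) s (m + n) u := by
  obtain ⟨k, hk, h₁⟩ := h₁
  obtain ⟨l, hl, h₂⟩ := h₂
  exact ⟨k + l, add_le_add hk hl, h₁.seq h₂⟩

theorem Runs.ite {b : σ → Bool} (h₁ : b s.1 = true → Runs p s n t)
    (h₂ : b s.1 = false → Runs q s n t) : Runs (ite b p q) s (1 + n) t := by
  cases hb : b s.1
  · obtain ⟨l, hl, h⟩ := h₂ hb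
    exact ⟨1 + l, by omega, .ite_false hb h⟩
  · obtain ⟨l, hl, h⟩ := h₁ hb
    exact ⟨1 + l, by omega, .ite_true hb h⟩

theorem Runs.push (k : K) (f : σ → A) (v : σ) (S S' : K → List A)
    (h : ∀ j, S' j = if j = k then f v :: S k else S j) :
    Runs (push k f) (v, S) 1 (v, S') := by
  obtain rfl : S' = Function.update S k (f v :: S k) := by
    funext j
    rw [h, Function.update_apply]
  exact ⟨1, le_rfl, .push k f v S⟩

theorem Runs.pop (k : K) (f : σ → Option A → σ) (v v' : σ) (S S' : K → List A)
    (hv : v' = f v (S k).head?) (h : ∀ j, S' j = if j = k then (S k).tail else S j) :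
    Runs (pop k f) (v, S) 1 (v', S') := by
  obtain rfl : S' = Function.update S k (S k).tail := by
    funext j
    rw [h, Function.update_apply]
  exact hv ▸ ⟨1, le_rfl, .pop k f v S⟩

theorem Runs.peek (k : K) (f : σ → Option A → σ) (v : σ) (S : K → List A) :
    Runs (peek k f) (v, S) 1 (f v (S k).head?, S) :=
  ⟨1, le_rfl, .peek k f v S⟩

theorem Runs.load (f : σ → σ) (v : σ) (S : K → List A) :
    Runs (load f) (v, S) 1 (f v, S) :=
  ⟨1, le_rfl, .load f v S⟩

/-- A loop whose body processes one element of a list at a time. -/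
theorem Runs.loop_foldl {α β : Type*} {b : σ → Bool} (f : β → α → β)
    (st : β → List α → σ × (K → List A)) (I : β → List α → Prop)
    (hnil : ∀ y, b (st y []).1 = false)
    (hcons : ∀ y x l, I y (x :: l) → b (st y (x :: l)).1 = true ∧ I (f y x) l ∧
      Runs p (st y (x :: l)) n (st (f y x) l)) (y : β) (l : List α) (h : I y l) :
    Runs (loop b p) (st y l) (l.length * (n + 1) + 1) (st (l.foldl f y) []) := by
  induction l generalizing y with
  | nil => exact ⟨1, by simp, .loop_false (hnil y)⟩
  | cons x l ih =>
    obtain ⟨h₁, h₂, k, hk, h₃⟩ := hcons y x l h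
    obtain ⟨m, hm, h₄⟩ := ih _ h₂
    refine ⟨1 + k + m, ?_, .loop_true h₁ h₃ h₄⟩
    rw [List.length_cons, Nat.add_mul, Nat.one_mul]
    omega

end Prog

/-! ### Machine memory, and operations on words and numbers -/

/-- The stacks of the machine. -/
inductive Stk (d : ℕ) : Type
  | A | B | B₂ | O | L | L₂ | M | M₂ | T | P | Q
  | arg (b : Bool) (i : Fin d)
  deriving DecidableEq, Fintype

/-- The finite memory of the machine. -/
structure Reg (G : Finset BoolRel) : Type where
  sym : Option (Symb G)
  sym₂ : Option (Symb G)
  ra : Option G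
  rb : Option G
  eq : Bool
  flag : Bool
  heavy : Bool

noncomputable instance (G : Finset BoolRel) : Fintype (Symb G) := by
  classical
  refine Fintype.ofSurjective (α := G ⊕ Bool ⊕ Unit)
    (fun x => Sum.elim Symb.rel (Sum.elim Symb.bit fun _ => Symb.comma) x) ?_
  rintro (R | b | _)
  exacts [⟨Sum.inl R, rfl⟩, ⟨Sum.inr (Sum.inl b), rfl⟩, ⟨Sum.inr (Sum.inr ()), rfl⟩]

noncomputable instance (G : Finset BoolRel) : Fintype (Reg G) := by
  classical
  refine Fintype.ofSurjective (α := (Option (Symb G) × Option (Symb G)) × (Option G × Option G) ×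
    Bool × Bool × Bool) (fun x => ⟨x.1.1, x.1.2, x.2.1.1, x.2.1.2, x.2.2.1, x.2.2.2.1,
      x.2.2.2.2⟩) ?_
  rintro ⟨a, b, c, d, e, f, g⟩
  exact ⟨((a, b), (c, d), e, f, g), rfl⟩

section Machine

open scoped Classical
open Prog

variable {G : Finset BoolRel} {d : ℕ}

/-- Programs of the machine. -/
abbrev Program (G : Finset BoolRel) (d : ℕ) : Type :=
  Prog (Stk d) (Symb G) (Reg G)

namespace Program

/-- Do nothing. -/
def skip : Program G d := .load id

/-- Pop a symbol. -/
def popTo (X : Stk d) : Program G d :=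
  .pop X fun v a => { v with sym := a }

/-- Push the current symbol on each of the stacks. -/
def pushAll : List (Stk d) → Program G d
  | [] => skip
  | Y :: Ys => .seq (.push Y fun v => v.sym.getD Symb.comma) (pushAll Ys)

/-- Move the symbols of `X`, one by one, to each of the stacks. -/
def move (X : Stk d) (Ys : List (Stk d)) : Program G d :=
  .seq (popTo X) (.loop (fun v => v.sym.isSome) (.seq (pushAll Ys) (popTo X)))

/-- Remove the word on `X` and put it on each of the stacks. -/
def transferAll (X : Stk d) (Ys : List (Stk d)) : Program G d :=
  .seq (move X [.T]) (move .T Ys)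

/-- Whether a symbol is a bit. -/
def isBit : Option (Symb G) → Bool
  | some (Symb.bit _) => true
  | _ => false

/-- Move the bits of the number on `X` to `T` and remove the delimiter. -/
def popBits (X : Stk d) : Program G d :=
  .seq (popTo X) (.loop (fun v => isBit v.sym) (.seq (pushAll [.T]) (popTo X)))

/-- Remove the number on `X` and put it on each of the stacks. -/
def transferNum (X : Stk d) (Ys : List (Stk d)) : Program G d :=
  .seq (popBits X) (.seq (pushAll Ys) (move .T Ys))

/-- Compare the current symbols and pop the next ones. -/
noncomputable def compareStep : Program G d :=
  .seq (.load fun v => { v with eq := v.eq && decide (v.sym = v.sym₂) })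
    (.seq (popTo .P) (.pop .Q fun v a => { v with sym₂ := a }))

/-- Remove the words on `P` and `Q`, and check whether they are equal. -/
noncomputable def compare : Program G d :=
  .seq (.load fun v => { v with eq := true }) (.seq (popTo .P)
    (.seq (.pop .Q fun v a => { v with sym₂ := a })
      (.loop (fun v => v.sym.isSome || v.sym₂.isSome) compareStep)))

/-- Check whether the numbers on `X` and `Y` are equal. -/
noncomputable def eqNum (X Y : Stk d) : Program G d :=
  .seq (transferNum X [X, .P]) (.seq (transferNum Y [Y, .Q]) compare)

/-- Decrement the number on `M₂`, and set the register `heavy` if it is zero. -/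
noncomputable def decr : Program G d :=
  .seq (popTo .M₂) (.seq
    (.loop (fun v => decide (v.sym = some (Symb.bit false)))
      (.seq (.push .T fun _ => Symb.bit true) (popTo .M₂)))
    (.ite (fun v => decide (v.sym = some (Symb.bit true)))
      (.seq (.push .M₂ fun _ => Symb.bit false) (move .T [.M₂]))
      (.seq (move .T []) (.load fun v => { v with heavy := true }))))

theorem runs_pushAll (v : Reg G) (a : Symb G) (hv : v.sym = some a) (S S' : Stk d → List (Symb G))
    (Ys : List (Stk d)) (hY : Ys.Nodup) (h : ∀ k, S' k = if k ∈ Ys then a :: S k else S k) :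
    Runs (pushAll Ys) (v, S) (Ys.length + 1) (v, S') := by
  induction Ys generalizing S with
  | nil =>
    obtain rfl : S' = S := funext fun k => by simpa using h k
    exact Runs.load id v S'
  | cons Y Ys ih =>
    rw [List.nodup_cons] at hY
    refine ((Runs.push Y _ v S (fun j => if j = Y then a :: S Y else S j) fun j => ?_).seq
      (ih _ hY.2 fun k => ?_)).mono (by simp; omega)
    · simp [hv]
    · rw [h]
      by_cases hk : k = Y
      · subst hk; simp [hY.1]
      · simp [hk]

theorem runs_move (v : Reg G) (S S' : Stk d → List (Symb G)) (X : Stk d) (Ys : List (Stk d))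
    (hY : Ys.Nodup) (hY₂ : Ys.length ≤ 2) (hX : X ∉ Ys)
    (h : ∀ k, S' k = if k = X then [] else if k ∈ Ys then (S X).reverse ++ S k else S k) :
    Runs (move X Ys) (v, S) (5 * ((S X).length + 1)) ({ v with sym := none }, S') := by
  let st (y : List (Symb G)) (l : List (Symb G)) : Reg G × (Stk d → List (Symb G)) :=
    ({ v with sym := l.head? },
      fun k => if k = X then l.tail else if k ∈ Ys then y ++ S k else S k)
  have h₁ : Runs (popTo X) (v, S) 1 (st [] (S X)) :=
    Runs.pop X _ v _ S _ rfl fun j => by simp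
  -- With at most two target stacks, pushing costs at most three steps and popping one, which gives
  -- `n := 4`.
  have h₂ := Runs.loop_foldl (p := .seq (pushAll Ys) (popTo X)) (n := 4)
    (b := fun v : Reg G => v.sym.isSome) (fun y x => x :: y) st (fun _ _ => True)
    (fun y => rfl) (fun y x l _ => ⟨rfl, trivial, by
      have e₁ := runs_pushAll { v with sym := some x } x rfl (st y (x :: l)).2
        (fun k => if k = X then l else if k ∈ Ys then x :: (y ++ S k) else S k) Ys hY fun k => by
          by_cases hk : k = X
          · subst hk; simp [hX, st]
          · simp only [hk, if_false, st]
            split_ifs <;> rfl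
      have e₂ := Runs.pop X (fun (v : Reg G) a => { v with sym := a }) { v with sym := some x }
        (st (x :: y) l).1 (fun k => if k = X then l else if k ∈ Ys then x :: (y ++ S k) else S k)
        (st (x :: y) l).2 (by simp [st]) fun j => by
          by_cases hj : j = X
          · subst hj; simp [st]
          · simp [st, hj]
      exact (e₁.seq e₂).mono (by omega)⟩) [] (S X) trivial
  have h₃ := h₁.seq h₂
  have : S' = (st ((S X).foldl (fun y x => x :: y) []) []).2 := by
    funext k
    simp [st, h]
  rw [this]
  exact h₃.mono (by omega)

/-- Two moves through `T` reverse twice, so the word arrives in its original order. Since `X` itself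
may be among the targets, this also serves to copy a word, and with no targets to erase it. -/
theorem runs_transferAll (v : Reg G) (S S' : Stk d → List (Symb G)) (X : Stk d)
    (Ys : List (Stk d)) (hY : Ys.Nodup) (hY₂ : Ys.length ≤ 2) (hX : X ≠ .T) (hT : Stk.T ∉ Ys)
    (hS : S .T = []) (n : ℕ) (hn : (S X).length ≤ n)
    (h : ∀ k, S' k = if k ∈ Ys then S X ++ (if k = X then [] else S k) else
      if k = X then [] else S k) :
    Runs (transferAll X Ys) (v, S) (10 * (n + 1)) ({ v with sym := none }, S') := by
  have h₁ := runs_move v S (fun k => if k = X then [] else if k = .T then (S X).reverse else S k)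
    X [.T] (by simp) (by simp) (by simpa using hX) (fun k => by
      by_cases hk : k = X
      · simp [hk]
      · by_cases hk' : k = .T
        · simp [hk', hS]
        · simp [hk, hk'])
  have h₂ := runs_move { v with sym := none } (fun k =>
    if k = X then [] else if k = .T then (S X).reverse else S k) S' .T Ys hY hY₂ hT (fun k => by
      rw [h, if_neg hX.symm, if_pos rfl, List.reverse_reverse]
      by_cases hk : k = .T
      · subst hk; simp [hT, hX.symm, hS]
      · simp [hk])
  refine (h₁.seq h₂).mono ?_
  simp only [if_neg hX.symm, if_true, List.length_reverse]
  omega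

theorem runs_popBits (v : Reg G) (S S' : Stk d → List (Symb G)) (X : Stk d) (hX : X ≠ .T)
    (l : List Bool) (rest : List (Symb G)) (hl : S X = l.map Symb.bit ++ Symb.comma :: rest)
    (h : ∀ k, S' k = if k = X then rest else
      if k = .T then (l.map Symb.bit).reverse ++ S .T else S k) :
    Runs (popBits X) (v, S) (5 * (l.length + 1)) ({ v with sym := some Symb.comma }, S') := by
  let st (y : List (Symb G)) (l : List Bool) : Reg G × (Stk d → List (Symb G)) :=
    ({ v with sym := (l.map Symb.bit ++ Symb.comma :: rest).head? },
      fun k => if k = X then (l.map Symb.bit ++ Symb.comma :: rest).tail else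
        if k = .T then y ++ S .T else S k)
  have h₁ : Runs (popTo X) (v, S) 1 (st [] l) :=
    Runs.pop X _ v _ S _ (by simp [hl]) fun j => by
      by_cases hj : j = .T
      · subst hj; simp [hX.symm]
      · simp [hj, hl]
  have h₂ := Runs.loop_foldl (p := .seq (pushAll [.T]) (popTo X)) (n := 4)
    (b := fun v : Reg G => isBit v.sym) (fun y (x : Bool) => Symb.bit x :: y) st (fun _ _ => True)
    (fun y => rfl) (fun y x l _ => ⟨rfl, trivial, by
      have e₁ := runs_pushAll { v with sym := some (Symb.bit x) } (Symb.bit x) rfl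
        (st y (x :: l)).2 (fun k => if k = X then l.map Symb.bit ++ Symb.comma :: rest else
          if k = .T then Symb.bit x :: (y ++ S .T) else S k) [.T] (by simp) fun k => by
          by_cases hk : k = X
          · subst hk; simp [hX, st]
          · by_cases hk' : k = .T
            · subst hk'; simp [hk, st]
            · simp [hk, hk', st]
      have e₂ := Runs.pop X (fun (v : Reg G) a => { v with sym := a })
        { v with sym := some (Symb.bit x) } (st (Symb.bit x :: y) l).1
        (fun k => if k = X then l.map Symb.bit ++ Symb.comma :: rest else
          if k = .T then Symb.bit x :: (y ++ S .T) else S k)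
        (st (Symb.bit x :: y) l).2 (by simp [st]) fun j => by
          by_cases hj : j = X
          · subst hj; simp [st]
          · simp [st, hj]
      exact (e₁.seq e₂).mono (by simp)⟩) [] l trivial
  have h₃ := h₁.seq h₂
  have hrev (y : List (Symb G)) :
      l.foldl (fun y (x : Bool) => Symb.bit x :: y) y = (l.map Symb.bit).reverse ++ y := by
    clear h₁ h₂ h₃ hl h
    induction l generalizing y with
    | nil => rfl
    | cons x l ih => simp [ih]
  have : S' = (st (l.foldl (fun y (x : Bool) => Symb.bit x :: y) []) []).2 := by
    funext k
    simp [st, h, hrev]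
  rw [this]
  exact h₃.mono (by omega)

theorem runs_transferNum (v : Reg G) (S S' : Stk d → List (Symb G)) (X : Stk d)
    (Ys : List (Stk d)) (hY : Ys.Nodup) (hY₂ : Ys.length ≤ 2) (hX : X ≠ .T) (hT : Stk.T ∉ Ys)
    (hS : S .T = []) (x n : ℕ) (rest : List (Symb G)) (hx : S X = encodeNumber G x ++ rest)
    (hn : (encodeNumber G x).length ≤ n)
    (h : ∀ k, S' k = if k ∈ Ys then encodeNumber G x ++ (if k = X then rest else S k) else
      if k = X then rest else S k) :
    Runs (transferNum X Ys) (v, S) (10 * (n + 1)) ({ v with sym := none }, S') := by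
  set l := Computability.encodeNat x with hl
  have hx' : S X = l.map Symb.bit ++ Symb.comma :: rest := by
    rw [hx, encodeNumber, ← hl]; simp
  have hlen : (encodeNumber G x).length = l.length + 1 := by simp [encodeNumber, ← hl]
  have h₁ := runs_popBits v S (fun k => if k = X then rest else
    if k = .T then (l.map Symb.bit).reverse else S k) X hX l rest hx' (fun k => by simp [hS])
  have h₂ := runs_pushAll { v with sym := some Symb.comma } Symb.comma rfl
    (fun k => if k = X then rest else if k = .T then (l.map Symb.bit).reverse else S k)
    (fun k => if k ∈ Ys then Symb.comma :: (if k = X then rest else S k) else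
      if k = X then rest else if k = .T then (l.map Symb.bit).reverse else S k) Ys hY (fun k => by
      by_cases hk : k = .T
      · subst hk; simp [hT]
      · simp [hk])
  have h₃ := runs_move { v with sym := some Symb.comma }
    (fun k => if k ∈ Ys then Symb.comma :: (if k = X then rest else S k) else
      if k = X then rest else if k = .T then (l.map Symb.bit).reverse else S k) S' .T Ys hY hY₂ hT
    (fun k => by
      rw [h, if_neg hT, if_neg hX.symm, if_pos rfl, List.reverse_reverse, encodeNumber, ← hl]
      by_cases hk : k = .T
      · subst hk; simp [hT, hX.symm, hS]
      · simp only [hk, if_false]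
        split_ifs <;> simp)
  refine (h₁.seq (h₂.seq h₃)).mono ?_
  simp only [hT, hX.symm, if_true, if_false, List.length_reverse, List.length_map]
  omega

theorem runs_compare (v : Reg G) (S S' : Stk d → List (Symb G))
    (h : ∀ k, S' k = if k = .P ∨ k = .Q then [] else S k) :
    Runs compare (v, S) (4 * ((S .P).length + (S .Q).length + 1))
      ({ v with sym := none, sym₂ := none, eq := decide (S .P = S .Q) }, S') := by
  let st (e : Bool) (l₁ l₂ : List (Symb G)) : Reg G × (Stk d → List (Symb G)) :=
    ({ v with sym := l₁.head?, sym₂ := l₂.head?, eq := e },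
      fun k => if k = .P then l₁.tail else if k = .Q then l₂.tail else S k)
  have hstep (e : Bool) (l₁ l₂ : List (Symb G)) :
      Runs compareStep (st e l₁ l₂) 3
        (st (e && decide (l₁.head? = l₂.head?)) l₁.tail l₂.tail) := by
    have e₁ := Runs.load (fun v : Reg G => { v with eq := v.eq && decide (v.sym = v.sym₂) })
      (st e l₁ l₂).1 (st e l₁ l₂).2
    have e₂ := Runs.pop .P (fun (v : Reg G) a => { v with sym := a }) { (st e l₁ l₂).1 with
        eq := e && decide (l₁.head? = l₂.head?) } { (st e l₁ l₂).1 with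
        eq := e && decide (l₁.head? = l₂.head?), sym := l₁.tail.head? } (st e l₁ l₂).2
      (fun k => if k = .P then l₁.tail.tail else if k = .Q then l₂.tail else S k)
      (by simp [st]) fun j => by by_cases hj : j = .P <;> simp [hj, st]
    have e₃ := Runs.pop .Q (fun (v : Reg G) a => { v with sym₂ := a }) { (st e l₁ l₂).1 with
        eq := e && decide (l₁.head? = l₂.head?), sym := l₁.tail.head? }
      (st (e && decide (l₁.head? = l₂.head?)) l₁.tail l₂.tail).1
      (fun k => if k = .P then l₁.tail.tail else if k = .Q then l₂.tail else S k)
      (st (e && decide (l₁.head? = l₂.head?)) l₁.tail l₂.tail).2 (by simp [st]) fun j => by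
        by_cases hj : j = .P
        · simp [hj, st]
        · by_cases hj' : j = .Q <;> simp [hj, hj', st]
    exact e₁.seq (e₂.seq e₃)
  -- The words may differ in length and popping an empty stack leaves it empty, so the induction is
  -- on the total length.
  have hloop (e : Bool) (l₁ l₂ : List (Symb G)) :
      Runs (.loop (fun v => v.sym.isSome || v.sym₂.isSome) compareStep) (st e l₁ l₂)
        (4 * (l₁.length + l₂.length) + 1) (st (e && decide (l₁ = l₂)) [] []) := by
    generalize hN : l₁.length + l₂.length = N
    induction N using Nat.strong_induction_on generalizing e l₁ l₂ with
    | _ N ih =>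
      rcases Nat.eq_zero_or_pos N with h0 | h0
      · have e₁ : l₁ = [] := List.eq_nil_of_length_eq_zero (by omega)
        have e₂ : l₂ = [] := List.eq_nil_of_length_eq_zero (by omega)
        subst e₁ e₂
        refine ⟨1, by omega, ?_⟩
        have := Exec.loop_false (p := compareStep)
          (b := fun v : Reg G => v.sym.isSome || v.sym₂.isSome) (s := st e [] []) rfl
        simpa using this
      · have hb : ((st e l₁ l₂).1.sym.isSome || (st e l₁ l₂).1.sym₂.isSome) = true := by
          rcases l₁ with _ | ⟨x, l₁⟩
          · rcases l₂ with _ | ⟨y, l₂⟩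
            · simp at hN; omega
            · simp [st]
          · simp [st]
        have hlt : l₁.tail.length + l₂.tail.length < N := by
          simp only [List.length_tail]; omega
        obtain ⟨m, hm, h₁⟩ := hstep e l₁ l₂
        obtain ⟨n, hn, h₂⟩ := ih _ hlt (e && decide (l₁.head? = l₂.head?)) l₁.tail l₂.tail rfl
        refine ⟨1 + m + n, by omega, Exec.loop_true hb h₁ ?_⟩
        have : (e && decide (l₁.head? = l₂.head?) && decide (l₁.tail = l₂.tail)) =
            (e && decide (l₁ = l₂)) := by
          rw [Bool.and_assoc, ← Bool.decide_and]
          congr 1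
          refine decide_eq_decide.2 ?_
          rcases l₁ with _ | ⟨x, l₁⟩ <;> rcases l₂ with _ | ⟨y, l₂⟩ <;> simp
        rwa [this] at h₂
  have h₁ := Runs.load (fun v : Reg G => { v with eq := true }) v S
  have h₂ := Runs.pop .P (fun (v : Reg G) a => { v with sym := a }) { v with eq := true }
    { v with eq := true, sym := (S .P).head? } S
    (fun k => if k = .P then (S .P).tail else S k) rfl fun j => rfl
  have h₃ := Runs.pop .Q (fun (v : Reg G) a => { v with sym₂ := a })
    { v with eq := true, sym := (S .P).head? } (st true (S .P) (S .Q)).1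
    (fun k => if k = .P then (S .P).tail else S k) (st true (S .P) (S .Q)).2 (by simp [st])
    fun j => by
      by_cases hj : j = .P
      · simp [hj, st]
      · by_cases hj' : j = .Q <;> simp [hj, hj', st]
  have h₄ := h₁.seq (h₂.seq (h₃.seq (hloop true (S .P) (S .Q))))
  have : S' = (st (true && decide (S .P = S .Q)) [] []).2 := by
    funext k
    rw [h]
    by_cases hk : k = .P <;> by_cases hk' : k = .Q <;> simp [st, hk, hk']
  rw [this]
  exact h₄.mono (by omega)

theorem encodeNumber_inj {x y : ℕ} : encodeNumber G x = encodeNumber G y ↔ x = y := by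
  refine ⟨fun h => ?_, fun h => h ▸ rfl⟩
  have h₁ := List.append_cancel_right h
  have h₂ : Function.Injective (Symb.bit : Bool → Symb G) := fun a b h => by injection h
  have h₃ := h₂.list_map h₁
  rw [← Computability.decode_encodeNat x, h₃, Computability.decode_encodeNat]

theorem runs_eqNum (v : Reg G) (S : Stk d → List (Symb G)) (X Y : Stk d)
    (hX : X ≠ .T ∧ X ≠ .P ∧ X ≠ .Q) (hY : Y ≠ .T ∧ Y ≠ .P ∧ Y ≠ .Q)
    (hS : S .T = [] ∧ S .P = [] ∧ S .Q = []) (x y n : ℕ) (r₁ r₂ : List (Symb G))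
    (hx : S X = encodeNumber G x ++ r₁) (hy : S Y = encodeNumber G y ++ r₂)
    (hxn : (encodeNumber G x).length ≤ n) (hyn : (encodeNumber G y).length ≤ n) :
    Runs (eqNum X Y) (v, S) (30 * (n + 1))
      ({ v with sym := none, sym₂ := none, eq := decide (x = y) }, S) := by
  have h₁ := runs_transferNum v S (fun k => if k = .P then encodeNumber G x else S k) X [X, .P]
    (by simpa using hX.2.1) (by simp) hX.1 (by simpa using hX.1.symm) hS.1 x n r₁ hx hxn
    (fun k => by
      by_cases hk : k = .P
      · subst hk; simp [hX.2.1.symm, hS]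
      · by_cases hk' : k = X
        · subst hk'; simp [hk, hx]
        · simp [hk, hk'])
  have h₂ := runs_transferNum { v with sym := none }
    (fun k => if k = .P then encodeNumber G x else S k)
    (fun k => if k = .P then encodeNumber G x else if k = .Q then encodeNumber G y else S k)
    Y [Y, .Q] (by simpa using hY.2.2) (by simp) hY.1 (by simpa using hY.1.symm)
    (by simpa using hS.1) y n r₂ (by simpa [hY.2.1] using hy) hyn
    (fun k => by
      by_cases hk : k = .Q
      · subst hk; simp [hY.2.2.symm, hS]
      · by_cases hk' : k = Y
        · subst hk'; simp [hk, hy, hY.2.1]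
        · simp [hk, hk'])
  have h₃ := runs_compare { v with sym := none }
    (fun k => if k = .P then encodeNumber G x else if k = .Q then encodeNumber G y else S k) S
    (fun k => by
      by_cases hk : k = .P
      · subst hk; simp [hS]
      · by_cases hk' : k = .Q
        · subst hk'; simp [hS]
        · simp [hk, hk'])
  have h₄ : Runs (eqNum X Y) (v, S) (30 * (n + 1)) _ := (h₁.seq (h₂.seq h₃)).mono (by
    simp only [if_true, reduceCtorEq, if_false]
    omega)
  simpa [encodeNumber_inj] using h₄

end Program

end Machine

/-! ### The binary counter; reading and writing constraints -/

section Machine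

open scoped Classical
open Prog

variable {G : Finset BoolRel} {d : ℕ}

/-- The number with the given bits, least significant bit first. -/
def bitVal : List Bool → ℕ
  | [] => 0
  | b :: l => b.toNat + 2 * bitVal l

theorem bitVal_encodeNat (n : ℕ) : bitVal (Computability.encodeNat n) = n := by
  have h (p : PosNum) : bitVal (Computability.encodePosNum p) = (p : ℕ) := by
    induction p with
    | one => rfl
    | bit1 p ih => simp [Computability.encodePosNum, bitVal, ih]; omega
    | bit0 p ih => simp [Computability.encodePosNum, bitVal, ih]; omega
  have h' (p : Num) : bitVal (Computability.encodeNum p) = (p : ℕ) := by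
    rcases p with _ | p
    · rfl
    · exact h p
  rw [Computability.encodeNat, h']
  simp

/-- The arithmetic of a decrement, least significant bit first: leading zeros turn into ones and the
first one turns into zero. Without any one, the number is zero. -/
theorem bitVal_cases (l : List Bool) : (bitVal l = 0 ∧ ∃ n, l = List.replicate n false) ∨
    ∃ n l', l = List.replicate n false ++ true :: l' ∧
      bitVal (List.replicate n true ++ false :: l') + 1 = bitVal l := by
  induction l with
  | nil => exact Or.inl ⟨rfl, 0, rfl⟩
  | cons b l ih =>
    rcases b with _ | _
    · rcases ih with ⟨h, n, rfl⟩ | ⟨n, l', rfl, h⟩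
      · exact Or.inl ⟨by simp [bitVal, h], n + 1, rfl⟩
      · refine Or.inr ⟨n + 1, l', rfl, ?_⟩
        simp only [List.replicate_succ, List.cons_append, bitVal, Bool.toNat_true,
          Bool.toNat_false] at h ⊢
        omega
    · exact Or.inr ⟨0, l, rfl, by simp [bitVal]; omega⟩

/-- The word `w` holds the number `m` in binary, with or without the final delimiter. -/
def Represents (w : List (Symb G)) (m : ℕ) : Prop :=
  ∃ l t, w = l.map Symb.bit ++ t ∧ (t = [] ∨ t = [Symb.comma]) ∧ bitVal l = m

theorem represents_encodeNumber (m : ℕ) : Represents (encodeNumber G m) m :=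
  ⟨_, _, rfl, Or.inr rfl, bitVal_encodeNat m⟩

/-- The variables of a constraint, in binary. -/
def argsCode (c : Constraint G) : List (Symb G) :=
  ((List.range c.rel.1.arity).map c.arg).flatMap (encodeNumber G)

theorem encodeConstraint_eq (c : Constraint G) :
    encodeConstraint c = Symb.rel c.rel :: argsCode c := by
  have : List.ofFn c.args = (List.range c.rel.1.arity).map c.arg := by
    refine List.ext_getElem (by simp) fun i h₁ h₂ => ?_
    have hi : i < c.rel.1.arity := by simpa using h₁
    simp [c.arg_of_lt hi]
  rw [encodeConstraint, this, argsCode]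

theorem encodeConstraint_withRel (c : Constraint G) {Q : G} (hQ : Q.1.arity = c.rel.1.arity) :
    encodeConstraint (c.withRel Q) = Symb.rel Q :: argsCode c := by
  have h₁ : (List.range (c.withRel Q).rel.1.arity).map (c.withRel Q).arg =
      (List.range c.rel.1.arity).map c.arg := by
    change (List.range Q.1.arity).map _ = _
    rw [hQ]
    refine List.map_congr_left fun i hi => ?_
    exact c.withRel_arg (by rw [hQ]; exact List.mem_range.1 hi)
  rw [encodeConstraint_eq, argsCode, h₁]
  rfl

/-- The variable of a constraint in position `i` in binary, and nothing if there is none. -/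
def argCode (c : Constraint G) (i : ℕ) : List (Symb G) :=
  if i < c.rel.1.arity then encodeNumber G (c.arg i) else []

theorem length_argsCode_le (c : Constraint G) :
    (argsCode c).length ≤ (encodeConstraint c).length := by
  rw [encodeConstraint_eq]; simp

theorem length_encodeNumber_arg_le {c : Constraint G} {i : ℕ} (hi : i < c.rel.1.arity) :
    (encodeNumber G (c.arg i)).length ≤ (encodeConstraint c).length := by
  refine le_trans ?_ (length_argsCode_le c)
  refine (List.sublist_flatten_of_mem (l := encodeNumber G (c.arg i)) ?_).length_le
  exact List.mem_map.2 ⟨_, List.mem_map.2 ⟨i, List.mem_range.2 hi, rfl⟩, rfl⟩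

theorem length_argCode_le (c : Constraint G) (i : ℕ) :
    (argCode c i).length ≤ (encodeConstraint c).length := by
  rw [argCode]
  split_ifs with hi
  · exact length_encodeNumber_arg_le hi
  · exact Nat.zero_le _

/-- The relation that was read into the register for the given family of stacks. -/
def Reg.rel (v : Reg G) : Bool → Option G
  | false => v.ra
  | true => v.rb

/-- Replace the relation in the register for the given family of stacks. -/
def Reg.setRel (v : Reg G) (b : Bool) (x : Option G) : Reg G :=
  match b with
  | false => { v with ra := x }
  | true => { v with rb := x }

/-- The relation denoted by a symbol. -/
def relOf : Option (Symb G) → Option G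
  | some (Symb.rel R) => some R
  | _ => none

/-- The arity of the relation in a register. -/
def arityOf : Option G → ℕ
  | some R => R.1.arity
  | none => 0

namespace Program

theorem runs_skip (v : Reg G) (S : Stk d → List (Symb G)) : Runs skip (v, S) 1 (v, S) :=
  Runs.load id v S

/-- The result may have superfluous zeros at the top, and underflow empties the stack along with the
delimiter. Hence only `Represents` is preserved, rather than a fixed encoding. -/
theorem runs_decr (v : Reg G) (S : Stk d → List (Symb G)) (hS : S .T = []) (m N : ℕ)
    (hm : Represents (S .M₂) m) (hN : (S .M₂).length ≤ N) :
    ∃ w, Represents w (m - 1) ∧ w.length ≤ (S .M₂).length ∧ Runs decr (v, S) (10 * (N + 1))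
      ({ v with sym := none, heavy := v.heavy || decide (m = 0) },
        fun k => if k = .M₂ then w else S k) := by
  obtain ⟨l, t, hl, ht, rfl⟩ := hm
  have hscan (n : ℕ) (r : List (Symb G)) (hr : r.head? ≠ some (Symb.bit false))
      (hn : S .M₂ = (List.replicate n false).map Symb.bit ++ r) :
      Runs (.seq (popTo .M₂) (.loop (fun v => decide (v.sym = some (Symb.bit false)))
        (.seq (.push .T fun _ => Symb.bit true) (popTo .M₂)))) (v, S) (3 * n + 2)
        ({ v with sym := r.head? }, fun k => if k = .M₂ then r.tail else
          if k = .T then List.replicate n (Symb.bit true) else S k) := by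
    let st (y : List (Symb G)) (l : List Bool) : Reg G × (Stk d → List (Symb G)) :=
      ({ v with sym := (l.map Symb.bit ++ r).head? },
        fun k => if k = .M₂ then (l.map Symb.bit ++ r).tail else if k = .T then y else S k)
    have h₁ : Runs (popTo .M₂) (v, S) 1 (st [] (List.replicate n false)) :=
      Runs.pop Stk.M₂ (fun (v : Reg G) a => { v with sym := a }) v
        (st [] (List.replicate n false)).1 S (st [] (List.replicate n false)).2 (by simp [hn, st]) fun j => by
          by_cases hj : j = .T
          · subst hj; simp [hS, st]
          · simp [hj, hn, st]
    have h₂ := Runs.loop_foldl (p := .seq (.push .T fun _ => Symb.bit true) (popTo .M₂)) (n := 2)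
      (b := fun v : Reg G => decide (v.sym = some (Symb.bit false)))
      (fun y (x : Bool) => Symb.bit true :: y) st (fun _ l => ∀ x ∈ l, x = false)
      (fun y => by simpa [st] using hr) (fun y x l hx => by
        obtain rfl := hx x List.mem_cons_self
        refine ⟨by simp [st], fun x hx' => hx x (List.mem_cons_of_mem _ hx'), ?_⟩
        have e₁ := Runs.push .T (fun _ => Symb.bit true) (st y (false :: l)).1
          (st y (false :: l)).2 (fun k => if k = .M₂ then l.map Symb.bit ++ r else
            if k = .T then Symb.bit true :: y else S k) fun k => by
          by_cases hk : k = .T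
          · subst hk; simp [st]
          · simp [hk, st]
        have e₂ := Runs.pop .M₂ (fun (v : Reg G) a => { v with sym := a })
          (st y (false :: l)).1 (st (Symb.bit true :: y) l).1
          (fun k => if k = .M₂ then l.map Symb.bit ++ r else
            if k = .T then Symb.bit true :: y else S k) (st (Symb.bit true :: y) l).2
          (by simp [st]) fun j => by
            by_cases hj : j = .M₂
            · subst hj; simp [st]
            · simp [st, hj]
        exact e₁.seq e₂) [] (List.replicate n false)
      (fun x hx => List.eq_of_mem_replicate hx)
    have hfold (n : ℕ) (y : List (Symb G)) : (List.replicate n false).foldl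
        (fun y (_ : Bool) => (Symb.bit true : Symb G) :: y) y =
          List.replicate n (Symb.bit true) ++ y := by
      induction n generalizing y with
      | zero => rfl
      | succ n ih =>
        rw [List.replicate_succ, List.foldl_cons, ih, List.replicate_succ',
          List.append_assoc]
        rfl
    rw [hfold, List.length_replicate, List.append_nil] at h₂
    exact (h₁.seq h₂).mono (by omega)
  rcases bitVal_cases l with ⟨h0, n, rfl⟩ | ⟨n, l', rfl, h0⟩
  · refine ⟨[], ⟨[], [], rfl, Or.inl rfl, by simp [bitVal, h0]⟩, by simp, ?_⟩
    have h₁ := hscan n t (by rcases ht with rfl | rfl <;> simp) hl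
    have hlen : n ≤ N := by rw [hl] at hN; simp at hN; omega
    have h₂ := runs_move { v with sym := t.head? } (fun k => if k = .M₂ then t.tail else
        if k = .T then List.replicate n (Symb.bit true) else S k)
      (fun k => if k = .M₂ then [] else S k) .T [] (by simp) (by simp) (by simp) (fun k => by
        by_cases hk : k = .T
        · subst hk; simp [hS]
        · rcases ht with rfl | rfl <;> simp [hk])
    have h₃ := Runs.load (fun v : Reg G => { v with heavy := true }) { v with sym := none }
      (fun k => if k = Stk.M₂ then [] else S k)
    have h₄ := Runs.ite (b := fun v : Reg G => decide (v.sym = some (Symb.bit true)))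
      (p := .seq (.push .M₂ fun _ => Symb.bit false) (move .T [.M₂])) (fun h => absurd h (by
        rcases ht with rfl | rfl <;> simp)) (fun _ => h₂.seq h₃)
    -- `hscan` groups the initial pop with the loop, whereas `decr` groups the loop with the
    -- conditional; the execution is taken apart and reassociated.
    obtain ⟨m₁, hm₁, hA⟩ := h₁
    obtain ⟨m₂, hm₂, hB⟩ := h₄
    rcases hA with _ | _ | _ | _ | ⟨hA₁, hA₂⟩
    rename_i a b c
    refine ⟨_, ?_, Exec.seq hA₁ (Exec.seq hA₂ (by simpa [h0] using hB))⟩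
    simp at hm₂
    omega
  · refine ⟨(List.replicate n true ++ false :: l').map Symb.bit ++ t, ⟨_, t, rfl, ht, by omega⟩,
      by rw [hl]; simp, ?_⟩
    have hlen : n + 1 ≤ N := by rw [hl] at hN; simp at hN; omega
    have h₁ := hscan n (Symb.bit true :: (l'.map Symb.bit ++ t)) (by simp) (by rw [hl]; simp)
    have h₂ := Runs.push .M₂ (fun _ => Symb.bit false)
      { v with sym := some (Symb.bit true) } (fun k => if k = .M₂ then l'.map Symb.bit ++ t else
        if k = .T then List.replicate n (Symb.bit true) else S k)
      (fun k => if k = .M₂ then Symb.bit false :: (l'.map Symb.bit ++ t) else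
        if k = .T then List.replicate n (Symb.bit true) else S k) fun k => by
        by_cases hk : k = .M₂ <;> simp [hk]
    have h₃ := runs_move { v with sym := some (Symb.bit true) }
      (fun k => if k = .M₂ then Symb.bit false :: (l'.map Symb.bit ++ t) else
        if k = .T then List.replicate n (Symb.bit true) else S k)
      (fun k => if k = .M₂ then (List.replicate n true ++ false :: l').map Symb.bit ++ t else S k)
      .T [.M₂] (by simp) (by simp) (by simp) (fun k => by
        by_cases hk : k = .T
        · subst hk; simp [hS]
        · by_cases hk' : k = .M₂
          · subst hk'; simp
          · simp [hk, hk'])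
    have h₄ := Runs.ite (b := fun v : Reg G => decide (v.sym = some (Symb.bit true)))
      (q := .seq (move .T []) (.load fun v => { v with heavy := true })) (fun _ => h₂.seq h₃)
      (fun h => absurd h (by simp))
    obtain ⟨m₁, hm₁, hA⟩ := h₁
    obtain ⟨m₂, hm₂, hB⟩ := h₄
    rcases hA with _ | _ | _ | _ | ⟨hA₁, hA₂⟩
    rename_i a b c
    have hne : bitVal (List.replicate n false ++ true :: l') ≠ 0 := by omega
    refine ⟨_, ?_, Exec.seq hA₁ (Exec.seq hA₂ (by simpa [hne] using hB))⟩
    simp at hm₂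
    omega

/-- Read the first `n` variables of a constraint. -/
noncomputable def readArgs (b : Bool) (X : Stk d) : ℕ → Program G d
  | 0 => skip
  | n + 1 => .seq (readArgs b X n) (if h : n < d then
      .ite (fun v => decide (n < arityOf (v.rel b))) (transferNum X [.arg b ⟨n, h⟩]) skip else skip)

/-- Read a constraint from the stack `X`. -/
noncomputable def read (b : Bool) (X : Stk d) : Program G d :=
  .seq (.pop X fun v a => Reg.setRel { v with sym := none } b (relOf a)) (readArgs b X d)

/-- Write the variables of a constraint except for the first `n` ones. -/
noncomputable def writeArgs (b : Bool) (X : Stk d) : ℕ → Program G d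
  | 0 => skip
  | n + 1 => .seq (if h : n < d then
      .ite (fun v => decide (n < arityOf (v.rel b)))
        (transferNum (.arg b ⟨n, h⟩) [.arg b ⟨n, h⟩, X]) skip else skip) (writeArgs b X n)

/-- Write a constraint to the stack `X`. -/
noncomputable def write (b : Bool) (X : Stk d) (f : Reg G → Symb G) : Program G d :=
  .seq (writeArgs b X d) (.push X f)

/-- Remove the first `n` variables of a constraint. -/
noncomputable def clearArgs (b : Bool) : ℕ → Program G d
  | 0 => skip
  | n + 1 => .seq (clearArgs b n) (if h : n < d then transferAll (.arg b ⟨n, h⟩) [] else skip)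

theorem drop_range_map_arg (c : Constraint G) {n : ℕ} (hn : n < c.rel.1.arity) :
    (((List.range c.rel.1.arity).drop n).map c.arg).flatMap (encodeNumber G) =
      encodeNumber G (c.arg n) ++
        (((List.range c.rel.1.arity).drop (n + 1)).map c.arg).flatMap (encodeNumber G) := by
  rw [List.drop_eq_getElem_cons (by simpa using hn)]
  simp

theorem drop_range_eq_nil (c : Constraint G) {n : ℕ} (hn : c.rel.1.arity ≤ n) :
    (List.range c.rel.1.arity).drop n = [] :=
  List.drop_eq_nil_of_le (by simpa using hn)

/-- The program is unrolled over all `d` possible positions and tests the arity at run time, since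
the relation is known only through the finite memory. -/
theorem runs_readArgs (b : Bool) (X : Stk d) (hX : X ≠ .T ∧ ∀ i, X ≠ .arg b i) (v : Reg G)
    (hv : v.sym = none) (S : Stk d → List (Symb G)) (hT : S .T = []) (c : Constraint G)
    (hc : v.rel b = some c.rel) (rest : List (Symb G)) (hSX : S X = argsCode c ++ rest)
    (hb : ∀ i, S (.arg b i) = []) (N : ℕ) (hN : (encodeConstraint c).length ≤ N) (n : ℕ)
    (hn : n ≤ d) : ∃ S' : Stk d → List (Symb G),
      Runs (readArgs b X n) (v, S) (1 + n * (10 * (N + 1) + 1)) (v, S') ∧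
      S' X = (((List.range c.rel.1.arity).drop n).map c.arg).flatMap (encodeNumber G) ++ rest ∧
      (∀ i : Fin d, S' (.arg b i) = if i.1 < n then argCode c i else []) ∧
      ∀ k, k ≠ X → (∀ i, k ≠ .arg b i) → S' k = S k := by
  induction n with
  | zero => exact ⟨S, (runs_skip v S).mono (by omega), by simp [hSX, argsCode], by simp [hb], fun _ _ _ => rfl⟩
  | succ n ih =>
    obtain ⟨S', h₁, h₂, h₃, h₄⟩ := ih (by omega)
    have hnd : n < d := by omega
    have hTne (i : Fin d) : Stk.T ≠ .arg b i := by simp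
    by_cases hlt : n < c.rel.1.arity
    · let S'' : Stk d → List (Symb G) := fun k => if k = X then
        (((List.range c.rel.1.arity).drop (n + 1)).map c.arg).flatMap (encodeNumber G) ++ rest else
        if k = .arg b ⟨n, hnd⟩ then encodeNumber G (c.arg n) else S' k
      refine ⟨S'', ?_, by simp [S''], fun i => ?_, fun k hk hk' => ?_⟩
      · have h₅ := runs_transferNum v S' S'' X [.arg b ⟨n, hnd⟩] (by simp) (by simp) hX.1
          (by simp) (by rw [h₄ _ hX.1.symm hTne, hT]) (c.arg n) N _
          (by rw [h₂, drop_range_map_arg c hlt, List.append_assoc])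
          ((length_encodeNumber_arg_le hlt).trans hN) (fun k => by
            by_cases hk : k = .arg b ⟨n, hnd⟩
            · subst hk; simp [S'', (hX.2 _).symm, h₃]
            · simp [S'', hk])
        have h₆ := Runs.ite (b := fun v : Reg G => decide (n < arityOf (v.rel b))) (q := skip)
          (fun _ => h₅) (fun h => absurd h (by simp [hc, arityOf, hlt]))
        have h₇ := h₁.seq h₆
        rw [readArgs, dif_pos hnd]
        have hv' : ({ v with sym := none } : Reg G) = v := by rw [← hv]
        rw [hv'] at h₇
        refine h₇.mono ?_
        rw [Nat.add_mul]; omega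
      · simp only [S'', (hX.2 i).symm, if_false]
        by_cases hi : i = ⟨n, hnd⟩
        · subst hi; simp [argCode, hlt]
        · have : i.1 ≠ n := fun h => hi (Fin.ext h)
          have e : (i.1 < n + 1) = (i.1 < n) := propext (by omega)
          simp only [Stk.arg.injEq, true_and, hi, if_false, h₃, e]
      · simp only [S'', hk, hk' _, if_false]
        exact h₄ k hk hk'
    · refine ⟨S', ?_, ?_, fun i => ?_, h₄⟩
      · rw [readArgs, dif_pos hnd]
        have h₆ := Runs.ite (b := fun v : Reg G => decide (n < arityOf (v.rel b)))
          (p := transferNum X [.arg b ⟨n, hnd⟩])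
          (fun h => absurd h (by simpa [hc, arityOf] using hlt)) (fun _ => runs_skip v S')
        refine (h₁.seq h₆).mono ?_
        rw [Nat.add_mul]; omega
      · rw [h₂, drop_range_eq_nil c (by omega), drop_range_eq_nil c (by omega)]
      · rw [h₃]
        by_cases hi : i.1 < n
        · rw [if_pos hi, if_pos (by omega)]
        · rw [if_neg hi]
          split_ifs
          · rw [argCode, if_neg (by omega)]
          · rfl

/-- A bound for the cost of reading or writing a constraint of length `N`. -/
def ioCost (d N : ℕ) : ℕ := d * (10 * (N + 1) + 1) + 2

theorem runs_read (b : Bool) (X : Stk d) (hX : X ≠ .T ∧ ∀ i, X ≠ .arg b i) (v : Reg G)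
    (S S' : Stk d → List (Symb G)) (hT : S .T = []) (c : Constraint G)
    (hd : c.rel.1.arity ≤ d) (rest : List (Symb G)) (hSX : S X = encodeConstraint c ++ rest)
    (hb : ∀ i, S (.arg b i) = []) (N : ℕ) (hN : (encodeConstraint c).length ≤ N)
    (h₁ : S' X = rest) (h₂ : ∀ i, S' (.arg b i) = argCode c i)
    (h₃ : ∀ k, k ≠ X → (∀ i, k ≠ .arg b i) → S' k = S k) :
    Runs (read b X) (v, S) (ioCost d N)
      (Reg.setRel { v with sym := none } b (some c.rel), S') := by
  rw [encodeConstraint_eq] at hSX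
  have e₁ := Runs.pop X (fun (v : Reg G) a => Reg.setRel { v with sym := none } b (relOf a)) v
    (Reg.setRel { v with sym := none } b (some c.rel)) S
    (fun k => if k = X then argsCode c ++ rest else S k) (by simp [hSX, relOf])
    (fun j => by simp [hSX])
  obtain ⟨S'', e₂, e₃, e₄, e₅⟩ := runs_readArgs b X hX
    (Reg.setRel { v with sym := none } b (some c.rel)) (by cases b <;> rfl)
    (fun k => if k = X then argsCode c ++ rest else S k) (by simp [hX.1.symm, hT]) c
    (by cases b <;> rfl) rest (by simp) (fun i => by simp [(hX.2 i).symm, hb]) N hN d le_rfl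
  have : S'' = S' := by
    funext k
    by_cases hk : k = X
    · subst hk
      rw [e₃, h₁, drop_range_eq_nil c hd]; rfl
    · by_cases hk' : ∃ i, k = .arg b i
      · obtain ⟨i, rfl⟩ := hk'
        rw [e₄, h₂, if_pos i.2]
      · push Not at hk'
        rw [e₅ k hk hk', h₃ k hk hk', if_neg hk]
  subst this
  exact (e₁.seq e₂).mono (by rw [ioCost]; omega)

theorem runs_read_nil (b : Bool) (X : Stk d) (v : Reg G) (S : Stk d → List (Symb G))
    (hSX : S X = []) : Runs (read b X) (v, S) (2 * d + 2)
      (Reg.setRel { v with sym := none } b none, S) := by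
  have e₁ := Runs.pop X (fun (v : Reg G) a => Reg.setRel { v with sym := none } b (relOf a)) v
    (Reg.setRel { v with sym := none } b none) S S (by simp [hSX, relOf]) (fun j => by
      by_cases hj : j = X
      · subst hj; simp [hSX]
      · simp [hj])
  have e₂ (n : ℕ) (hn : n ≤ d) : Runs (readArgs b X n)
      (Reg.setRel { v with sym := none } b none, S) (1 + n * 2)
      (Reg.setRel { v with sym := none } b none, S) := by
    induction n with
    | zero => exact runs_skip _ _
    | succ n ih =>
      have hnd : n < d := by omega
      rw [readArgs, dif_pos hnd]
      have h₆ := Runs.ite (b := fun v : Reg G => decide (n < arityOf (v.rel b)))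
        (p := transferNum X [.arg b ⟨n, hnd⟩]) (s := (Reg.setRel { v with sym := none } b none, S))
        (fun h => absurd h (by cases b <;> simp [Reg.setRel, Reg.rel, arityOf]))
        (fun _ => runs_skip _ S)
      exact ((ih (by omega)).seq h₆).mono (by omega)
  exact (e₁.seq (e₂ d le_rfl)).mono (by omega)

theorem runs_writeArgs (b : Bool) (X : Stk d) (hX : X ≠ .T ∧ ∀ i, X ≠ .arg b i) (v : Reg G)
    (hv : v.sym = none) (S : Stk d → List (Symb G)) (hT : S .T = []) (c : Constraint G)
    (hc : v.rel b = some c.rel) (w : List (Symb G))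
    (hb : ∀ i, S (.arg b i) = argCode c i) (N : ℕ) (hN : (encodeConstraint c).length ≤ N) (n : ℕ)
    (hn : n ≤ d) (S' : Stk d → List (Symb G))
    (hSX : S X =
      (((List.range c.rel.1.arity).drop n).map c.arg).flatMap (encodeNumber G) ++ w)
    (h : ∀ k, S' k = if k = X then argsCode c ++ w else S k) :
    Runs (writeArgs b X n) (v, S) (1 + n * (10 * (N + 1) + 1)) (v, S') := by
  induction n generalizing S with
  | zero =>
    obtain rfl : S' = S := by
      funext k
      rw [h]
      split_ifs with hk
      · subst hk; simp [hSX, argsCode]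
      · rfl
    exact (runs_skip v S').mono (by omega)
  | succ n ih =>
    have hnd : n < d := by omega
    rw [writeArgs, dif_pos hnd]
    by_cases hlt : n < c.rel.1.arity
    · have h₁ := runs_transferNum v S (fun k => if k = X then
          (((List.range c.rel.1.arity).drop n).map c.arg).flatMap (encodeNumber G) ++ w else S k)
        (.arg b ⟨n, hnd⟩) [.arg b ⟨n, hnd⟩, X] (by simpa using (hX.2 _).symm) (by simp) (by simp)
        (by simpa using hX.1.symm) hT (c.arg n) N [] (by simp [hb, argCode, hlt])
        ((length_encodeNumber_arg_le hlt).trans hN) (fun k => by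
          by_cases hk : k = X
          · subst hk
            rw [if_pos rfl, if_pos (by simp), if_neg (hX.2 _), hSX, drop_range_map_arg c hlt,
              List.append_assoc]
          · by_cases hk' : k = .arg b ⟨n, hnd⟩
            · subst hk'; simp [hk, hb, argCode, hlt]
            · simp [hk, hk'])
      have hv' : ({ v with sym := none } : Reg G) = v := by rw [← hv]
      rw [hv'] at h₁
      have h₂ := Runs.ite (b := fun v : Reg G => decide (n < arityOf (v.rel b))) (q := skip)
        (fun _ => h₁) (fun h => absurd h (by simp [hc, arityOf, hlt]))
      have h₃ := ih (fun k => if k = X then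
          (((List.range c.rel.1.arity).drop n).map c.arg).flatMap (encodeNumber G) ++ w else S k)
        (by simp [hX.1.symm, hT]) (fun i => by simp [(hX.2 i).symm, hb]) (by omega) (by simp)
        (fun k => by rw [h]; split_ifs <;> rfl)
      refine (h₂.seq h₃).mono ?_
      rw [Nat.add_mul]; omega
    · have h₂ := Runs.ite (b := fun v : Reg G => decide (n < arityOf (v.rel b)))
        (p := transferNum (.arg b ⟨n, hnd⟩) [.arg b ⟨n, hnd⟩, X])
        (fun h => absurd h (by simpa [hc, arityOf] using hlt)) (fun _ => runs_skip v S)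
      have h₃ := ih S hT hb (by omega)
        (by rw [hSX, drop_range_eq_nil c (by omega), drop_range_eq_nil c (by omega)]) h
      refine (h₂.seq h₃).mono ?_
      rw [Nat.add_mul]; omega

theorem runs_write (b : Bool) (X : Stk d) (hX : X ≠ .T ∧ ∀ i, X ≠ .arg b i) (f : Reg G → Symb G)
    (v : Reg G) (hv : v.sym = none) (S S' : Stk d → List (Symb G)) (hT : S .T = [])
    (c : Constraint G) (hd : c.rel.1.arity ≤ d)
    (hc : v.rel b = some c.rel) (hb : ∀ i, S (.arg b i) = argCode c i) (N : ℕ)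
    (hN : (encodeConstraint c).length ≤ N)
    (h : ∀ k, S' k = if k = X then f v :: argsCode c ++ S X else S k) :
    Runs (write b X f) (v, S) (ioCost d N) (v, S') := by
  have h₁ := runs_writeArgs b X hX v hv S hT c hc (S X) hb N hN d le_rfl
    (fun k => if k = X then argsCode c ++ S X else S k) (by rw [drop_range_eq_nil c hd]; rfl)
    (fun k => rfl)
  have h₂ := Runs.push X f v (fun k => if k = X then argsCode c ++ S X else S k) S' (fun j => by
    rw [h]
    by_cases hj : j = X <;> simp [hj])
  exact (h₁.seq h₂).mono (by rw [ioCost]; omega)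

theorem runs_clearArgs (b : Bool) (v : Reg G) (hv : v.sym = none)
    (S S' : Stk d → List (Symb G)) (hT : S .T = []) (N : ℕ)
    (hN : ∀ i, (S (.arg b i)).length ≤ N) (h₁ : ∀ i, S' (.arg b i) = [])
    (h₂ : ∀ k, (∀ i, k ≠ .arg b i) → S' k = S k) :
    Runs (clearArgs b d) (v, S) (ioCost d N) (v, S') := by
  have key (n : ℕ) (hn : n ≤ d) : ∃ S' : Stk d → List (Symb G),
      Runs (clearArgs b n) (v, S) (1 + n * (10 * (N + 1))) (v, S') ∧
      (∀ i : Fin d, S' (.arg b i) = if i.1 < n then [] else S (.arg b i)) ∧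
      ∀ k, (∀ i, k ≠ .arg b i) → S' k = S k := by
    induction n with
    | zero => exact ⟨S, (runs_skip v S).mono (by omega), by simp, fun _ _ => rfl⟩
    | succ n ih =>
      obtain ⟨S', e₁, e₂, e₃⟩ := ih (by omega)
      have hnd : n < d := by omega
      let S'' : Stk d → List (Symb G) := fun k => if k = .arg b ⟨n, hnd⟩ then [] else S' k
      have e₄ := runs_transferAll v S' S'' (.arg b ⟨n, hnd⟩) [] (by simp) (by simp) (by simp)
        (by simp) (by rw [e₃ _ (by simp), hT]) N (by rw [e₂]; simpa using hN _)
        (fun k => by simp [S''])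
      have hv' : ({ v with sym := none } : Reg G) = v := by rw [← hv]
      rw [hv'] at e₄
      refine ⟨S'', ?_, fun i => ?_, fun k hk => ?_⟩
      · rw [clearArgs, dif_pos hnd]
        refine (e₁.seq e₄).mono ?_
        rw [Nat.add_mul]; omega
      · by_cases hi : i = ⟨n, hnd⟩
        · subst hi; simp [S'']
        · have : i.1 ≠ n := fun h => hi (Fin.ext h)
          have e : (i.1 < n + 1) = (i.1 < n) := propext (by omega)
          simp [S'', hi, e₂, e]
      · simp only [S'', hk _, if_false]
        exact e₃ k hk
  obtain ⟨S'', e₁, e₂, e₃⟩ := key d le_rfl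
  have : S'' = S' := by
    funext k
    by_cases hk : ∃ i, k = .arg b i
    · obtain ⟨i, rfl⟩ := hk
      rw [e₂, h₁, if_pos i.2]
    · push Not at hk
      rw [e₃ k hk, h₂ k hk]
  subst this
  refine e₁.mono ?_
  have := Nat.mul_le_mul_left d (Nat.le_add_right (10 * (N + 1)) 1)
  rw [ioCost]
  omega

end Program

end Machine

/-- Unlike in `loop_foldl`, the state is not a function of the accumulated value and the remaining
list: registers left by comparisons and the exact word of the counter are only existentially
described. -/
theorem Prog.Runs.loop_inv {K A σ : Type} [DecidableEq K] {p : Prog K A σ} {n : ℕ} {α : Type*}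
    {b : σ → Bool} (I : List α → σ × (K → List A) → Prop)
    (hnil : ∀ s, I [] s → b s.1 = false)
    (hcons : ∀ x l s, I (x :: l) s → b s.1 = true ∧ ∃ t, I l t ∧ Prog.Runs p s n t)
    (l : List α) (s : σ × (K → List A)) (h : I l s) :
    ∃ t, I [] t ∧ Prog.Runs (.loop b p) s (l.length * (n + 1) + 1) t := by
  induction l generalizing s with
  | nil => exact ⟨s, h, 1, by simp, .loop_false (hnil s h)⟩
  | cons x l ih =>
    obtain ⟨h₁, t, h₂, k, hk, h₃⟩ := hcons x l s h
    obtain ⟨u, h₄, m, hm, h₅⟩ := ih t h₂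
    refine ⟨u, h₄, 1 + k + m, ?_, .loop_true h₁ h₃ h₅⟩
    rw [List.length_cons, Nat.add_mul, Nat.one_mul]
    omega

/-! ### Programs for a pass; cost of one step of the greedy search -/

section Machine

open scoped Classical
open Prog

variable {G : Finset BoolRel} {d : ℕ}

/-- The contents of the stacks, apart from those that are empty between operations. -/
structure Mem (G : Finset BoolRel) (d : ℕ) : Type where
  A : List (Symb G) := []
  B : List (Symb G) := []
  B₂ : List (Symb G) := []
  O : List (Symb G) := []
  L : List (Symb G) := []
  L₂ : List (Symb G) := []
  M : List (Symb G) := []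
  M₂ : List (Symb G) := []
  a : Fin d → List (Symb G) := fun _ => []
  b : Fin d → List (Symb G) := fun _ => []

/-- The contents of all stacks. -/
def Mem.stk (m : Mem G d) : Stk d → List (Symb G)
  | .A => m.A
  | .B => m.B
  | .B₂ => m.B₂
  | .O => m.O
  | .L => m.L
  | .L₂ => m.L₂
  | .M => m.M
  | .M₂ => m.M₂
  | .T | .P | .Q => []
  | .arg false i => m.a i
  | .arg true i => m.b i

/-- The finite memory between operations. -/
def reg (ra rb : Option G) (e f h : Bool) : Reg G :=
  ⟨none, none, ra, rb, e, f, h⟩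

/-- The numbers of a list in binary. -/
def numsCode (G : Finset BoolRel) (l : List ℕ) : List (Symb G) :=
  l.flatMap (encodeNumber G)

namespace Program

/-- Check that the constraints on the two families of stacks agree in the positions `S`. -/
noncomputable def checkKept : List (Fin d) → Program G d
  | [] => skip
  | i :: S => .seq (eqNum (.arg false i) (.arg true i))
      (.seq (.load fun v => { v with flag := v.flag && v.eq }) (checkKept S))

/-- Compare one variable with the first number on `L₂`. -/
noncomputable def freshStep (i : Fin d) : Program G d :=
  .seq (eqNum (.arg true i) .L₂) (.seq (.load fun v => { v with flag := v.flag && !v.eq })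
    (.seq (transferNum .L₂ []) (.peek .L₂ fun v a => { v with sym := a })))

/-- Check that the variables in the positions `P` are not on `L`. -/
noncomputable def checkFresh : List (Fin d) → Program G d
  | [] => skip
  | i :: P => .seq (.seq (transferAll .L [.L, .L₂]) (.seq (.peek .L₂ fun v a => { v with sym := a })
      (.loop (fun v => v.sym.isSome) (freshStep i)))) (checkFresh P)

/-- Add the variables in the positions `P` to `L`. -/
noncomputable def addPetals : List (Fin d) → Program G d
  | [] => skip
  | i :: P => .seq (transferNum (.arg true i) [.arg true i, .L]) (addPetals P)

/-- Add one `R`-constraint to the greedy search. -/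
noncomputable def collectProg (R : G) (S P : List (Fin d)) : Program G d :=
  .seq (.ite (fun v => decide (v.rb = some R))
    (.seq (.load fun v => { v with flag := true }) (.seq (checkKept S) (.seq (checkFresh P)
      (.ite (fun v => v.flag) (.seq (addPetals P) decr) skip)))) skip) (clearArgs true d)

/-- The greedy search. -/
noncomputable def scanProg (R : G) (S P : List (Fin d)) : Program G d :=
  .seq (read true .B₂) (.loop (fun v => v.rb.isSome) (.seq (collectProg R S P) (read true .B₂)))

/-- The greedy search for the current constraint. -/
noncomputable def heavyProg (R : G) (S P : List (Fin d)) : Program G d :=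
  .seq (transferAll .B [.B, .B₂]) (.seq (transferAll .M [.M, .M₂]) (.seq (scanProg R S P)
    (.seq (transferAll .M₂ []) (transferAll .L []))))

/-- Process one constraint in a pass. -/
noncomputable def passStep (R Q₁ Q₂ : G) (S P : List (Fin d)) : Program G d :=
  .seq (.load fun v => { v with heavy := false }) (.seq
    (.ite (fun v => decide (v.ra = some R)) (heavyProg R S P) skip) (.seq
    (.ite (fun v => v.heavy)
      (.seq (write false .O fun _ => Symb.rel Q₁) (write false .O fun _ => Symb.rel Q₂))
      (write false .O fun v => (v.ra.map Symb.rel).getD Symb.comma))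
    (clearArgs false d)))

/-- A pass. -/
noncomputable def passProg (R Q₁ Q₂ : G) (S P : List (Fin d)) : Program G d :=
  .seq (transferAll .A [.A, .B]) (.seq (read false .A) (.seq
    (.loop (fun v => v.ra.isSome) (.seq (passStep R Q₁ Q₂ S P) (read false .A)))
    (.seq (transferAll .B []) (transferAll .O [.A]))))

theorem runs_checkKept (S : List (Fin d)) (c c' : Constraint G)
    (hS : ∀ i ∈ S, i.1 < c.rel.1.arity ∧ i.1 < c'.rel.1.arity) (m : Mem G d)
    (ha : m.a = fun i : Fin d => argCode c i) (hb : m.b = fun i : Fin d => argCode c' i) (N : ℕ)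
    (hN : (encodeConstraint c).length ≤ N ∧ (encodeConstraint c').length ≤ N)
    (ra rb : Option G) (e f h : Bool) :
    ∃ e', Runs (checkKept S) (reg ra rb e f h, m.stk) (S.length * (30 * (N + 1) + 1) + 1)
      (reg ra rb e' (f && decide (∀ i ∈ S, c.arg i = c'.arg i)) h, m.stk) := by
  induction S generalizing e f with
  | nil =>
    refine ⟨e, ?_⟩
    have h₁ := (runs_skip (reg ra rb e f h) m.stk).mono (n := ([] : List (Fin d)).length * (30 * (N + 1) + 1) + 1) (by omega)
    simp only [List.not_mem_nil, false_imp_iff, implies_true, decide_true, Bool.and_true]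
    exact h₁
  | cons i S ih =>
    have hi := hS i List.mem_cons_self
    obtain ⟨e', h₃⟩ := ih (fun j hj => hS j (List.mem_cons_of_mem _ hj))
      (decide (c.arg i = c'.arg i)) (f && decide (c.arg i = c'.arg i))
    have h₁ := runs_eqNum (reg ra rb e f h) m.stk (.arg false i) (.arg true i) (by simp) (by simp)
      ⟨rfl, rfl, rfl⟩ (c.arg i) (c'.arg i) N [] [] (by simp [Mem.stk, ha, argCode, hi])
      (by simp [Mem.stk, hb, argCode, hi]) ((length_encodeNumber_arg_le hi.1).trans hN.1)
      ((length_encodeNumber_arg_le hi.2).trans hN.2)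
    have h₂ := Runs.load (fun v : Reg G => { v with flag := v.flag && v.eq })
      (reg ra rb (decide (c.arg i = c'.arg i)) f h) m.stk
    refine ⟨e', ?_⟩
    have h₄ := (h₁.seq (h₂.seq h₃)).mono
      (n := (i :: S).length * (30 * (N + 1) + 1) + 1) (by
        rw [List.length_cons, Nat.add_mul]; omega)
    have : (f && decide (c.arg i = c'.arg i) && decide (∀ i ∈ S, c.arg i = c'.arg i)) =
        (f && decide (∀ j ∈ i :: S, c.arg j = c'.arg j)) := by
      rw [Bool.and_assoc, ← Bool.decide_and]
      simp
    rw [this] at h₄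
    exact h₄

theorem encodeNumber_ne_nil (x : ℕ) : encodeNumber G x ≠ [] := by
  simp [encodeNumber]

theorem length_numsCode_le (l : List ℕ) (N : ℕ) (h : ∀ x ∈ l, (encodeNumber G x).length ≤ N) :
    (numsCode G l).length ≤ l.length * N := by
  induction l with
  | nil => simp [numsCode]
  | cons x l ih =>
    have h₁ := h x List.mem_cons_self
    have h₂ := ih fun y hy => h y (List.mem_cons_of_mem _ hy)
    simp only [numsCode, List.flatMap_cons, List.length_append, List.length_cons] at h₂ ⊢
    rw [Nat.add_mul]
    omega

/-- A bound for the cost of comparing one variable with `n` numbers. -/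
def freshCost (n N : ℕ) : ℕ := 10 * (n * N + 1) + n * (40 * (N + 1) + 2 + 1) + 2

theorem runs_freshOne (i : Fin d) (c' : Constraint G) (hi : i.1 < c'.rel.1.arity) (m : Mem G d)
    (bl : List ℕ) (hL : m.L = numsCode G bl) (hL₂ : m.L₂ = [])
    (hb : m.b = fun i : Fin d => argCode c' i) (N n : ℕ)
    (hN : (encodeConstraint c').length ≤ N) (hbl : ∀ x ∈ bl, (encodeNumber G x).length ≤ N)
    (hn : bl.length ≤ n) (ra rb : Option G) (e f h : Bool) :
    ∃ e', Runs (.seq (transferAll .L [.L, .L₂]) (.seq (.peek .L₂ fun v a => { v with sym := a })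
      (.loop (fun v => v.sym.isSome) (freshStep i)))) (reg ra rb e f h, m.stk) (freshCost n N)
      (reg ra rb e' (f && decide (c'.arg i ∉ bl)) h, m.stk) := by
  have h₁ := runs_transferAll (reg ra rb e f h) m.stk { m with L₂ := numsCode G bl }.stk
    .L [.L, .L₂] (by simp) (by simp) (by simp) (by simp) rfl (n * N)
    (by
      change m.L.length ≤ _
      rw [hL]
      exact (length_numsCode_le bl N hbl).trans (Nat.mul_le_mul_right _ hn))
    (fun k => by rcases k with _ | _ | _ | _ | _ | _ | _ | _ | _ | _ | _ | ⟨_ | _, j⟩ <;>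
      simp [Mem.stk, hL, hL₂])
  -- The pair `y` holds the last comparison and the flag. The loop always reads the whole list;
  -- peeking at the next symbol detects its end, because no encoded number is empty.
  let st (y : Bool × Bool) (l : List ℕ) : Reg G × (Stk d → List (Symb G)) :=
    (⟨(numsCode G l).head?, none, ra, rb, y.1, y.2, h⟩, { m with L₂ := numsCode G l }.stk)
  have h₂ := Runs.peek Stk.L₂ (fun (v : Reg G) a => { v with sym := a }) (reg ra rb e f h)
    { m with L₂ := numsCode G bl }.stk
  have h₃ := Runs.loop_foldl (p := freshStep i) (n := 40 * (N + 1) + 2)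
    (b := fun v : Reg G => v.sym.isSome)
    (fun (y : Bool × Bool) x => (decide (c'.arg i = x), y.2 && !decide (c'.arg i = x))) st
    (fun _ l => ∀ x ∈ l, (encodeNumber G x).length ≤ N) (fun y => rfl) (fun y x l hx => by
      refine ⟨?_, fun z hz => hx z (List.mem_cons_of_mem _ hz), ?_⟩
      · obtain ⟨s, r, hsr⟩ := List.exists_cons_of_ne_nil (encodeNumber_ne_nil (G := G) x)
        simp [st, numsCode, hsr]
      have e₁ := runs_eqNum (st y (x :: l)).1 (st y (x :: l)).2 (.arg true i) .L₂ (by simp)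
        (by simp) ⟨rfl, rfl, rfl⟩ (c'.arg i) x N [] (numsCode G l)
        (by simp [st, Mem.stk, hb, argCode, hi]) rfl ((length_encodeNumber_arg_le hi).trans hN)
        (hx x List.mem_cons_self)
      have e₂ := Runs.load (fun v : Reg G => { v with flag := v.flag && !v.eq })
        ⟨none, none, ra, rb, decide (c'.arg i = x), y.2, h⟩ (st y (x :: l)).2
      have e₃ := runs_transferNum
        ⟨none, none, ra, rb, decide (c'.arg i = x), y.2 && !decide (c'.arg i = x), h⟩
        (st y (x :: l)).2 { m with L₂ := numsCode G l }.stk .L₂ [] (by simp) (by simp) (by simp)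
        (by simp) rfl x N (numsCode G l) rfl (hx x List.mem_cons_self) (fun k => by
          rcases k with _ | _ | _ | _ | _ | _ | _ | _ | _ | _ | _ | ⟨_ | _, j⟩ <;>
          simp [Mem.stk, st])
      have e₄ := Runs.peek Stk.L₂ (fun (v : Reg G) a => { v with sym := a })
        ⟨none, none, ra, rb, decide (c'.arg i = x), y.2 && !decide (c'.arg i = x), h⟩
        { m with L₂ := numsCode G l }.stk
      exact (e₁.seq (e₂.seq (e₃.seq e₄))).mono (by omega)) (e, f) bl hbl
  have hfold (l : List ℕ) (y : Bool × Bool) : (l.foldl (fun (y : Bool × Bool) x =>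
      (decide (c'.arg i = x), y.2 && !decide (c'.arg i = x))) y).2 =
        (y.2 && decide (c'.arg i ∉ l)) := by
    induction l generalizing y with
    | nil => simp
    | cons x l ih =>
      rw [List.foldl_cons, ih]
      by_cases hx : c'.arg i = x <;> simp [hx]
  set y := bl.foldl (fun (y : Bool × Bool) x =>
      (decide (c'.arg i = x), y.2 && !decide (c'.arg i = x))) (e, f) with hy
  refine ⟨y.1, ?_⟩
  have h₄ := (h₁.seq (h₂.seq h₃)).mono (n := freshCost n N) (by
    have := Nat.mul_le_mul_right (40 * (N + 1) + 2 + 1) hn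
    rw [freshCost]; omega)
  have hst : st y [] = (reg ra rb y.1 (f && decide (c'.arg i ∉ bl)) h, m.stk) := by
    have : y.2 = (f && decide (c'.arg i ∉ bl)) := hfold bl (e, f)
    have hm : ({ m with L₂ := numsCode G [] } : Mem G d) = m := by
      rw [show numsCode G [] = m.L₂ from hL₂.symm]
    rw [← this]
    simp only [st, hm]
    rfl
  rw [hst] at h₄
  exact h₄

theorem runs_checkFresh (P : List (Fin d)) (c' : Constraint G)
    (hP : ∀ i ∈ P, i.1 < c'.rel.1.arity) (m : Mem G d)
    (bl : List ℕ) (hL : m.L = numsCode G bl) (hL₂ : m.L₂ = [])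
    (hb : m.b = fun i : Fin d => argCode c' i) (N n : ℕ)
    (hN : (encodeConstraint c').length ≤ N) (hbl : ∀ x ∈ bl, (encodeNumber G x).length ≤ N)
    (hn : bl.length ≤ n) (ra rb : Option G) (e f h : Bool) :
    ∃ e', Runs (checkFresh P) (reg ra rb e f h, m.stk) (P.length * freshCost n N + 1)
      (reg ra rb e' (f && decide (∀ i ∈ P, c'.arg i ∉ bl)) h, m.stk) := by
  induction P generalizing e f with
  | nil =>
    refine ⟨e, ?_⟩
    have h₁ := (runs_skip (reg ra rb e f h) m.stk).mono (n := ([] : List (Fin d)).length * freshCost n N + 1) (by omega)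
    simp only [List.not_mem_nil, false_imp_iff, implies_true, decide_true, Bool.and_true]
    exact h₁
  | cons i P ih =>
    obtain ⟨e₁, h₁⟩ := runs_freshOne i c' (hP i List.mem_cons_self) m bl hL hL₂ hb N n hN hbl hn
      ra rb e f h
    obtain ⟨e₂, h₂⟩ := ih (fun j hj => hP j (List.mem_cons_of_mem _ hj)) e₁
      (f && decide (c'.arg i ∉ bl))
    refine ⟨e₂, ?_⟩
    have h₃ := (h₁.seq h₂).mono (n := (i :: P).length * freshCost n N + 1) (by
      rw [List.length_cons, Nat.add_mul]; omega)
    have : (f && decide (c'.arg i ∉ bl) && decide (∀ i ∈ P, c'.arg i ∉ bl)) =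
        (f && decide (∀ j ∈ i :: P, c'.arg j ∉ bl)) := by
      rw [Bool.and_assoc, ← Bool.decide_and]
      simp
    rw [this] at h₃
    exact h₃

theorem runs_addPetals (P : List (Fin d)) (c' : Constraint G)
    (hP : ∀ i ∈ P, i.1 < c'.rel.1.arity) (m : Mem G d) (bl : List ℕ)
    (hL : m.L = numsCode G bl) (hb : m.b = fun i : Fin d => argCode c' i) (N : ℕ)
    (hN : (encodeConstraint c').length ≤ N) (ra rb : Option G) (e f h : Bool) :
    Runs (addPetals P) (reg ra rb e f h, m.stk) (P.length * (10 * (N + 1)) + 1)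
      (reg ra rb e f h,
        { m with L := numsCode G ((P.map fun i : Fin d => c'.arg i).reverse ++ bl) }.stk) := by
  induction P generalizing m bl with
  | nil =>
    have := runs_skip (reg ra rb e f h) m.stk
    simp only [List.map_nil, List.reverse_nil, List.nil_append, ← hL]
    exact this.mono (by omega)
  | cons i P ih =>
    have hi := hP i List.mem_cons_self
    have h₁ := runs_transferNum (reg ra rb e f h) m.stk
      { m with L := numsCode G (c'.arg i :: bl) }.stk (.arg true i) [.arg true i, .L] (by simp)
      (by simp) (by simp) (by simp) rfl (c'.arg i) N [] (by simp [Mem.stk, hb, argCode, hi])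
      ((length_encodeNumber_arg_le hi).trans hN) (fun k => by
        rcases k with _ | _ | _ | _ | _ | _ | _ | _ | _ | _ | _ | ⟨_ | _, j⟩ <;>
          simp [Mem.stk, hL, numsCode]
        by_cases hj : j = i
        · subst hj; simp [hb, argCode, hi]
        · simp [hj])
    have h₂ := ih (fun j hj => hP j (List.mem_cons_of_mem _ hj))
      { m with L := numsCode G (c'.arg i :: bl) } (c'.arg i :: bl) rfl hb
    have h₃ := (h₁.seq h₂).mono (n := (i :: P).length * (10 * (N + 1)) + 1) (by
      rw [List.length_cons, Nat.add_mul]; omega)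
    simp only [List.map_cons, List.reverse_cons, List.append_assoc, List.singleton_append]
    exact h₃

/-- A bound for the cost of `collectProg`. -/
def collectCost (d n N : ℕ) : ℕ :=
  d * (30 * (N + 1) + 1) + d * freshCost n N + d * (10 * (N + 1)) + 10 * (N + 1) +
    ioCost d N + 10

/-- `collectProg` implements `collect`: the counter is decremented exactly when a constraint is
accepted, and underflow raises the `heavy` register. The list grows by at most `d` numbers, each no
longer than `N`, which keeps later steps cheap. -/
theorem runs_collectProg (R : G) (S P : List (Fin d))
    (hS : S.length ≤ d) (hP : P.length ≤ d) (hSR : ∀ i ∈ S, i.1 < R.1.arity)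
    (hPR : ∀ i ∈ P, i.1 < R.1.arity) (c c' : Constraint G) (hc : c.rel = R)
    (m : Mem G d) (ha : m.a = fun i : Fin d => argCode c i) (hb : m.b = fun i : Fin d => argCode c' i)
    (bl : List ℕ) (hL : m.L = numsCode G bl) (hL₂ : m.L₂ = []) (k : ℕ)
    (hM : Represents m.M₂ k) (N n : ℕ)
    (hN : (encodeConstraint c).length ≤ N ∧ (encodeConstraint c').length ≤ N)
    (hbl : ∀ x ∈ bl, (encodeNumber G x).length ≤ N) (hn : bl.length ≤ n)
    (hMN : m.M₂.length ≤ N) (ra : Option G) (e f h : Bool) :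
    ∃ w e' f', Represents w (collect R S P c (bl, k, h) c').2.1 ∧ w.length ≤ N ∧
      (∀ x ∈ (collect R S P c (bl, k, h) c').1, (encodeNumber G x).length ≤ N) ∧
      (collect R S P c (bl, k, h) c').1.length ≤ bl.length + d ∧
      Runs (collectProg R S P) (reg ra (some c'.rel) e f h, m.stk) (collectCost d n N)
        (reg ra (some c'.rel) e' f' (collect R S P c (bl, k, h) c').2.2,
          { m with L := numsCode G (collect R S P c (bl, k, h) c').1, M₂ := w,
                   b := fun _ => [] }.stk) := by
  have hclear (m' : Mem G d) (hb' : m'.b = fun i : Fin d => argCode c' i) (v : Reg G)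
      (hv : v.sym = none) :
      Runs (clearArgs true d) (v, m'.stk) (ioCost d N)
        (v, { m' with b := fun _ => [] }.stk) := by
    refine runs_clearArgs true v hv _ _ rfl N (fun i => ?_) (fun i => rfl) fun k hk => ?_
    · change (m'.b i).length ≤ N
      rw [hb']
      exact (length_argCode_le c' i).trans hN.2
    · rcases k with _ | _ | _ | _ | _ | _ | _ | _ | _ | _ | _ | ⟨_ | _, j⟩ <;> try rfl
      exact absurd rfl (hk j)
  by_cases hR : c'.rel = R
  · obtain ⟨e₁, h₁⟩ := runs_checkKept S c c' (fun i hi => ⟨by rw [hc]; exact hSR i hi,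
      by rw [hR]; exact hSR i hi⟩) m ha hb N hN ra (some c'.rel) e true h
    obtain ⟨e₂, h₂⟩ := runs_checkFresh P c' (fun i hi => by rw [hR]; exact hPR i hi) m bl hL hL₂ hb
      N n hN.2 hbl hn ra (some c'.rel) e₁ (true && decide (∀ i ∈ S, c.arg i = c'.arg i)) h
    have h₀ := Runs.load (fun v : Reg G => { v with flag := true })
      (reg ra (some c'.rel) e f h) m.stk
    have l₁ := Nat.mul_le_mul_right (30 * (N + 1) + 1) hS
    have l₂ := Nat.mul_le_mul_right (freshCost n N) hP
    have l₃ := Nat.mul_le_mul_right (10 * (N + 1)) hP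
    by_cases hx : Agrees R S c c' ∧ ∀ i ∈ P, c'.arg i ∉ bl
    · have hflag : (true && decide (∀ i ∈ S, c.arg i = c'.arg i) &&
          decide (∀ i ∈ P, c'.arg i ∉ bl)) = true := by
        simp only [Bool.true_and, Bool.and_eq_true, decide_eq_true_eq]
        exact ⟨hx.1.2, hx.2⟩
      rw [hflag] at h₂
      have h₃ := runs_addPetals P c' (fun i hi => by rw [hR]; exact hPR i hi) m bl hL hb N hN.2
        ra (some c'.rel) e₂ true h
      let m' : Mem G d := { m with L := numsCode G ((P.map fun i : Fin d => c'.arg i).reverse ++ bl) }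
      obtain ⟨w, hw₁, hw₂, h₄⟩ := runs_decr (reg ra (some c'.rel) e₂ true h) m'.stk rfl k N hM hMN
      have hm' : (fun k => if k = .M₂ then w else m'.stk k) = { m' with M₂ := w }.stk := by
        funext k
        rcases k with _ | _ | _ | _ | _ | _ | _ | _ | _ | _ | _ | ⟨_ | _, j⟩ <;> simp [Mem.stk]
      have h₄' : Runs decr (reg ra (some c'.rel) e₂ true h, m'.stk) (10 * (N + 1))
          (reg ra (some c'.rel) e₂ true (h || decide (k = 0)), { m' with M₂ := w }.stk) :=
        hm' ▸ h₄
      have h₅ := Runs.ite (b := fun v : Reg G => v.flag) (q := skip) (fun _ => h₃.seq h₄')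
        (fun h => absurd h (by simp [reg]))
      have h₆ := Runs.ite (b := fun v : Reg G => decide (v.rb = some R)) (q := skip)
        (fun _ => h₀.seq (h₁.seq (h₂.seq h₅))) (fun h => absurd h (by simp [reg, hR]))
      have h₇ := h₆.seq (hclear { m with
        L := numsCode G ((P.map fun i : Fin d => c'.arg i).reverse ++ bl), M₂ := w } hb
        (reg ra (some c'.rel) e₂ true (h || decide (k = 0))) rfl)
      rw [collect, if_pos hx]
      refine ⟨w, e₂, true, hw₁, hw₂.trans hMN, fun x hx => ?_, ?_, h₇.mono ?_⟩
      · simp only [List.mem_append, List.mem_reverse, List.mem_map] at hx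
        rcases hx with ⟨i, hi, rfl⟩ | hx
        · exact (length_encodeNumber_arg_le (by rw [hR]; exact hPR i hi)).trans hN.2
        · exact hbl x hx
      · simp only [List.length_append, List.length_reverse, List.length_map]
        omega
      · rw [collectCost]
        omega
    · have hflag : (true && decide (∀ i ∈ S, c.arg i = c'.arg i) &&
          decide (∀ i ∈ P, c'.arg i ∉ bl)) = false := by
        rw [Bool.true_and, ← Bool.decide_and, decide_eq_false_iff_not]
        exact fun h => hx ⟨⟨hR, h.1⟩, h.2⟩
      rw [hflag] at h₂
      have h₅ := Runs.ite (b := fun v : Reg G => v.flag) (p := .seq (addPetals P) decr)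
        (s := (reg ra (some c'.rel) e₂ false h, m.stk))
        (fun h => absurd h (by simp [reg])) (fun _ => runs_skip _ _)
      have h₆ := Runs.ite (b := fun v : Reg G => decide (v.rb = some R)) (q := skip)
        (fun _ => h₀.seq (h₁.seq (h₂.seq h₅))) (fun h => absurd h (by simp [reg, hR]))
      have h₇ := h₆.seq (hclear m hb (reg ra (some c'.rel) e₂ false h) rfl)
      rw [collect, if_neg hx]
      refine ⟨m.M₂, e₂, false, hM, hMN, hbl, Nat.le_add_right _ _, ?_⟩
      simp only [← hL]
      refine h₇.mono ?_
      rw [collectCost]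
      omega
  · have h₆ := Runs.ite (b := fun v : Reg G => decide (v.rb = some R))
      (p := .seq (.load fun v => { v with flag := true }) (.seq (checkKept S) (.seq (checkFresh P)
        (.ite (fun v => v.flag) (.seq (addPetals P) decr) skip))))
      (s := (reg ra (some c'.rel) e f h, m.stk))
      (fun h => absurd h (by simp [reg, hR])) (fun _ => runs_skip _ _)
    have h₇ := h₆.seq (hclear m hb (reg ra (some c'.rel) e f h) rfl)
    rw [collect, if_neg (fun h => hR h.1.1)]
    refine ⟨m.M₂, e, f, hM, hMN, hbl, Nat.le_add_right _ _, ?_⟩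
    simp only [← hL]
    refine h₇.mono ?_
    rw [collectCost]
    omega

end Program

end Machine

/-! ### Cost of the greedy search and of a pass -/

section Machine

open scoped Classical
open Prog

variable {G : Finset BoolRel} {d : ℕ}

theorem encodeFormula_cons (c : Constraint G) (F : Formula G) :
    encodeFormula (c :: F) = encodeConstraint c ++ encodeFormula F := by
  simp [encodeFormula]

theorem length_le_length_encodeFormula (F : Formula G) : F.length ≤ (encodeFormula F).length := by
  induction F with
  | nil => simp
  | cons c F ih =>
    rw [encodeFormula_cons, List.length_append, encodeConstraint_eq, List.length_cons,
      List.length_cons]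
    omega

/-- The variable of the first constraint of a formula in position `i` in binary. -/
def headCode : Formula G → ℕ → List (Symb G)
  | [], _ => []
  | c :: _, i => argCode c i

/-- Each constraint yields at most two, with the same variables and a single symbol for the
relation, so the encoding at most doubles. -/
theorem length_encodeFormula_pass_le (R Q₁ Q₂ : G) (hQ₁ : Q₁.1.arity = R.1.arity)
    (hQ₂ : Q₂.1.arity = R.1.arity) (S P : List (Fin d)) (k : ℕ) (F : Formula G) :
    (encodeFormula (pass R Q₁ Q₂ S P k F)).length ≤ 2 * (encodeFormula F).length := by
  have key (l O : Formula G) : (encodeFormula (l.foldl (fun O c =>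
      if c.rel = R ∧ heavy R S P k F c = true then
        c.withRel Q₂ :: c.withRel Q₁ :: O else c :: O) O)).length ≤
      (encodeFormula O).length + 2 * (encodeFormula l).length := by
    induction l generalizing O with
    | nil => simp
    | cons c l ih =>
      rw [List.foldl_cons]
      refine (ih _).trans ?_
      split_ifs with h
      · simp only [encodeFormula_cons, List.length_append, encodeConstraint_eq c,
          encodeConstraint_withRel c (hQ₁.trans (congrArg (fun R : G => R.1.arity) h.1.symm)),
          encodeConstraint_withRel c (hQ₂.trans (congrArg (fun R : G => R.1.arity) h.1.symm)),
          List.length_cons]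
        omega
      · simp only [encodeFormula_cons, List.length_append]
        omega
  simpa [pass, encodeFormula] using key F []

namespace Program

theorem runs_readHead (hG : ∀ R ∈ G, R.arity ≤ d) (b : Bool) (X : Stk d)
    (hX : X ≠ .T ∧ ∀ i, X ≠ .arg b i) (v : Reg G) (S S' : Stk d → List (Symb G))
    (hT : S .T = []) (l : Formula G) (hSX : S X = encodeFormula l)
    (hb : ∀ i, S (.arg b i) = []) (N : ℕ) (hN : (encodeFormula l).length ≤ N)
    (h₁ : S' X = encodeFormula l.tail) (h₂ : ∀ i : Fin d, S' (.arg b i) = headCode l i)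
    (h₃ : ∀ k, k ≠ X → (∀ i, k ≠ .arg b i) → S' k = S k) :
    Runs (read b X) (v, S) (ioCost d N)
      (Reg.setRel { v with sym := none } b (l.head?.map Constraint.rel), S') := by
  rcases l with _ | ⟨c, l⟩
  · obtain rfl : S' = S := by
      funext k
      by_cases hk : k = X
      · subst hk; rw [h₁, hSX]; rfl
      · by_cases hk' : ∃ i, k = .arg b i
        · obtain ⟨i, rfl⟩ := hk'
          rw [h₂, hb]; rfl
        · push Not at hk'
          exact h₃ k hk hk'
    refine (runs_read_nil b X v S' hSX).mono ?_
    rw [ioCost]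
    have := Nat.mul_le_mul_left d (show 2 ≤ 10 * (N + 1) + 1 by omega)
    omega
  · rw [encodeFormula_cons] at hSX hN
    exact runs_read b X hX v S S' hT c (hG _ c.rel.2) (encodeFormula l) hSX hb N
      (by rw [List.length_append] at hN; omega) h₁ h₂ h₃

/-- A bound for the cost of `scanProg`. -/
def scanCost (d N : ℕ) : ℕ :=
  ioCost d N + (N * (collectCost d (d * N) N + ioCost d N + 1) + 1)

theorem runs_scanProg (hG : ∀ R ∈ G, R.arity ≤ d) (R : G) (S P : List (Fin d))
    (hS : S.length ≤ d) (hP : P.length ≤ d) (hSR : ∀ i ∈ S, i.1 < R.1.arity)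
    (hPR : ∀ i ∈ P, i.1 < R.1.arity) (c : Constraint G) (hc : c.rel = R) (F : Formula G)
    (m : Mem G d) (ha : m.a = fun i : Fin d => argCode c i) (hb : m.b = fun _ => [])
    (hB₂ : m.B₂ = encodeFormula F) (hL : m.L = []) (hL₂ : m.L₂ = []) (k : ℕ)
    (hM : Represents m.M₂ k) (N : ℕ) (hcN : (encodeConstraint c).length ≤ N)
    (hFN : (encodeFormula F).length ≤ N) (hMN : m.M₂.length ≤ N) (ra : Option G) (e f : Bool) :
    ∃ bl w e' f', (numsCode G bl).length ≤ d * N * N ∧ w.length ≤ N ∧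
      Runs (scanProg R S P) (reg ra none e f false, m.stk) (scanCost d N)
        (reg ra none e' f' (heavy R S P k F c),
          { m with L := numsCode G bl, M₂ := w, B₂ := [] }.stk) := by
  have hlen : F.length ≤ N := (length_le_length_encodeFormula F).trans hFN
  have h₁ := runs_readHead hG true .B₂ (by simp) (reg ra none e f false) m.stk
    { m with B₂ := encodeFormula F.tail, b := fun i => headCode F i }.stk rfl F hB₂
    (fun i => by simp [Mem.stk, hb]) N hFN rfl (fun i => rfl) (fun k hk hk' => by
      rcases k with _ | _ | _ | _ | _ | _ | _ | _ | _ | _ | _ | ⟨_ | _, j⟩ <;> try rfl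
      · exact absurd rfl hk
      · exact absurd rfl (hk' j))
  -- The invariant says that finishing the fold from the current state gives the final result. The
  -- quantity `bl.length + d * l.length` does not increase, so the list of used variables never
  -- exceeds `d * N` entries.
  let I (l : Formula G) (s : Reg G × (Stk d → List (Symb G))) : Prop :=
    ∃ bl k' h w e f, l.foldl (collect R S P c) (bl, k', h) =
        F.foldl (collect R S P c) ([], k, false) ∧
      (∀ x ∈ bl, (encodeNumber G x).length ≤ N) ∧ bl.length + d * l.length ≤ d * N ∧
      w.length ≤ N ∧ Represents w k' ∧ (encodeFormula l).length ≤ N ∧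
      s = (reg ra (l.head?.map Constraint.rel) e f h, { m with
        L := numsCode G bl, M₂ := w, B₂ := encodeFormula l.tail,
        b := fun i => headCode l i }.stk)
  obtain ⟨t, ⟨bl, k', h, w, e', f', i₁, i₂, i₃, i₄, -, -, rfl⟩, h₂⟩ :=
    Runs.loop_inv (p := .seq (collectProg R S P) (read true .B₂))
      (n := collectCost d (d * N) N + ioCost d N) (b := fun v : Reg G => v.rb.isSome) I
      (by rintro s ⟨bl, k', h, w, e, f, -, -, -, -, -, -, rfl⟩; rfl)
      (by
        rintro c' l s ⟨bl, k', h, w, e, f, i₁, i₂, i₃, i₄, i₅, i₆, rfl⟩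
        refine ⟨rfl, ?_⟩
        rw [List.length_cons, Nat.mul_add, Nat.mul_one] at i₃
        rw [encodeFormula_cons, List.length_append] at i₆
        obtain ⟨w', e', f', j₁, j₂, j₃, j₄, j₅⟩ := runs_collectProg R S P hS hP hSR hPR c c' hc
          { m with L := numsCode G bl, M₂ := w, B₂ := encodeFormula l, b := fun i => argCode c' i }
          ha rfl bl rfl hL₂ k' i₅ N (d * N) ⟨hcN, by omega⟩ i₂ (by omega) i₄ ra e f h
        rcases hcol : collect R S P c (bl, k', h) c' with ⟨bl', k'', h'⟩
        rw [hcol] at j₁ j₃ j₄ j₅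
        have j₆ := runs_readHead hG true .B₂ (by simp) (reg ra (some c'.rel) e' f' h')
          { m with L := numsCode G bl', M₂ := w', B₂ := encodeFormula l, b := fun _ => [] }.stk
          { m with L := numsCode G bl', M₂ := w', B₂ := encodeFormula l.tail,
                   b := fun i => headCode l i }.stk rfl l rfl (fun i => rfl) N (by omega) rfl
          (fun i => rfl) (fun k hk hk' => by
            rcases k with _ | _ | _ | _ | _ | _ | _ | _ | _ | _ | _ | ⟨_ | _, j⟩ <;> try rfl
            · exact absurd rfl hk
            · exact absurd rfl (hk' j))
        refine ⟨_, ⟨bl', k'', h', w', e', f', ?_, j₃, ?_, j₂, j₁, by omega, rfl⟩, j₅.seq j₆⟩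
        · rw [← i₁, List.foldl_cons, hcol]
        · simp only at j₄; omega)
      F _ ⟨[], k, false, m.M₂, e, f, rfl, by simp,
        by simpa using Nat.mul_le_mul_left d hlen, hMN, hM, hFN, rfl⟩
  have hh : heavy R S P k F c = h := by
    rw [heavy, ← i₁]; rfl
  have hm : ({ m with
      L := numsCode G bl, M₂ := w, B₂ := encodeFormula ([] : Formula G).tail,
      b := fun i => headCode [] i } : Mem G d) =
      { m with L := numsCode G bl, M₂ := w, B₂ := [] } := by
    simp only [headCode, hb]; rfl
  rw [hm] at h₂
  refine ⟨bl, w, e', f', (length_numsCode_le bl N i₂).trans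
    (Nat.mul_le_mul_right _ (by simpa using i₃)), i₄, ?_⟩
  rw [hh]
  have h₃ : Runs (read true .B₂) (reg ra none e f false, m.stk) (ioCost d N)
      (reg ra (F.head?.map Constraint.rel) e f false,
        { m with L := numsCode G [], M₂ := m.M₂, B₂ := encodeFormula F.tail,
                 b := fun i => headCode F i }.stk) := by
    have : numsCode G [] = m.L := by rw [hL]; rfl
    rw [this]
    exact h₁
  refine (h₃.seq h₂).mono ?_
  have := Nat.mul_le_mul_right (collectCost d (d * N) N + ioCost d N + 1) hlen
  rw [scanCost]
  omega

/-- A bound for the cost of `heavyProg`. -/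
def heavyCost (d N : ℕ) : ℕ := 30 * (N + 1) + scanCost d N + 10 * (d * N * N + 1)

theorem runs_heavyProg (hG : ∀ R ∈ G, R.arity ≤ d) (R : G) (S P : List (Fin d))
    (hS : S.length ≤ d) (hP : P.length ≤ d) (hSR : ∀ i ∈ S, i.1 < R.1.arity)
    (hPR : ∀ i ∈ P, i.1 < R.1.arity) (c : Constraint G) (hc : c.rel = R) (F : Formula G)
    (A O : List (Symb G)) (k N : ℕ) (hcN : (encodeConstraint c).length ≤ N)
    (hFN : (encodeFormula F).length ≤ N) (hkN : (encodeNumber G k).length ≤ N)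
    (ra : Option G) (e f : Bool) : ∃ e' f',
      Runs (heavyProg R S P) (reg ra none e f false, Mem.stk
          { A := A, O := O, B := encodeFormula F, M := encodeNumber G k,
            a := fun i : Fin d => argCode c i }) (heavyCost d N)
        (reg ra none e' f' (heavy R S P k F c), Mem.stk
          { A := A, O := O, B := encodeFormula F, M := encodeNumber G k,
            a := fun i : Fin d => argCode c i }) := by
  let m : Mem G d :=
    { A := A, O := O, B := encodeFormula F, M := encodeNumber G k, a := fun i => argCode c i }
  have h₁ := runs_transferAll (reg ra none e f false) m.stk
    { m with B₂ := encodeFormula F }.stk .B [.B, .B₂] (by simp) (by simp) (by simp) (by simp) rfl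
    N hFN (fun k => by rcases k with _ | _ | _ | _ | _ | _ | _ | _ | _ | _ | _ | ⟨_ | _, j⟩ <;>
      simp [Mem.stk, m])
  have h₂ := runs_transferAll (reg ra none e f false) { m with B₂ := encodeFormula F }.stk
    { m with B₂ := encodeFormula F, M₂ := encodeNumber G k }.stk .M [.M, .M₂] (by simp) (by simp)
    (by simp) (by simp) rfl N hkN (fun k => by
      rcases k with _ | _ | _ | _ | _ | _ | _ | _ | _ | _ | _ | ⟨_ | _, j⟩ <;> simp [Mem.stk, m])
  obtain ⟨bl, w, e', f', hbl, hw, h₃⟩ := runs_scanProg hG R S P hS hP hSR hPR c hc F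
    { m with B₂ := encodeFormula F, M₂ := encodeNumber G k } rfl rfl rfl rfl rfl k
    (represents_encodeNumber k) N hcN hFN hkN ra e f
  have h₄ := runs_transferAll (reg ra none e' f' (heavy R S P k F c))
    { m with L := numsCode G bl, M₂ := w }.stk { m with L := numsCode G bl }.stk .M₂ [] (by simp)
    (by simp) (by simp) (by simp) rfl N hw (fun k => by
      rcases k with _ | _ | _ | _ | _ | _ | _ | _ | _ | _ | _ | ⟨_ | _, j⟩ <;> simp [Mem.stk, m])
  have h₅ := runs_transferAll (reg ra none e' f' (heavy R S P k F c))
    { m with L := numsCode G bl }.stk m.stk .L [] (by simp)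
    (by simp) (by simp) (by simp) rfl (d * N * N) hbl (fun k => by
      rcases k with _ | _ | _ | _ | _ | _ | _ | _ | _ | _ | _ | ⟨_ | _, j⟩ <;> simp [Mem.stk, m])
  exact ⟨e', f', (h₁.seq (h₂.seq (h₃.seq (h₄.seq h₅)))).mono (by rw [heavyCost]; omega)⟩

/-- A bound for the cost of `passStep`. -/
def stepCost (d N : ℕ) : ℕ := heavyCost d N + 3 * ioCost d N + 3

theorem runs_passStep (hG : ∀ R ∈ G, R.arity ≤ d) (R Q₁ Q₂ : G)
    (hQ₁ : Q₁.1.arity = R.1.arity) (hQ₂ : Q₂.1.arity = R.1.arity) (S P : List (Fin d))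
    (hS : S.length ≤ d) (hP : P.length ≤ d) (hSR : ∀ i ∈ S, i.1 < R.1.arity)
    (hPR : ∀ i ∈ P, i.1 < R.1.arity) (c : Constraint G) (F O : Formula G)
    (A : List (Symb G)) (k N : ℕ) (hcN : (encodeConstraint c).length ≤ N)
    (hFN : (encodeFormula F).length ≤ N) (hkN : (encodeNumber G k).length ≤ N)
    (e f h : Bool) : ∃ e' f' h',
      Runs (passStep R Q₁ Q₂ S P) (reg (some c.rel) none e f h, Mem.stk
          { A := A, O := encodeFormula O, B := encodeFormula F, M := encodeNumber G k,
            a := fun i : Fin d => argCode c i }) (stepCost d N)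
        (reg (some c.rel) none e' f' h', Mem.stk
          { A := A, B := encodeFormula F, M := encodeNumber G k,
            O := encodeFormula (if c.rel = R ∧ heavy R S P k F c = true then
              c.withRel Q₂ :: c.withRel Q₁ :: O else c :: O) }) := by
  let m (x : List (Symb G)) : Mem G d :=
    { A := A, O := x, B := encodeFormula F, M := encodeNumber G k, a := fun i => argCode c i }
  have h₁ := Runs.load (fun v : Reg G => { v with heavy := false })
    (reg (some c.rel) none e f h) (m (encodeFormula O)).stk
  have hclear (v : Reg G) (hv : v.sym = none) (x : List (Symb G)) :
      Runs (clearArgs false d) (v, (m x).stk) (ioCost d N)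
        (v, Mem.stk { A := A, O := x, B := encodeFormula F, M := encodeNumber G k }) := by
    refine runs_clearArgs false v hv _ _ rfl N (fun i => (length_argCode_le c i).trans hcN)
      (fun i => rfl) fun k hk => ?_
    rcases k with _ | _ | _ | _ | _ | _ | _ | _ | _ | _ | _ | ⟨_ | _, j⟩ <;> try rfl
    exact absurd rfl (hk j)
  have hwrite (g : Reg G → Symb G) (e f h : Bool) (x : List (Symb G)) :
      Runs (write false .O g) (reg (some c.rel) none e f h, (m x).stk) (ioCost d N)
        (reg (some c.rel) none e f h,
          (m (g (reg (some c.rel) none e f h) :: argsCode c ++ x)).stk) :=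
    runs_write false .O (by simp) g _ rfl _ _ rfl c (hG _ c.rel.2) rfl (fun i => rfl) N hcN
      (fun k => by rcases k with _ | _ | _ | _ | _ | _ | _ | _ | _ | _ | _ | ⟨_ | _, j⟩ <;> rfl)
  obtain ⟨e', f', h₂⟩ : ∃ e' f', Runs
      (.ite (fun v => decide (v.ra = some R)) (heavyProg R S P) skip)
      (reg (some c.rel) none e f false, (m (encodeFormula O)).stk) (1 + heavyCost d N)
      (reg (some c.rel) none e' f' (decide (c.rel = R ∧ heavy R S P k F c = true)),
        (m (encodeFormula O)).stk) := by
    by_cases hc : c.rel = R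
    · obtain ⟨e', f', h₂⟩ := runs_heavyProg hG R S P hS hP hSR hPR c hc F A (encodeFormula O) k N
        hcN hFN hkN (some c.rel) e f
      refine ⟨e', f', Runs.ite (fun _ => ?_) fun h => absurd h (by simp [reg, hc])⟩
      simpa [hc] using h₂
    · refine ⟨e, f, Runs.ite (fun h => absurd h (by simp [reg, hc])) fun _ => ?_⟩
      simp only [hc, false_and, decide_false]
      exact (runs_skip _ _).mono (by rw [heavyCost]; omega)
  refine ⟨e', f', decide (c.rel = R ∧ heavy R S P k F c = true), ?_⟩
  by_cases hx : c.rel = R ∧ heavy R S P k F c = true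
  · have h₃ := (hwrite (fun _ => Symb.rel Q₁) e' f' true (encodeFormula O)).seq
      (hwrite (fun _ => Symb.rel Q₂) e' f' true _)
    have h₄ := Runs.ite (b := fun v : Reg G => v.heavy)
      (q := write false .O fun v => (v.ra.map Symb.rel).getD Symb.comma) (fun _ => h₃)
      (fun h => absurd h (by simp [reg]))
    rw [decide_eq_true hx] at h₂ ⊢
    have h₅ := h₁.seq (h₂.seq (h₄.seq (hclear _ rfl _)))
    rw [if_pos hx, encodeFormula_cons, encodeFormula_cons,
      encodeConstraint_withRel c (hQ₁.trans (congrArg (fun R : G => R.1.arity) hx.1.symm)),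
      encodeConstraint_withRel c (hQ₂.trans (congrArg (fun R : G => R.1.arity) hx.1.symm))]
    exact h₅.mono (by rw [stepCost]; omega)
  · have h₃ := hwrite (fun v => (v.ra.map Symb.rel).getD Symb.comma) e' f' false (encodeFormula O)
    have h₄ := Runs.ite (b := fun v : Reg G => v.heavy)
      (p := .seq (write false .O fun _ => Symb.rel Q₁) (write false .O fun _ => Symb.rel Q₂))
      (fun h => absurd h (by simp [reg])) (fun _ => h₃)
    rw [decide_eq_false hx] at h₂ ⊢
    have h₅ := h₁.seq (h₂.seq (h₄.seq (hclear _ rfl _)))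
    rw [if_neg hx, encodeFormula_cons, encodeConstraint_eq]
    exact h₅.mono (by rw [stepCost]; omega)

/-- A bound for the cost of `passProg`. -/
def passCost (d N : ℕ) : ℕ :=
  30 * (N + 1) + 10 * (2 * N + 1) + ioCost d N + N * (stepCost d N + ioCost d N + 1) + 1

theorem runs_passProg (hG : ∀ R ∈ G, R.arity ≤ d) (R Q₁ Q₂ : G)
    (hQ₁ : Q₁.1.arity = R.1.arity) (hQ₂ : Q₂.1.arity = R.1.arity) (S P : List (Fin d))
    (hS : S.length ≤ d) (hP : P.length ≤ d) (hSR : ∀ i ∈ S, i.1 < R.1.arity)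
    (hPR : ∀ i ∈ P, i.1 < R.1.arity) (F : Formula G) (k N : ℕ)
    (hFN : (encodeFormula F).length ≤ N) (hkN : (encodeNumber G k).length ≤ N)
    (e f h : Bool) : ∃ e' f' h',
      Runs (passProg R Q₁ Q₂ S P) (reg none none e f h, Mem.stk (d := d)
          { A := encodeFormula F, M := encodeNumber G k }) (passCost d N)
        (reg none none e' f' h', Mem.stk
          { A := encodeFormula (pass R Q₁ Q₂ S P k F), M := encodeNumber G k }) := by
  have hlen : F.length ≤ N := (length_le_length_encodeFormula F).trans hFN
  let st (l O : Formula G) : Mem G d :=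
    { A := encodeFormula l.tail, B := encodeFormula F, O := encodeFormula O,
      M := encodeNumber G k, a := fun i => headCode l i }
  have hread (l O : Formula G) (hl : (encodeFormula l).length ≤ N) (x : Option G) (e f h : Bool) :
      Runs (read false .A) (reg x none e f h, Mem.stk (d := d)
          { A := encodeFormula l, B := encodeFormula F, O := encodeFormula O,
            M := encodeNumber G k }) (ioCost d N)
        (reg (l.head?.map Constraint.rel) none e f h, (st l O).stk) :=
    runs_readHead hG false .A (by simp) (reg x none e f h) _ _ rfl l rfl (fun i => rfl) N hl rfl
      (fun i => rfl) (fun k hk hk' => by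
        rcases k with _ | _ | _ | _ | _ | _ | _ | _ | _ | _ | _ | ⟨_ | _, j⟩ <;> try rfl
        · exact absurd rfl hk
        · exact absurd rfl (hk' j))
  have h₁ := runs_transferAll (reg none none e f h) (Mem.stk (d := d)
      { A := encodeFormula F, M := encodeNumber G k }) (Mem.stk (d := d)
      { A := encodeFormula F, B := encodeFormula F, O := encodeFormula ([] : Formula G),
        M := encodeNumber G k })
    .A [.A, .B] (by simp) (by simp) (by simp) (by simp) rfl N hFN (fun k => by
      rcases k with _ | _ | _ | _ | _ | _ | _ | _ | _ | _ | _ | ⟨_ | _, j⟩ <;>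
        simp [Mem.stk, encodeFormula])
  -- The accumulator `O` is a stack whose head is the latest constraint, matching the `cons` in
  -- `pass`; so the output needs no reversal.
  let I (l : Formula G) (s : Reg G × (Stk d → List (Symb G))) : Prop :=
    ∃ O e f h, l.foldl (fun O c => if c.rel = R ∧ heavy R S P k F c = true then
        c.withRel Q₂ :: c.withRel Q₁ :: O else c :: O) O = pass R Q₁ Q₂ S P k F ∧
      (encodeFormula l).length ≤ N ∧
      s = (reg (l.head?.map Constraint.rel) none e f h, (st l O).stk)
  obtain ⟨t, ⟨O, e', f', h', hO, -, rfl⟩, h₂⟩ :=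
    Runs.loop_inv (p := .seq (passStep R Q₁ Q₂ S P) (read false .A))
      (n := stepCost d N + ioCost d N) (b := fun v : Reg G => v.ra.isSome) I
      (by rintro s ⟨O, e, f, h, -, -, rfl⟩; rfl)
      (by
        rintro c l s ⟨O, e, f, h, i₁, i₂, rfl⟩
        refine ⟨rfl, ?_⟩
        rw [encodeFormula_cons, List.length_append] at i₂
        obtain ⟨e', f', h', j₁⟩ := runs_passStep hG R Q₁ Q₂ hQ₁ hQ₂ S P hS hP hSR hPR c F O
          (encodeFormula l) k N (by omega) hFN hkN e f h
        exact ⟨_, ⟨_, e', f', h', i₁, by omega, rfl⟩, j₁.seq (hread l _ (by omega) _ e' f' h')⟩)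
      F _ ⟨[], e, f, h, rfl, hFN, rfl⟩
  obtain rfl : O = pass R Q₁ Q₂ S P k F := hO
  set O := pass R Q₁ Q₂ S P k F
  have hO : (encodeFormula O).length ≤ 2 * N :=
    (length_encodeFormula_pass_le R Q₁ Q₂ hQ₁ hQ₂ S P k F).trans (Nat.mul_le_mul_left 2 hFN)
  have h₃ := runs_transferAll (reg none none e' f' h') (st [] O).stk (Mem.stk (d := d)
      { O := encodeFormula O, M := encodeNumber G k }) .B [] (by simp) (by simp) (by simp)
    (by simp) rfl N hFN (fun k => by
      rcases k with _ | _ | _ | _ | _ | _ | _ | _ | _ | _ | _ | ⟨_ | _, j⟩ <;>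
        simp [Mem.stk, encodeFormula, st, headCode])
  have h₄ := runs_transferAll (reg none none e' f' h') (Mem.stk (d := d)
      { O := encodeFormula O, M := encodeNumber G k }) (Mem.stk (d := d)
      { A := encodeFormula O, M := encodeNumber G k }) .O [.A] (by simp) (by simp) (by simp)
    (by simp) rfl (2 * N) hO (fun k => by
      rcases k with _ | _ | _ | _ | _ | _ | _ | _ | _ | _ | _ | ⟨_ | _, j⟩ <;> simp [Mem.stk])
  refine ⟨e', f', h', (h₁.seq ((hread F [] hFN none e f h).seq (h₂.seq (h₃.seq h₄)))).mono ?_⟩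
  have := Nat.mul_le_mul_right (stepCost d N + ioCost d N + 1) hlen
  rw [passCost]
  omega

end Program

end Machine

/-! ### The cost bounds are polynomial -/

section Cost

/-- The function is given by a polynomial. -/
def IsPoly (f : ℕ → ℕ) : Prop :=
  ∃ p : Polynomial ℕ, ∀ n, p.eval n = f n

theorem IsPoly.const (c : ℕ) : IsPoly fun _ => c := ⟨.C c, by simp⟩

theorem IsPoly.id : IsPoly fun n => n := ⟨.X, by simp⟩

theorem IsPoly.add {f g : ℕ → ℕ} : IsPoly f → IsPoly g → IsPoly fun n => f n + g n := by
  rintro ⟨p, hp⟩ ⟨q, hq⟩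
  exact ⟨p + q, fun n => by simp [hp, hq]⟩

theorem IsPoly.mul {f g : ℕ → ℕ} : IsPoly f → IsPoly g → IsPoly fun n => f n * g n := by
  rintro ⟨p, hp⟩ ⟨q, hq⟩
  exact ⟨p * q, fun n => by simp [hp, hq]⟩

theorem IsPoly.comp {f g : ℕ → ℕ} : IsPoly f → IsPoly g → IsPoly fun n => f (g n) := by
  rintro ⟨p, hp⟩ ⟨q, hq⟩
  exact ⟨p.comp q, fun n => by simp [hp, hq]⟩

namespace Program

theorem isPoly_ioCost (d : ℕ) : IsPoly (ioCost d) :=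
  (((IsPoly.const d).mul (((IsPoly.const 10).mul (IsPoly.id.add (.const 1))).add (.const 1))).add
    (.const 2))

theorem isPoly_freshCost (d : ℕ) : IsPoly fun N => freshCost (d * N) N := by
  have h : IsPoly fun N => d * N := (IsPoly.const d).mul .id
  exact (((IsPoly.const 10).mul ((h.mul .id).add (.const 1))).add
    (h.mul ((((IsPoly.const 40).mul (IsPoly.id.add (.const 1))).add (.const 2)).add
      (.const 1)))).add (.const 2)

theorem isPoly_collectCost (d : ℕ) : IsPoly fun N => collectCost d (d * N) N := by
  have h : IsPoly fun N => N + 1 := IsPoly.id.add (.const 1)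
  exact ((((((IsPoly.const d).mul (((IsPoly.const 30).mul h).add (.const 1))).add
    ((IsPoly.const d).mul (isPoly_freshCost d))).add
    ((IsPoly.const d).mul ((IsPoly.const 10).mul h))).add ((IsPoly.const 10).mul h)).add
    (isPoly_ioCost d)).add (.const 10)

theorem isPoly_scanCost (d : ℕ) : IsPoly (scanCost d) :=
  (isPoly_ioCost d).add ((IsPoly.id.mul (((isPoly_collectCost d).add (isPoly_ioCost d)).add
    (.const 1))).add (.const 1))

theorem isPoly_heavyCost (d : ℕ) : IsPoly (heavyCost d) :=
  (((IsPoly.const 30).mul (IsPoly.id.add (.const 1))).add (isPoly_scanCost d)).add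
    ((IsPoly.const 10).mul ((((IsPoly.const d).mul .id).mul .id).add (.const 1)))

theorem isPoly_stepCost (d : ℕ) : IsPoly (stepCost d) :=
  ((isPoly_heavyCost d).add ((IsPoly.const 3).mul (isPoly_ioCost d))).add (.const 3)

theorem isPoly_passCost (d : ℕ) : IsPoly (passCost d) :=
  (((((IsPoly.const 30).mul (IsPoly.id.add (.const 1))).add
    ((IsPoly.const 10).mul (((IsPoly.const 2).mul .id).add (.const 1)))).add
    (isPoly_ioCost d)).add (IsPoly.id.mul (((isPoly_stepCost d).add (isPoly_ioCost d)).add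
      (.const 1)))).add (.const 1)

/-- A bound for the cost of `n` passes. -/
def scheduleCost (d : ℕ) : ℕ → ℕ → ℕ
  | 0, _ => 1
  | n + 1, N => passCost d N + scheduleCost d n (2 * N)

/-- The size bound doubles with each pass, but the number `n` of passes is fixed, so this is a
finite composition and sum of polynomials. -/
theorem isPoly_scheduleCost (d n : ℕ) : IsPoly (scheduleCost d n) := by
  induction n with
  | zero => exact .const 1
  | succ n ih => exact (isPoly_passCost d).add (ih.comp ((IsPoly.const 2).mul .id))

end Program

end Cost

/-! ### The complete program -/

section Machine

open scoped Classical
open Prog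

variable {d : ℕ}

namespace Program

/-- The passes of a schedule. -/
noncomputable def scheduleProg :
    List (mergeableRels d × Finset ℕ) → Program (mergeableRels d) d
  | [] => skip
  | p :: l => .seq (passProg p.1 (downRel p.1 p.2) (sideRel p.1 p.2) (positions d p.2)
      (positions d (p.1.1.core \ p.2))) (scheduleProg l)

theorem runs_scheduleProg (l : List (mergeableRels d × Finset ℕ))
    (hl : ∀ p ∈ l, p ∈ schedule d) (F : Formula (mergeableRels d)) (k N : ℕ)
    (hFN : (encodeFormula F).length ≤ N) (hkN : (encodeNumber (mergeableRels d) k).length ≤ N)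
    (e f h : Bool) : ∃ e' f' h',
      Runs (scheduleProg l) (reg none none e f h, Mem.stk (d := d)
          { A := encodeFormula F, M := encodeNumber _ k }) (scheduleCost d l.length N)
        (reg none none e' f' h', Mem.stk
          { A := encodeFormula (l.foldl (corePass k) F), M := encodeNumber _ k }) ∧
      (encodeFormula (l.foldl (corePass k) F)).length ≤ 2 ^ l.length * N := by
  induction l generalizing F N e f h with
  | nil => exact ⟨e, f, h, runs_skip _ _, by simpa using hFN⟩
  | cons p l ih =>
    have hp := mem_schedule.1 (hl p List.mem_cons_self)
    have hcore (i : ℕ) (hi : i ∈ p.1.1.core) : i < p.1.1.arity := (BoolRel.mem_core.1 hi).1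
    obtain ⟨e₁, f₁, h₁, r₁⟩ := runs_passProg (fun R hR => (mem_mergeableRels.1 hR).1) p.1
      (downRel p.1 p.2) (sideRel p.1 p.2) rfl rfl (positions d p.2)
      (positions d (p.1.1.core \ p.2)) (length_positions_le _ _) (length_positions_le _ _)
      (fun i hi => hcore _ (hp.2.1 (mem_positions.1 hi)))
      (fun i hi => hcore _ (Finset.mem_sdiff.1 (mem_positions.1 hi)).1) F k N hFN hkN e f h
    obtain ⟨e₂, f₂, h₂, r₂, hlen⟩ := ih (fun q hq => hl q (List.mem_cons_of_mem _ hq))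
      (corePass k F p) (2 * N)
      ((length_encodeFormula_pass_le p.1 (downRel p.1 p.2) (sideRel p.1 p.2) rfl rfl _ _ k F).trans
        (Nat.mul_le_mul_left 2 hFN)) (by omega) e₁ f₁ h₁
    refine ⟨e₂, f₂, h₂, r₁.seq r₂, hlen.trans_eq ?_⟩
    rw [List.length_cons, pow_succ, mul_assoc]

/-- The program that computes the kernel. -/
noncomputable def kernelProg (d : ℕ) : Program (mergeableRels d) d :=
  .seq (move .T [.A]) (.seq (transferNum .A [.M]) (.seq (scheduleProg (schedule d))
    (transferAll .M [])))

theorem runs_kernelProg (F : Formula (mergeableRels d)) (k : ℕ) : ∃ v,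
    Runs (kernelProg d) (reg none none false false false,
        only Stk.T (encodeInstance (F, k)).reverse)
      (5 * ((encodeInstance (F, k)).length + 1) + (10 * ((encodeInstance (F, k)).length + 1) +
        (scheduleCost d (schedule d).length (encodeInstance (F, k)).length +
          10 * ((encodeInstance (F, k)).length + 1))))
      (v, only Stk.A (encodeFormula (kernel k F))) := by
  set N := (encodeInstance (F, k)).length with hN
  have hN' : N = (encodeNumber (mergeableRels d) k).length + (encodeFormula F).length := by
    rw [hN, encodeInstance, List.length_append]
  -- Loading left the input reversed on `T`; a single move, which reverses again, restores it on
  -- `A`.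
  have h₁ := runs_move (reg none none false false false)
    (only (Stk.T (d := d)) (encodeInstance (F, k)).reverse)
    (Mem.stk { A := encodeInstance (F, k) }) .T [.A] (by simp) (by simp) (by simp) (fun k => by
      rcases k with _ | _ | _ | _ | _ | _ | _ | _ | _ | _ | _ | ⟨_ | _, j⟩ <;> simp [Mem.stk, only])
  have h₂ := runs_transferNum (reg none none false false false)
    (Mem.stk (d := d) { A := encodeInstance (F, k) })
    (Mem.stk { A := encodeFormula F, M := encodeNumber _ k }) .A [.M] (by simp) (by simp) (by simp)
    (by simp) rfl k N (encodeFormula F) rfl (by omega) (fun k => by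
      rcases k with _ | _ | _ | _ | _ | _ | _ | _ | _ | _ | _ | ⟨_ | _, j⟩ <;> simp [Mem.stk])
  obtain ⟨e, f, h, h₃, -⟩ := runs_scheduleProg (schedule d) (fun _ h => h) F k N (by omega)
    (by omega) false false false
  have h₄ := runs_transferAll (reg none none e f h)
    (Mem.stk { A := encodeFormula (kernel k F), M := encodeNumber _ k })
    (only (Stk.A (d := d)) (encodeFormula (kernel k F))) .M [] (by simp) (by simp) (by simp)
    (by simp) rfl N (by change (encodeNumber (mergeableRels d) k).length ≤ N; omega) (fun k => by
      rcases k with _ | _ | _ | _ | _ | _ | _ | _ | _ | _ | _ | ⟨_ | _, j⟩ <;> simp [Mem.stk, only])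
  refine ⟨_, (h₁.seq (h₂.seq (h₃.seq h₄))).mono (le_of_eq ?_)⟩
  simp [only, hN]

end Program

end Machine

/-! ### Embedding formulas into the larger language -/

section Lift

variable {G G' : Finset BoolRel}

/-- A constraint over `G` as a constraint over a larger language. -/
def Constraint.lift (h : G ⊆ G') (c : Constraint G) : Constraint G' :=
  ⟨⟨c.rel.1, h c.rel.2⟩, c.args⟩

/-- A formula over `G` as a formula over a larger language. -/
def Formula.lift (h : G ⊆ G') (F : Formula G) : Formula G' :=
  F.map (Constraint.lift h)

/-- A symbol for `G` as a symbol for a larger language. -/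
def Symb.lift (h : G ⊆ G') : Symb G → Symb G'
  | .rel R => .rel ⟨R.1, h R.2⟩
  | .bit b => .bit b
  | .comma => .comma

theorem encodeNumber_lift (h : G ⊆ G') (n : ℕ) :
    (encodeNumber G n).map (Symb.lift h) = encodeNumber G' n := by
  simp only [encodeNumber, List.map_append, List.map_map, List.map_cons, List.map_nil]
  rfl

theorem encodeInstance_lift (h : G ⊆ G') (F : Formula G) (k : ℕ) :
    (encodeInstance (F, k)).map (Symb.lift h) = encodeInstance (F.lift h, k) := by
  have hc (c : Constraint G) :
      (encodeConstraint c).map (Symb.lift h) = encodeConstraint (c.lift h) := by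
    simp only [encodeConstraint, List.map_cons, List.map_flatMap, encodeNumber_lift]
    rfl
  simp only [encodeInstance, encodeFormula, Formula.lift, List.map_append, List.map_flatMap, hc,
    encodeNumber_lift, List.flatMap_map]

theorem Formula.vars_lift (h : G ⊆ G') (F : Formula G) : (F.lift h).vars = F.vars := by
  simp only [Formula.vars, Formula.lift, List.flatMap_map]
  rfl

theorem Formula.satisfies_lift (h : G ⊆ G') (F : Formula G) (φ : ℕ → Bool) :
    (F.lift h).Satisfies φ ↔ F.Satisfies φ := by
  simp only [Formula.Satisfies, Formula.lift, List.forall_mem_map]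
  rfl

end Lift

/-- Passing to the larger language costs nothing: the symbols are translated by `Symb.lift` while
the machine loads its input, and this commutes with the encodings. -/
theorem polyTimeComputable_kernel {d : ℕ} {G : Finset BoolRel} (h : G ⊆ mergeableRels d) :
    PolyTimeComputable (encodeInstance (Γ := G)) encodeFormula
      fun p => kernel p.2 (p.1.lift h) := by
  have hp : IsPoly fun N => 5 * (N + 1) + (10 * (N + 1) +
      (Program.scheduleCost d (schedule d).length N + 10 * (N + 1))) := by
    have h : IsPoly fun N => N + 1 := IsPoly.id.add (.const 1)
    exact ((IsPoly.const 5).mul h).add (((IsPoly.const 10).mul h).add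
      ((Program.isPoly_scheduleCost d _).add ((IsPoly.const 10).mul h)))
  obtain ⟨T, hT⟩ := hp
  refine Prog.polyTimeComputable_of_runs (Program.kernelProg d)
    (reg none none false false false) (Symb.lift h) .T .A .comma _ _ _ T fun ⟨F, k⟩ => ?_
  obtain ⟨v, hv⟩ := Program.runs_kernelProg (F.lift h) k
  refine ⟨v, ?_⟩
  rw [← encodeInstance_lift, List.length_map] at hv
  rw [hT]
  exact hv

end MinOnes

theorem mainTheorem3 (Γ : Finset MinOnes.BoolRel) (hΓ : MinOnes.MergeableLanguage Γ) :
    ∃ Γ' : Finset MinOnes.BoolRel,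
      Γ ⊆ Γ' ∧ MinOnes.MergeableLanguage Γ' ∧ MinOnes.maxArity Γ' = MinOnes.maxArity Γ ∧
      ∃ (C : ℕ) (f : MinOnes.Formula Γ × ℕ → MinOnes.Formula Γ'),
        MinOnes.PolyTimeComputable MinOnes.encodeInstance MinOnes.encodeFormula f ∧
        ∀ (F : MinOnes.Formula Γ) (k : ℕ),
          (f (F, k)).vars ⊆ F.vars ∧
          (∀ φ : ℕ → Bool, F.weight φ ≤ k → (F.Satisfies φ ↔ (f (F, k)).Satisfies φ)) ∧
          ∀ R : Γ', ¬ R.1.ZeroValid →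
            ((f (F, k)).cores R).ncard ≤ C * (max k 1) ^ MinOnes.maxArity Γ := by
  have hsub : Γ ⊆ MinOnes.mergeableRels (MinOnes.maxArity Γ) := fun R hR =>
    MinOnes.mem_mergeableRels.2 ⟨Finset.le_sup (f := MinOnes.BoolRel.arity) hR, hΓ R hR⟩
  refine ⟨_, hsub, fun R hR => (MinOnes.mem_mergeableRels.1 hR).2,
    le_antisymm (Finset.sup_le fun R hR => (MinOnes.mem_mergeableRels.1 hR).1)
      (Finset.sup_mono hsub), _, _, MinOnes.polyTimeComputable_kernel hsub, fun F k => ⟨?_, ?_,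
      fun R hR => MinOnes.ncard_cores_kernel_le k (F.lift hsub) hR⟩⟩
  · exact (MinOnes.vars_foldl_corePass_subset k _ _).trans (F.vars_lift hsub).subset
  · intro φ hφ
    rw [← F.satisfies_lift hsub]
    -- The set `T` consists of the true variables of the original formula, so its size is the weight
    -- of `φ`.
    refine MinOnes.satisfies_foldl_corePass (fun _ h => h)
      (T := F.vars.filter fun x => φ x = true) (fun x hx hφx => ?_) hφ
    rw [F.vars_lift hsub] at hx
    exact Finset.mem_filter.2 ⟨hx, hφx⟩
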